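/- **Setting.** Let $d\ge 1$, $\widehat f(\xi)=\mathcal F f(\xi)=\int_{\mathbb R^d} f(x)e^{-2\pi i x\cdot\xi}\,dx$, $M_bf(x)=e^{2\pi i b\cdot x}f(x)$, and let $\mathcal O\subset\mathbb R^d$ be open with complement of Lebesgue measure zero. *Covers.* Let $\mathcal Q=(Q_i)_{i\in I}=(S_i(Q_i'))_{i\in I}$, $S_i\xi=A_i\xi+b_i$, $A_i\in GL(d,\mathbb R)$, $b_i\in\mathbb R^d$, be an affinely generated cover of $\mathcal O$. That is: the $Q_i'$ are open and uniformly bounded, the $Q_i$ are non-empty with $\bigcup_i Q_i=\mathcal O$, $N_{\mathcal Q}:=\sup_i|i^*|<\infty$ for $i^*:=\{\ell: Q_\ell\cap Q_i\ne\emptyset\}$, $\sup_{i}\sup_{\ell\in i^*}\|A_i^{-1}A_\ell\|<\infty$, and there are open sets $Q_i''$ with $\overline{Q_i''}\subset Q_i'$, $\mathcal O\subset\bigcup_i S_i(Q_i'')$, such that $\{Q_i'\}$ and $\{Q_i''\}$ are finite collections of sets. A weight $w=(w_i)$ in $(0,\infty)$ is $\mathcal Q$-moderate if $\sup_i\sup_{\ell\in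 i^*}w_i/w_\ell<\infty$. *Partition of unity.* Let $\Phi=(\varphi_i)_{i\in I}$ be a regular partition of unity subordinate to $\mathcal Q$: $\varphi_i\in C_c^\infty(\mathcal O)$, $\sum_i\varphi_i=1$ on $\mathcal O$, $\varphi_i=0$ on $\mathcal O\setminus Q_i$, and $C_{\mathcal Q,\Phi,\alpha}:=\sup_i\|\partial^\alpha(\varphi_i\circ S_i)\|_{L^\infty}<\infty$ for every multi-index $\alpha$. Put $C_\Phi:=\sup_i\|\mathcal F^{-1}\varphi_i\|_{L^1}$ and $\varphi_i^*:=\sum_{\ell\in i^*}\varphi_\ell$. *Spaces.* $Z(\mathcal O)=\mathcal F(C_c^\infty(\mathcal O))$, with the topology transported from $C_c^\infty(\mathcal O)$, $Z'(\mathcal O)$ is its dual, and $\widehat f:=f\circ\mathcal F\in\mathcal D'(\mathcal O)$ for $f\in Z'(\mathcal O)$. For $p,q\in[1,\infty]$ let $\mathcal D(\mathcal Q,L^p,\ell^q_w)$ be the space of all $f\in Z'(\mathcal O)$ with $\|f\|:=\big\|\big(w_i\|\mathcal F^{-1}(\varphi_i\widehat f)\|_{L^p}\big)_i\big\|_{\ell^q}<\infty$.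 *Multipliers.* A continuous $h:\mathcal O\to\mathbb C$ is tame if $\sup_i\|\mathcal F^{-1}(\varphi_ih)\|_{L^1}<\infty$; then $\Phi_hf:=\sum_i\mathcal F^{-1}(\varphi_i^*h)*\mathcal F^{-1}(\varphi_i\widehat f)$, with unconditional convergence in $Z'(\mathcal O)$, for $f$ in any of these spaces. *Systems.* For a countable set $J$, $C_j\in GL(d,\mathbb R)$ and $g_j\in L^1\cap L^2$ with $\widehat{g_j}\in C^\infty$, put $t_0:=\sum_{j\in J}|\det C_j|^{-1}|\widehat{g_j}|^2$ and $g^\natural_{i,j}:=|\det A_i|^{-1}(M_{-b_i}g_j)\circ A_i^{-t}$. Let $$C_d:=\frac{3(d+1)^{3/2}2^{d+1}}{\pi^d}\left(\frac{\frac{0.8}{e}(d+1)^2}{\ln(2+d)}\right)^{d+1}.$$ **(1)** Suppose there are $A,B>0$ with $A\le t_0\le B$ almost everywhere and that $$M:=\sup_{i\in I}\sum_{j\in J}|\det C_j|^{-1}\Big\|\max_{|\nu|\le d+1}\big|\partial^\nu|\mathcal F g^\natural_{i,j}|^2\big|\Big\|_{L^{d+1}(Q_i')}<\infty .$$ Then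 $t_0$ is continuous on $\mathcal O$ and tame, $A\le t_0(\xi)\le B$ for all $\xi\in\mathcal O$, and for all $p,q\in[1,\infty]$ and all $\mathcal Q$-moderate $w$ the operator $T_0:=\Phi_{t_0}$ on $\mathcal D(\mathcal Q,L^p,\ell^q_w)$ is well defined, bounded and boundedly invertible, with $$\|T_0^{-1}\|\le C_d\,N_{\mathcal Q}^2\,C_\Phi\Big[\max_{|\alpha|\le d+1}C_{\mathcal Q,\Phi,\alpha}\Big]A^{-1}\Big(\frac MA\Big)^{d+1}.$$ **(2)** Let the cover $\mathcal Q=(S_j(Q_j'))_{j\in J}$ be indexed by a countable set $J$, let $\delta>0$, $C_j:=\delta A_j^{-t}$ and $g_j:=|\det A_j|^{1/2}M_{b_j}[g\circ A_j^t]$, where $g\in L^1\cap L^2$ and $\widehat g\in C^\infty$. Suppose there is $A'>0$ with $A'\le\sum_{j}|\widehat g(S_j^{-1}\xi)|^2$ for almost all $\xi\in\mathcal O$, with the series convergent, and that $$M_0:=\sup_{i\in J}\sum_{j\in J}\max\{1,\|A_j^{-1}A_i\|^{d+1}\}\Big(\int_{Q_i'}\max_{|\alpha|\le d+1}\big|(\partial^\alpha\widehat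 g)(S_j^{-1}(S_i\xi))\big|^{2(d+1)}d\xi\Big)^{1/(d+1)}<\infty .$$ Then $t_0$ is continuous on $\mathcal O$ and tame, $A'\le\sum_{j}|\widehat g(S_j^{-1}\xi)|^2<\infty$ for all $\xi\in\mathcal O$, and for all $p,q\in[1,\infty]$ and all $\mathcal Q$-moderate $w$ the operator $T_0:=\Phi_{t_0}$ on $\mathcal D(\mathcal Q,L^p,\ell^q_w)$ is well defined, bounded and boundedly invertible, with $$\|T_0^{-1}\|\le C_d\,(2d)^{(d+1)^2}\,N_{\mathcal Q}^2\,C_\Phi\Big[\max_{|\alpha|\le d+1}C_{\mathcal Q,\Phi,\alpha}\Big](A')^{-1}\Big(\frac{M_0}{A'}\Big)^{d+1}\delta^d .$$ -/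

import Mathlib

open MeasureTheory Set Filter Topology TopologicalSpace
open scoped ENNReal NNReal FourierTransform ContDiff Distributions

universe u v

namespace GSI

/-- The Euclidean space `ℝ^d`, used both for the time domain and for the Fourier domain. -/
abbrev Rd (d : ℕ) : Type := EuclideanSpace ℝ (Fin d)

section Derivatives

/-- The partial derivative `∂_l f`. -/
noncomputable def partialDeriv {d : ℕ} {F : Type*} [NormedAddCommGroup F] [NormedSpace ℝ F]
    (l : Fin d) (f : Rd d → F) : Rd d → F :=
  fun x => fderiv ℝ f x (EuclideanSpace.single l (1 : ℝ))

/-- The partial derivative `∂^ν f = ∂_1^{ν_1} ⋯ ∂_d^{ν_d} f` for a multi-index `ν`. -/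
noncomputable def multiDeriv {d : ℕ} {F : Type*} [NormedAddCommGroup F] [NormedSpace ℝ F]
    (ν : Fin d → ℕ) (f : Rd d → F) : Rd d → F :=
  (List.finRange d).foldr (fun l h => (partialDeriv l)^[ν l] h) f

/-- `max_{|ν| ≤ n} |∂^ν f (x)|`, as an extended nonnegative number. -/
noncomputable def maxDeriv {d : ℕ} {F : Type*} [NormedAddCommGroup F] [NormedSpace ℝ F]
    (n : ℕ) (f : Rd d → F) (x : Rd d) : ℝ≥0∞ :=
  ⨆ ν : {ν : Fin d → ℕ // ∑ l, ν l ≤ n}, ‖multiDeriv ν.1 f x‖ₑ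

end Derivatives

section Covers

/-- The index cluster `i* = {ℓ : Q_ℓ ∩ Q_i ≠ ∅}`. -/
def neighbors {d : ℕ} {I : Type*} (Q : I → Set (Rd d)) (i : I) : Set I :=
  {l | (Q l ∩ Q i).Nonempty}

/-- `N_Q = sup_i |i*|`. -/
noncomputable def coverNumber {d : ℕ} {I : Type*} (Q : I → Set (Rd d)) : ℕ∞ :=
  ⨆ i, (neighbors Q i).encard

/-- Admissible covers of the (nonempty) open set `O`. -/
structure IsAdmissibleCover {d : ℕ} {I : Type*} (O : Opens (Rd d)) (Q : I → Set (Rd d)) :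
    Prop where
  nonempty : (O : Set (Rd d)).Nonempty
  cover : ⋃ i, Q i = (O : Set (Rd d))
  nonempty_piece : ∀ i, (Q i).Nonempty
  finite_number : coverNumber Q < ⊤

/-- The affine map `S ξ = A ξ + b` with invertible linear part `A`. -/
def affMap {d : ℕ} (A : Rd d ≃L[ℝ] Rd d) (b : Rd d) (ξ : Rd d) : Rd d := A ξ + b

/-- The inverse `S⁻¹ ξ = A⁻¹ (ξ - b)` of `affMap A b`. -/
def affMapInv {d : ℕ} (A : Rd d ≃L[ℝ] Rd d) (b : Rd d) (ξ : Rd d) : Rd d := A.symm (ξ - b)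

/-- The family `Q_i = S_i (Q_i') = A_i (Q_i') + b_i`. -/
def affCover {d : ℕ} {I : Type*} (A : I → Rd d ≃L[ℝ] Rd d) (b : I → Rd d)
    (Q' : I → Set (Rd d)) (i : I) : Set (Rd d) :=
  affMap (A i) (b i) '' Q' i

/-- `(S_i (Q_i'))_i` is an affinely generated cover of `O`. -/
structure IsAffinelyGeneratedCover {d : ℕ} {I : Type*} (O : Opens (Rd d))
    (A : I → Rd d ≃L[ℝ] Rd d) (b : I → Rd d) (Q' : I → Set (Rd d)) : Prop where
  isOpen : ∀ i, IsOpen (Q' i)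
  admissible : IsAdmissibleCover O (affCover A b Q')
  bounded : ∃ R : ℝ, ∀ i, ∀ ξ ∈ Q' i, ‖ξ‖ ≤ R
  compatible : ∃ C : ℝ, ∀ i, ∀ l ∈ neighbors (affCover A b Q') i,
    ‖((A i).symm : Rd d →L[ℝ] Rd d) ∘L (A l : Rd d →L[ℝ] Rd d)‖ ≤ C
  exists_shrinking : ∃ Q'' : I → Set (Rd d), (∀ i, IsOpen (Q'' i)) ∧
    (∀ i, closure (Q'' i) ⊆ Q' i) ∧
    ((O : Set (Rd d)) ⊆ ⋃ i, affCover A b Q'' i) ∧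
    (range Q').Finite ∧ (range Q'').Finite

/-- `Q`-moderate weights. -/
structure IsModerate {d : ℕ} {I : Type*} (Q : I → Set (Rd d)) (w : I → ℝ) : Prop where
  pos : ∀ i, 0 < w i
  moderate : ∃ C : ℝ, ∀ i, ∀ l ∈ neighbors Q i, w i / w l ≤ C

/-- `C_{Q,Φ,α} = sup_i ‖∂^α (φ_i ∘ S_i)‖_{L^∞}`. -/
noncomputable def regularityConst {d : ℕ} {I : Type*} {O : Opens (Rd d)}
    (A : I → Rd d ≃L[ℝ] Rd d) (b : I → Rd d) (φ : I → 𝓓(O, ℂ)) (α : Fin d → ℕ) : ℝ≥0∞ :=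
  ⨆ i, eLpNorm (multiDeriv α (fun ξ => φ i (affMap (A i) (b i) ξ))) ⊤ volume

/-- `max_{|α| ≤ n} C_{Q,Φ,α}`. -/
noncomputable def maxRegularityConst {d : ℕ} {I : Type*} {O : Opens (Rd d)} (n : ℕ)
    (A : I → Rd d ≃L[ℝ] Rd d) (b : I → Rd d) (φ : I → 𝓓(O, ℂ)) : ℝ≥0∞ :=
  ⨆ α : {α : Fin d → ℕ // ∑ l, α l ≤ n}, regularityConst A b φ α.1

/-- Regular partitions of unity subordinate to `(S_i (Q_i'))_i`; the smoothness of the `φ_i` and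
the compactness of their supports inside `O` are part of the type `𝓓(O, ℂ)`. -/
structure IsRegularPartition {d : ℕ} {I : Type*} {O : Opens (Rd d)}
    (A : I → Rd d ≃L[ℝ] Rd d) (b : I → Rd d) (Q' : I → Set (Rd d)) (φ : I → 𝓓(O, ℂ)) :
    Prop where
  sum_eq_one : ∀ ξ ∈ O, HasSum (fun i => φ i ξ) 1
  eq_zero : ∀ i, ∀ ξ ∈ O, ξ ∉ affCover A b Q' i → φ i ξ = 0
  regular : ∀ α : Fin d → ℕ, regularityConst A b φ α < ⊤

/-- `C_Φ = sup_i ‖𝓕⁻ φ_i‖_{L^1}`. -/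
noncomputable def bapuConst {d : ℕ} {I : Type*} {O : Opens (Rd d)} (φ : I → 𝓓(O, ℂ)) : ℝ≥0∞ :=
  ⨆ i, eLpNorm (𝓕⁻ (φ i : Rd d → ℂ)) 1 volume

/-- Tameness (with respect to `(φ_i)_i`) of a function that is continuous on `O`:
`sup_i ‖𝓕⁻ (φ_i h)‖_{L^1} < ∞`. -/
def IsTame {d : ℕ} {I : Type*} {O : Opens (Rd d)} (φ : I → 𝓓(O, ℂ)) (h : Rd d → ℂ) : Prop :=
  ContinuousOn h O ∧ ⨆ i, eLpNorm (𝓕⁻ (fun ξ => φ i ξ * h ξ)) 1 volume < ⊤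

end Covers

section FourierDistributions

theorem integrable_test {d : ℕ} {O : Opens (Rd d)} (θ : 𝓓(O, ℂ)) :
    Integrable (θ : Rd d → ℂ) volume :=
  θ.continuous.integrable_of_hasCompactSupport θ.hasCompactSupport

/-- The Fourier transform as a linear map on test functions. -/
noncomputable def testFourierLM {d : ℕ} (O : Opens (Rd d)) : 𝓓(O, ℂ) →ₗ[ℂ] (Rd d → ℂ) where
  toFun θ := 𝓕 (θ : Rd d → ℂ)
  map_add' θ η := VectorFourier.fourierIntegral_add Real.continuous_fourierChar
    continuous_inner (integrable_test θ) (integrable_test η)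
  map_smul' c _ := VectorFourier.fourierIntegral_const_smul _ _ _ _ c

/-- The Fourier test function space `Z(O) = 𝓕 (C_c^∞(O))`. -/
def FourierTestSpace {d : ℕ} (O : Opens (Rd d)) : Type :=
  LinearMap.range (testFourierLM O)

noncomputable instance {d : ℕ} (O : Opens (Rd d)) : AddCommGroup (FourierTestSpace O) :=
  inferInstanceAs (AddCommGroup (LinearMap.range (testFourierLM O)))

noncomputable instance {d : ℕ} (O : Opens (Rd d)) : Module ℂ (FourierTestSpace O) :=
  inferInstanceAs (Module ℂ (LinearMap.range (testFourierLM O)))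

/-- The function underlying an element of `Z(O)`. -/
def FourierTestSpace.toFun {d : ℕ} {O : Opens (Rd d)} (u : FourierTestSpace O) : Rd d → ℂ :=
  Subtype.val u

/-- The Fourier transform `𝓕 : C_c^∞(O) → Z(O)`. -/
noncomputable def testFourier {d : ℕ} (O : Opens (Rd d)) : 𝓓(O, ℂ) →ₗ[ℂ] FourierTestSpace O :=
  (testFourierLM O).rangeRestrict

/-- `Z(O)` carries the topology transported from `C_c^∞(O)` by the (bijective) Fourier transform. -/
noncomputable instance {d : ℕ} (O : Opens (Rd d)) : TopologicalSpace (FourierTestSpace O) :=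
  TopologicalSpace.coinduced (testFourier O) inferInstance

/-- The Fourier transform `𝓕 : C_c^∞(O) → Z(O)` as a continuous linear map. -/
noncomputable def testFourierCLM {d : ℕ} (O : Opens (Rd d)) :
    𝓓(O, ℂ) →L[ℂ] FourierTestSpace O :=
  ⟨testFourier O, continuous_coinduced_rng⟩

/-- The space `Z'(O)` of Fourier distributions, the topological dual of `Z(O)`. -/
def FourierDistribution {d : ℕ} (O : Opens (Rd d)) : Type := FourierTestSpace O →L[ℂ] ℂ

noncomputable instance {d : ℕ} (O : Opens (Rd d)) : AddCommGroup (FourierDistribution O) :=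
  inferInstanceAs (AddCommGroup (FourierTestSpace O →L[ℂ] ℂ))

noncomputable instance {d : ℕ} (O : Opens (Rd d)) : Module ℂ (FourierDistribution O) :=
  inferInstanceAs (Module ℂ (FourierTestSpace O →L[ℂ] ℂ))

/-- The bilinear pairing `⟨f, u⟩` of `f ∈ Z'(O)` and `u ∈ Z(O)`. -/
noncomputable def FourierDistribution.pair {d : ℕ} {O : Opens (Rd d)} (f : FourierDistribution O)
    (u : FourierTestSpace O) : ℂ :=
  (show FourierTestSpace O →L[ℂ] ℂ from f) u

/-- The Fourier transform `𝓕 f = f ∘ 𝓕 ∈ 𝓓'(O)` of a Fourier distribution `f ∈ Z'(O)`. -/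
noncomputable def FourierDistribution.fourier {d : ℕ} {O : Opens (Rd d)}
    (f : FourierDistribution O) : 𝓓(O, ℂ) →L[ℂ] ℂ :=
  (show FourierTestSpace O →L[ℂ] ℂ from f) ∘L testFourierCLM O

/-- The test function `φ · e_x`, where `e_x(ξ) = exp(2πi x·ξ)`. -/
noncomputable def expTest {d : ℕ} {O : Opens (Rd d)} (φ : 𝓓(O, ℂ)) (x : Rd d) : 𝓓(O, ℂ) where
  toFun ξ := φ ξ * Complex.exp (2 * Real.pi * Complex.I * (inner ℝ x ξ : ℝ))
  contDiff' := by
    have h := φ.contDiff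
    refine h.mul (ContDiff.cexp (contDiff_const.mul ?_))
    exact Complex.ofRealCLM.contDiff.comp (contDiff_const.inner ℝ contDiff_id)
  hasCompactSupport' := φ.hasCompactSupport.mul_right
  tsupport_subset' := (tsupport_mul_subset_left).trans φ.tsupport_subset

/-- `𝓕⁻ (φ · 𝓕 f)` for `φ ∈ C_c^∞(O)` and `f ∈ Z'(O)`: the inverse Fourier transform of the
compactly supported distribution `φ · 𝓕 f`, that is, the smooth function
`x ↦ (φ · 𝓕 f)(e_x) = (𝓕 f)(φ · e_x)`. -/
noncomputable def localize {d : ℕ} {O : Opens (Rd d)} (φ : 𝓓(O, ℂ)) (f : FourierDistribution O) :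
    Rd d → ℂ :=
  fun x => f.fourier (expTest φ x)

theorem localize_add {d : ℕ} {O : Opens (Rd d)} (φ : 𝓓(O, ℂ)) (f g : FourierDistribution O) :
    localize φ (f + g) = localize φ f + localize φ g := rfl

theorem localize_smul {d : ℕ} {O : Opens (Rd d)} (φ : 𝓓(O, ℂ)) (c : ℂ)
    (f : FourierDistribution O) : localize φ (c • f) = c • localize φ f := rfl

theorem localize_zero {d : ℕ} {O : Opens (Rd d)} (φ : 𝓓(O, ℂ)) :
    localize φ (0 : FourierDistribution O) = 0 := rfl

theorem continuous_iteratedFDeriv_param {X Y : Type} [NormedAddCommGroup X] [NormedSpace ℝ X]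
    [NormedAddCommGroup Y] [NormedSpace ℝ Y] (n : ℕ) :
    ∀ {G : Type} [NormedAddCommGroup G] [NormedSpace ℝ G] {f : X → Y → G},
      ContDiff ℝ ∞ (Function.uncurry f) →
      Continuous (fun p : X × Y => iteratedFDeriv ℝ n (f p.1) p.2) := by
  induction n with
  | zero =>
    intro G _ _ f hf
    have : (fun p : X × Y => iteratedFDeriv ℝ 0 (f p.1) p.2) =
        (continuousMultilinearCurryFin0 ℝ Y G).symm ∘ Function.uncurry f := by
      funext p
      rw [iteratedFDeriv_zero_eq_comp]
      rfl
    rw [this]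
    exact (LinearIsometryEquiv.continuous _).comp hf.continuous
  | succ n ih =>
    intro G _ _ f hf
    have hfd : ContDiff ℝ ∞ (Function.uncurry (fun x y => fderiv ℝ (f x) y)) := by
      have h2 : ContDiff ℝ ∞ (Function.uncurry (fun (p : X × Y) (y : Y) => f p.1 y)) :=
        hf.comp ((contDiff_fst.comp contDiff_fst).prodMk contDiff_snd)
      exact h2.fderiv contDiff_snd (by simp)
    have := ih hfd
    have h3 : (fun p : X × Y => iteratedFDeriv ℝ (n + 1) (f p.1) p.2) =
        (continuousMultilinearCurryRightEquiv' ℝ n Y G).symm ∘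
          (fun p : X × Y => iteratedFDeriv ℝ n (fun y => fderiv ℝ (f p.1) y) p.2) := by
      funext p
      rw [iteratedFDeriv_succ_eq_comp_right]
      rfl
    rw [h3]
    exact (LinearIsometryEquiv.continuous _).comp this

theorem continuous_of_continuous_uncurry {X Y G : Type*} [TopologicalSpace X]
    [TopologicalSpace Y] [NormedAddCommGroup G] {K : Set Y} (hK : IsCompact K)
    (T : X → BoundedContinuousFunction Y G) (h : Continuous fun p : X × Y => T p.1 p.2)
    (h0 : ∀ x, ∀ y ∉ K, T x y = 0) : Continuous T := by
  rw [continuous_iff_continuousAt]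
  intro x₀
  rw [ContinuousAt, Metric.tendsto_nhds]
  intro ε hε
  have key : ∀ᶠ x in 𝓝 x₀, ∀ y ∈ K, dist (T x y) (T x₀ y) < ε / 2 := by
    refine hK.eventually_forall_of_forall_eventually fun y _ => ?_
    have hd : Continuous (fun p : X × Y => dist (T p.1 p.2) (T x₀ p.2)) :=
      h.dist (h.comp (continuous_const.prodMk continuous_snd))
    have := hd.tendsto (x₀, y)
    simp only [dist_self] at this
    exact this.eventually (gt_mem_nhds (half_pos hε))
  filter_upwards [key] with x hx
  refine lt_of_le_of_lt ?_ (half_lt_self hε)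
  rw [BoundedContinuousFunction.dist_le (half_pos hε).le]
  intro y
  by_cases hy : y ∈ K
  · exact (hx y hy).le
  · rw [h0 x y hy, h0 x₀ y hy, dist_self]
    exact (half_pos hε).le

theorem continuous_expTest {d : ℕ} {O : Opens (Rd d)} (φ : 𝓓(O, ℂ)) :
    Continuous (expTest φ) := by
  let K : Compacts (Rd d) := ⟨tsupport φ, φ.hasCompactSupport⟩
  have hK : (K : Set (Rd d)) ⊆ O := φ.tsupport_subset
  have hsup : ∀ x, Function.support (expTest φ x) ⊆ K := fun x =>
    (Function.support_mul_subset_left _ _).trans subset_closure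
  let ψ : Rd d → ContDiffMapSupportedIn (Rd d) ℂ ⊤ K := fun x =>
    ContDiffMapSupportedIn.of_support_subset (expTest φ x).contDiff (hsup x)
  have hψ : Continuous ψ := by
    rw [ContDiffMapSupportedIn.continuous_iff_comp]
    intro i
    have hF : ContDiff ℝ ∞ (Function.uncurry (fun x ξ : Rd d => (expTest φ x ξ : ℂ))) := by
      have h : ContDiff ℝ ∞ (φ : Rd d → ℂ) := φ.contDiff
      refine (h.comp contDiff_snd).mul (ContDiff.cexp (contDiff_const.mul ?_))
      exact Complex.ofRealCLM.contDiff.comp (contDiff_fst.inner ℝ contDiff_snd)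
    have hc := continuous_iteratedFDeriv_param i hF
    have he : ∀ x ξ, (ContDiffMapSupportedIn.structureMapCLM ℝ ⊤ i ∘ ψ) x ξ =
        iteratedFDeriv ℝ i (expTest φ x) ξ := fun x ξ => by
      rw [Function.comp_apply, ContDiffMapSupportedIn.structureMapCLM_top_apply]
      rfl
    refine continuous_of_continuous_uncurry K.isCompact _ ?_ ?_
    · simp only [he]
      exact hc
    · intro x ξ hξ
      rw [Function.comp_apply, ContDiffMapSupportedIn.structureMapCLM_top_apply]
      exact (ψ x).iteratedFDeriv_zero_on_compl hξ
  exact (TestFunction.continuous_ofSupportedIn hK).comp hψ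

theorem continuous_localize {d : ℕ} {O : Opens (Rd d)} (φ : 𝓓(O, ℂ))
    (f : FourierDistribution O) : Continuous (localize φ f) :=
  f.fourier.continuous.comp (continuous_expTest φ)

end FourierDistributions

section DecompositionSpaces

/-- The weighted norm `‖(w_i c_i)_i‖_{ℓ^q}` of a family of extended nonnegative numbers
(the `L^q`-norm for the counting measure on the index set). -/
noncomputable def weightedLqNorm {I : Type*} (w : I → ℝ) (q : ℝ≥0∞) (c : I → ℝ≥0∞) : ℝ≥0∞ :=
  letI : MeasurableSpace I := ⊤
  eLpNorm (fun i => ENNReal.ofReal (w i) * c i) q Measure.count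

theorem weightedLqNorm_zero {I : Type*} (w : I → ℝ) (q : ℝ≥0∞) :
    weightedLqNorm w q (fun _ => 0) = 0 := by
  let _ : MeasurableSpace I := ⊤
  simp only [weightedLqNorm, mul_zero]
  exact eLpNorm_zero'

theorem weightedLqNorm_mono {I : Type*} (w : I → ℝ) (q : ℝ≥0∞) {c c' : I → ℝ≥0∞}
    (h : ∀ i, c i ≤ c' i) : weightedLqNorm w q c ≤ weightedLqNorm w q c' := by
  let _ : MeasurableSpace I := ⊤
  refine eLpNorm_mono_enorm fun i => ?_
  simp only [enorm_eq_self]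
  gcongr
  exact h i

theorem weightedLqNorm_add_le {I : Type*} (w : I → ℝ) (q : ℝ≥0∞) (hq : 1 ≤ q)
    (c c' : I → ℝ≥0∞) :
    weightedLqNorm w q (fun i => c i + c' i) ≤ weightedLqNorm w q c + weightedLqNorm w q c' := by
  let _ : MeasurableSpace I := ⊤
  have h := eLpNorm_add_le (p := q) (μ := Measure.count)
    (f := fun i => ENNReal.ofReal (w i) * c i) (g := fun i => ENNReal.ofReal (w i) * c' i)
    measurable_from_top.aestronglyMeasurable measurable_from_top.aestronglyMeasurable hq
  simp only [weightedLqNorm, mul_add]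
  exact h

theorem weightedLqNorm_const_mul_le {I : Type*} (w : I → ℝ) (q : ℝ≥0∞) (a : ℝ≥0)
    (c : I → ℝ≥0∞) :
    weightedLqNorm w q (fun i => a * c i) ≤ a * weightedLqNorm w q c := by
  let _ : MeasurableSpace I := ⊤
  refine eLpNorm_le_nnreal_smul_eLpNorm_of_ae_le_mul' (Eventually.of_forall fun i => ?_) q
  simp only [enorm_eq_self]
  rw [mul_left_comm]

/-- `‖f‖_{𝓓(Q, L^p, ℓ^q_w)} = ‖(‖𝓕⁻ (φ_i · 𝓕 f)‖_{L^p})_i‖_{ℓ^q_w}` for `f ∈ Z'(O)`. -/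
noncomputable def decompENorm {d : ℕ} {I : Type*} {O : Opens (Rd d)} (φ : I → 𝓓(O, ℂ))
    (w : I → ℝ) (p q : ℝ≥0∞) (f : FourierDistribution O) : ℝ≥0∞ :=
  weightedLqNorm w q (fun i => eLpNorm (localize (φ i) f) p volume)

theorem decompENorm_zero {d : ℕ} {I : Type*} {O : Opens (Rd d)} (φ : I → 𝓓(O, ℂ))
    (w : I → ℝ) (p q : ℝ≥0∞) : decompENorm φ w p q (0 : FourierDistribution O) = 0 := by
  simp only [decompENorm, localize_zero, eLpNorm_zero]
  exact weightedLqNorm_zero w q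

theorem decompENorm_add_le {d : ℕ} {I : Type*} {O : Opens (Rd d)} (φ : I → 𝓓(O, ℂ))
    (w : I → ℝ) (p q : ℝ≥0∞) (hp : 1 ≤ p) (hq : 1 ≤ q) (f g : FourierDistribution O) :
    decompENorm φ w p q (f + g) ≤ decompENorm φ w p q f + decompENorm φ w p q g := by
  refine le_trans (weightedLqNorm_mono w q fun i => ?_) (weightedLqNorm_add_le w q hq _ _)
  rw [localize_add]
  exact eLpNorm_add_le (continuous_localize _ _).aestronglyMeasurable
    (continuous_localize _ _).aestronglyMeasurable hp

theorem decompENorm_smul_le {d : ℕ} {I : Type*} {O : Opens (Rd d)} (φ : I → 𝓓(O, ℂ))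
    (w : I → ℝ) (p q : ℝ≥0∞) (c : ℂ) (f : FourierDistribution O) :
    decompENorm φ w p q (c • f) ≤ ‖c‖ₑ * decompENorm φ w p q f := by
  refine le_trans (weightedLqNorm_mono w q fun i => ?_)
    (weightedLqNorm_const_mul_le w q ‖c‖₊ _)
  rw [localize_smul, eLpNorm_const_smul]
  rfl

/-- The decomposition space `𝓓(Q, L^p, ℓ^q_w)` as a subspace of `Z'(O)`, for `p, q ∈ [1, ∞]`. -/
noncomputable def decompSubmodule {d : ℕ} {I : Type*} {O : Opens (Rd d)} (φ : I → 𝓓(O, ℂ))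
    (w : I → ℝ) (p q : ℝ≥0∞) [hp : Fact (1 ≤ p)] [hq : Fact (1 ≤ q)] :
    Submodule ℂ (FourierDistribution O) where
  carrier := {f | decompENorm φ w p q f < ⊤}
  zero_mem' := by simp [decompENorm_zero]
  add_mem' hf hg := (decompENorm_add_le φ w p q hp.out hq.out _ _).trans_lt
    (ENNReal.add_lt_top.2 ⟨hf, hg⟩)
  smul_mem' c f hf := (decompENorm_smul_le φ w p q c f).trans_lt
    (ENNReal.mul_lt_top enorm_lt_top hf)

/-- The decomposition space `𝓓(Q, L^p, ℓ^q_w)`, for `p, q ∈ [1, ∞]`. -/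
def DecompSpace {d : ℕ} {I : Type*} {O : Opens (Rd d)} (φ : I → 𝓓(O, ℂ))
    (w : I → ℝ) (p q : ℝ≥0∞) [Fact (1 ≤ p)] [Fact (1 ≤ q)] : Type :=
  decompSubmodule φ w p q

variable {d : ℕ} {I : Type*} {O : Opens (Rd d)} (φ : I → 𝓓(O, ℂ))
    (w : I → ℝ) (p q : ℝ≥0∞) [Fact (1 ≤ p)] [Fact (1 ≤ q)]

noncomputable instance : AddCommGroup (DecompSpace φ w p q) :=
  inferInstanceAs (AddCommGroup (decompSubmodule φ w p q))

noncomputable instance : Module ℂ (DecompSpace φ w p q) :=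
  inferInstanceAs (Module ℂ (decompSubmodule φ w p q))

/-- The Fourier distribution underlying an element of the decomposition space. -/
def DecompSpace.toDist {φ : I → 𝓓(O, ℂ)} {w : I → ℝ} {p q : ℝ≥0∞} [Fact (1 ≤ p)]
    [Fact (1 ≤ q)] (f : DecompSpace φ w p q) : FourierDistribution O :=
  Subtype.val f

noncomputable instance : Norm (DecompSpace φ w p q) :=
  ⟨fun f => (decompENorm φ w p q f.toDist).toReal⟩

theorem DecompSpace.core : SeminormedSpace.Core ℂ (DecompSpace φ w p q) where
  norm_nonneg _ := ENNReal.toReal_nonneg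
  norm_smul c f := by
    have h1 : ∀ (c : ℂ) (f : DecompSpace φ w p q), ‖c • f‖ ≤ ‖c‖ * ‖f‖ := by
      intro c f
      have h := decompENorm_smul_le φ w p q c f.toDist
      have h' := ENNReal.toReal_mono (ENNReal.mul_ne_top enorm_ne_top f.2.ne) h
      rwa [ENNReal.toReal_mul, toReal_enorm] at h'
    refine le_antisymm (h1 c f) ?_
    by_cases hc : c = 0
    · subst hc
      rw [norm_zero, zero_mul]
      exact ENNReal.toReal_nonneg
    · have h2 := h1 c⁻¹ (c • f)
      rw [smul_smul, inv_mul_cancel₀ hc, one_smul, norm_inv] at h2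
      have hc' : 0 < ‖c‖ := norm_pos_iff.2 hc
      calc ‖c‖ * ‖f‖ ≤ ‖c‖ * (‖c‖⁻¹ * ‖c • f‖) := by gcongr
        _ = ‖c • f‖ := by rw [← mul_assoc, mul_inv_cancel₀ hc'.ne', one_mul]
  norm_triangle f g := by
    have h := decompENorm_add_le φ w p q Fact.out Fact.out f.toDist g.toDist
    have h' := ENNReal.toReal_mono (ENNReal.add_ne_top.2 ⟨f.2.ne, g.2.ne⟩) h
    exact h'.trans (ENNReal.toReal_add f.2.ne g.2.ne).le

noncomputable instance : SeminormedAddCommGroup (DecompSpace φ w p q) :=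
  SeminormedAddCommGroup.ofCore (DecompSpace.core φ w p q)

noncomputable instance : NormedSpace ℂ (DecompSpace φ w p q) :=
  { norm_smul_le := fun c f => ((DecompSpace.core φ w p q).norm_smul c f).le }

end DecompositionSpaces

section FourierMultipliers

/-- `φ_i^* = ∑_{ℓ ∈ i*} φ_ℓ`. -/
noncomputable def starSum {d : ℕ} {I : Type*} {O : Opens (Rd d)} (Q : I → Set (Rd d))
    (φ : I → 𝓓(O, ℂ)) (i : I) (ξ : Rd d) : ℂ :=
  ∑ᶠ l ∈ neighbors Q i, φ l ξ

/-- The function `𝓕⁻ (φ_i^* h)`. -/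
noncomputable def multiplierKernel {d : ℕ} {I : Type*} {O : Opens (Rd d)} (Q : I → Set (Rd d))
    (φ : I → 𝓓(O, ℂ)) (h : Rd d → ℂ) (i : I) : Rd d → ℂ :=
  𝓕⁻ (fun ξ => starSum Q φ i ξ * h ξ)

/-- The function `𝓕⁻ [(φ_i^* h) ⊙ (φ_i · 𝓕 f)]`, where the generalized product `⊙` of elements of
`𝓕 L^1` and `𝓕 L^p` is `u ⊙ v = 𝓕 [(𝓕⁻ u) ∗ (𝓕⁻ v)]`. -/
noncomputable def multiplierTerm {d : ℕ} {I : Type*} {O : Opens (Rd d)} (Q : I → Set (Rd d))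
    (φ : I → 𝓓(O, ℂ)) (h : Rd d → ℂ) (f : FourierDistribution O) (i : I) : Rd d → ℂ :=
  MeasureTheory.convolution (multiplierKernel Q φ h i) (localize (φ i) f)
    (ContinuousLinearMap.mul ℂ ℂ) volume

/-- `τ ∈ Z'(O)` is the Fourier distribution `u ↦ ∫ ψ u` given by the function `ψ`. -/
def IsGivenBy {d : ℕ} {O : Opens (Rd d)} (τ : FourierDistribution O) (ψ : Rd d → ℂ) : Prop :=
  ∀ u : FourierTestSpace O, Integrable (fun x => ψ x * u.toFun x) volume ∧
    τ.pair u = ∫ x, ψ x * u.toFun x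

/-- `Φ_h f` is well defined and equal to `u`: the products `(φ_i^* h) ⊙ (φ_i · 𝓕 f)` are defined as
products of elements of `𝓕 L^1` and `𝓕 L^p`, and the series
`∑_i 𝓕⁻ [(φ_i^* h) ⊙ (φ_i · 𝓕 f)]` converges unconditionally in `Z'(O)` to `u`. -/
def IsMultiplierValue {d : ℕ} {I : Type*} {O : Opens (Rd d)} (Q : I → Set (Rd d))
    (φ : I → 𝓓(O, ℂ)) (h : Rd d → ℂ) (p : ℝ≥0∞) (f u : FourierDistribution O) : Prop :=
  (∀ i, MemLp (multiplierKernel Q φ h i) 1 volume) ∧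
  (∀ i, MemLp (localize (φ i) f) p volume) ∧
  ∃ τ : I → FourierDistribution O, (∀ i, IsGivenBy (τ i) (multiplierTerm Q φ h f i)) ∧
    ∀ v : FourierTestSpace O, HasSum (fun i => (τ i).pair v) (u.pair v)

end FourierMultipliers

section Systems

/-- `|det C|` for an invertible linear map `C`. -/
noncomputable def absDet {d : ℕ} (C : Rd d ≃L[ℝ] Rd d) : ℝ :=
  |LinearMap.det (C : Rd d →ₗ[ℝ] Rd d)|

/-- The transpose `A^t`. -/
noncomputable def transpose {d : ℕ} (A : Rd d ≃L[ℝ] Rd d) : Rd d →L[ℝ] Rd d :=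
  ContinuousLinearMap.adjoint (A : Rd d →L[ℝ] Rd d)

/-- Modulation: `M_b f (x) = exp(2πi b·x) f(x)`. -/
noncomputable def modulate {d : ℕ} (b : Rd d) (f : Rd d → ℂ) (x : Rd d) : ℂ :=
  Complex.exp (2 * Real.pi * Complex.I * (inner ℝ b x : ℝ)) * f x

/-- Admissible generators: `g ∈ L^1 ∩ L^2` with `𝓕 g ∈ C^∞`. -/
structure IsGenerator {d : ℕ} (g : Rd d → ℂ) : Prop where
  memLp_one : MemLp g 1 volume
  memLp_two : MemLp g 2 volume
  contDiff_fourier : ContDiff ℝ ∞ (𝓕 g)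

/-- `t_0(ξ) = ∑_j |det C_j|⁻¹ |𝓕 g_j (ξ)|²`. -/
noncomputable def tZero {d : ℕ} {J : Type*} (C : J → Rd d ≃L[ℝ] Rd d) (g : J → Rd d → ℂ)
    (ξ : Rd d) : ℝ :=
  ∑' j, (absDet (C j))⁻¹ * ‖𝓕 (g j) ξ‖ ^ 2

/-- The localized generator `g^♮ = |det A|⁻¹ (M_{-b} g) ∘ A^{-t}`, for which
`𝓕 g^♮ = (𝓕 g)(A · + b)`. -/
noncomputable def natural {d : ℕ} (A : Rd d ≃L[ℝ] Rd d) (b : Rd d) (g : Rd d → ℂ) (x : Rd d) : ℂ :=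
  ((absDet A)⁻¹ : ℝ) * modulate (-b) g (transpose A.symm x)

/-- The quantity
`M = sup_i ∑_j |det C_j|⁻¹ ‖ max_{|ν| ≤ d+1} |∂^ν |𝓕 g^♮_{i,j}|²| ‖_{L^{d+1}(Q_i')}`. -/
noncomputable def mainTermBound {d : ℕ} {I J : Type*} (A : I → Rd d ≃L[ℝ] Rd d) (b : I → Rd d)
    (Q' : I → Set (Rd d)) (C : J → Rd d ≃L[ℝ] Rd d) (g : J → Rd d → ℂ) : ℝ≥0∞ :=
  ⨆ i, ∑' j, ENNReal.ofReal (absDet (C j))⁻¹ *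
    (∫⁻ ξ in Q' i,
      maxDeriv (d + 1) (fun η => ‖𝓕 (natural (A i) (b i) (g j)) η‖ ^ 2) ξ ^ (d + 1))
        ^ ((1 : ℝ) / (d + 1))

/-- The structured generators `g_j = |det A_j|^{1/2} M_{b_j} [g ∘ A_j^t]`. -/
noncomputable def structuredGenerator {d : ℕ} {J : Type*} (A : J → Rd d ≃L[ℝ] Rd d) (b : J → Rd d)
    (g : Rd d → ℂ) (j : J) (x : Rd d) : ℂ :=
  (Real.sqrt (absDet (A j)) : ℝ) * modulate (b j) (fun y => g (transpose (A j) y)) x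

/-- The quantity `M_0 = sup_i ∑_j max {1, ‖A_j⁻¹ A_i‖^{d+1}} ·
(∫_{Q_i'} max_{|α| ≤ d+1} |(∂^α 𝓕 g)(S_j⁻¹ (S_i ξ))|^{2(d+1)} dξ)^{1/(d+1)}`. -/
noncomputable def structuredBound {d : ℕ} {J : Type*} (A : J → Rd d ≃L[ℝ] Rd d) (b : J → Rd d)
    (Q' : J → Set (Rd d)) (g : Rd d → ℂ) : ℝ≥0∞ :=
  ⨆ i, ∑' j,
    ENNReal.ofReal
      (max 1 (‖((A j).symm : Rd d →L[ℝ] Rd d) ∘L (A i : Rd d →L[ℝ] Rd d)‖ ^ (d + 1))) *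
    (∫⁻ ξ in Q' i,
      maxDeriv (d + 1) (𝓕 g) (affMapInv (A j) (b j) (affMap (A i) (b i) ξ)) ^ (2 * (d + 1)))
        ^ ((1 : ℝ) / (d + 1))

/-- The dimensional constant
`C_d = 3 (d+1)^{3/2} 2^{d+1} π^{-d} ((0.8/e) (d+1)² / ln(2+d))^{d+1}`. -/
noncomputable def dimConst (d : ℕ) : ℝ :=
  3 * ((d : ℝ) + 1) ^ ((3 : ℝ) / 2) * 2 ^ (d + 1) / Real.pi ^ d *
    ((0.8 / Real.exp 1) * ((d : ℝ) + 1) ^ 2 / Real.log (2 + (d : ℝ))) ^ (d + 1)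

/-- For all `p, q ∈ [1, ∞]` and all `Q`-moderate weights `w`, the Fourier multiplier `Φ_h` is a
well-defined, bounded and boundedly invertible linear operator on `𝓓(Q, L^p, ℓ^q_w)`, and the
operator norm of its inverse is at most `K`. -/
def IsMultiplierInvertible {d : ℕ} {I : Type*} {O : Opens (Rd d)} (Q : I → Set (Rd d))
    (φ : I → 𝓓(O, ℂ)) (h : Rd d → ℂ) (K : ℝ≥0∞) : Prop :=
  ∀ (p q : ℝ≥0∞) [Fact (1 ≤ p)] [Fact (1 ≤ q)] (w : I → ℝ), IsModerate Q w →
    ∃ T : DecompSpace φ w p q ≃L[ℂ] DecompSpace φ w p q,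
      (∀ f : DecompSpace φ w p q, IsMultiplierValue Q φ h p f.toDist (T f).toDist) ∧
      ‖(T.symm : DecompSpace φ w p q →L[ℂ] DecompSpace φ w p q)‖ₑ ≤ K

end Systems

end GSI

/-!
In both parts the symbol is a sum `t = ∑_j h_j` of smooth nonnegative functions, `h_j = |det C_j|⁻¹
|𝓕 g_j|²`, bounded below by a positive constant `a`. It suffices to see that `t` and `1/t` are tame,
with a quantitative bound for `1/t`: the Fourier multiplier with symbol `1/t` is then a bounded
inverse of the one with symbol `t`.

**Bounds for the symbols.** For smooth `f` with compact support, `𝓕 f` decays like `(2π max_l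
|w_l|)^{-(d+1)}`, with a constant that only involves pure partial derivatives of order `d + 1`;
integrating this gives `‖𝓕 f‖_{L^1} ≤ (d+1)/π^d · L`, where `L` bounds the `L^1`-norms of `f` and of
these derivatives (`lintegral_fourier_le`). The estimate is applied to `f ∘ S_i`, which changes no
`L^1`-norm of a Fourier transform (`lintegral_fourier_comp_affMap`) and moves `f` to the uniformly
bounded set `Q_i'`. The hypotheses `M < ∞` and `M_0 < ∞` say that the derivatives of `h_j ∘ S_i` are
dominated by functions whose norms in `L^{d+1}(Q_i')` are summable over `j`, uniformly in `i`
(`IsDominatedFamily`). Thus `‖𝓕 (φ_i h_j)‖_{L^1}` is summable over `j`, uniformly in `i`; this makes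
`t` continuous by the Weierstrass M-test and tame (`IsDominatedFamily.isTame`), and the inequalities
assumed almost everywhere hold everywhere on `O`.

For `1/t`, let `τ` be a finite partial sum of the `h_j` with `τ ≥ a'` on the support of `φ_i`, where
`a' < a`. Solving the Leibniz rule for `φ_i = τ (φ_i / τ)` recursively bounds the derivatives of
`φ_i / τ` of order `k` by `k! 2^k R a'⁻¹ (m/a')^k`, where `R` and `m` bound the derivatives of `φ_i`
and `τ` (`norm_dirDeriv_iterate_quotient_le`). As `m ≥ τ ≥ a'`, the exponent may be raised to `d +
1`, and Minkowski's inequality in `L^{d+1}(Q_i')` turns `∫ m^{d+1}` into `M^{d+1}`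
(`IsDominatedFamily.lintegral_fourier_div_le`). Fatou's lemma along the partial sums and `a' → a`
give the estimate for `φ_i / t` (`IsDominatedFamily.lintegral_fourier_inv_le`), and Stirling's
formula compares the factor `(d+1)! 2^{d+1} (d+1)/π^d` with `C_d` (`mul_factorial_le_dimConst`).

**Multipliers.** The pieces `𝓕⁻ (φ_i · 𝓕 f)` of an element `f` of a decomposition space are bounded
functions, because they are band-limited and in `L^p`. For such `f` the defining series of `Φ_h f`
is locally finite on the Fourier side, and `u = Φ_h f` is characterized by duality, `(𝓕 u)(θ)` being
the integral of the Fourier transform of `φ_S h` against `𝓕⁻ (θ · 𝓕 f)` for any finite partial sum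
`φ_S` of the partition that is one on the support of `θ` (`IsMultiplierImage`). What makes this work
is that multiplication of test functions corresponds to convolution of localized pieces also for
distributions (`fourier_mulTest`). Uniqueness and linearity are then immediate, the convolution
theorem shows that multipliers with reciprocal symbols are inverse to each other
(`IsMultiplierImage.comp_eq`), and Young's inequality bounds `Φ_h` by `N_Q sup_i ‖𝓕⁻ (φ_i h)‖_{L^1}`
(`IsMultiplierImage.decompENorm_le`). The factor `N_Q C_Φ` that the asserted bound has in addition
is at least one (`one_le_coverNumber_mul_bapuConst`).

**Structured systems.** Here `h_j = δ^{-d} |𝓕 g ∘ S_j⁻¹|²`. The derivatives of `h_j ∘ S_i` in a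
coordinate direction are directional derivatives of `|𝓕 g|²` along the columns of `A_j⁻¹ A_i`, and
expanding them in partial derivatives shows that the family is dominated with the constant `δ^{-d}
(2d)^{d+1} M_0` (`isDominatedFamily_of_structuredBound_lt_top`).
-/

namespace GSI

/-! ### Directional derivatives of products and quotients -/

section DirectionalDerivatives

variable {E F : Type*} [NormedAddCommGroup E] [NormedSpace ℝ E] [NormedAddCommGroup F]
  [NormedSpace ℝ F]

/-- The directional derivative `D_v f`. For `v` a coordinate vector this is `partialDeriv`. -/
noncomputable def dirDeriv (v : E) (f : E → F) : E → F := fun x => fderiv ℝ f x v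

theorem contDiff_dirDeriv (v : E) {f : E → F} (hf : ContDiff ℝ ∞ f) :
    ContDiff ℝ ∞ (dirDeriv v f) :=
  (hf.fderiv_right (m := ∞) (by simp)).clm_apply contDiff_const

theorem contDiff_dirDeriv_iterate (v : E) {f : E → F} (hf : ContDiff ℝ ∞ f) (k : ℕ) :
    ContDiff ℝ ∞ ((dirDeriv v)^[k] f) := by
  induction k with
  | zero => exact hf
  | succ k ih =>
    rw [Function.iterate_succ_apply']
    exact contDiff_dirDeriv v ih

theorem hasCompactSupport_dirDeriv_iterate (v : E) {f : E → F} (hf : HasCompactSupport f)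
    (k : ℕ) : HasCompactSupport ((dirDeriv v)^[k] f) := by
  induction k with
  | zero => exact hf
  | succ k ih =>
    rw [Function.iterate_succ_apply']
    exact ih.fderiv_apply (𝕜 := ℝ) v

/-- Iterated directional derivatives are ordinary derivatives along lines; this transfers
one-variable rules such as the Leibniz rule. -/
theorem iteratedDeriv_line (v x : E) {f : E → F} (hf : ContDiff ℝ ∞ f) (k : ℕ) :
    iteratedDeriv k (fun s : ℝ => f (x + s • v)) = fun s => (dirDeriv v)^[k] f (x + s • v) := by
  induction k with
  | zero => simp
  | succ k ih =>
    rw [iteratedDeriv_succ, ih]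
    funext s
    rw [Function.iterate_succ_apply']
    have h1 : HasDerivAt (fun s : ℝ => x + s • v) v s := by
      simpa using ((hasDerivAt_id s).smul_const v).const_add x
    have h2 := ((contDiff_dirDeriv_iterate v hf k).differentiable (by simp)
      (x + s • v)).hasFDerivAt
    exact (h2.comp_hasDerivAt s h1).deriv

theorem dirDeriv_iterate_eq_iteratedDeriv (v x : E) {f : E → F} (hf : ContDiff ℝ ∞ f) (k : ℕ) :
    (dirDeriv v)^[k] f x = iteratedDeriv k (fun s : ℝ => f (x + s • v)) 0 := by
  rw [iteratedDeriv_line v x hf k]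
  simp

theorem contDiff_line (v x : E) {f : E → F} (hf : ContDiff ℝ ∞ f) :
    ContDiff ℝ ∞ (fun s : ℝ => f (x + s • v)) :=
  hf.comp (contDiff_const.add (contDiff_id.smul contDiff_const))

/-- The Leibniz rule. -/
theorem dirDeriv_iterate_mul {A : Type*} [NormedRing A] [NormedAlgebra ℝ A]
    (v x : E) {f g : E → A} (hf : ContDiff ℝ ∞ f) (hg : ContDiff ℝ ∞ g)
    (k : ℕ) :
    (dirDeriv v)^[k] (fun y => f y * g y) x =
      ∑ i ∈ Finset.range (k + 1),
        (k.choose i : A) * (dirDeriv v)^[i] f x * (dirDeriv v)^[k - i] g x := by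
  have hk : ((k : ℕ∞) : WithTop ℕ∞) ≤ ((⊤ : ℕ∞) : WithTop ℕ∞) := by exact_mod_cast le_top
  rw [dirDeriv_iterate_eq_iteratedDeriv v x (hf.mul hg)]
  simp_rw [dirDeriv_iterate_eq_iteratedDeriv v x hf, dirDeriv_iterate_eq_iteratedDeriv v x hg]
  exact iteratedDeriv_mul ((contDiff_line v x hf).contDiffAt.of_le hk)
    ((contDiff_line v x hg).contDiffAt.of_le hk)

theorem dirDeriv_iterate_sum {ι : Type*} (s : Finset ι) (v : E) {f : ι → E → F}
    (hf : ∀ i, ContDiff ℝ ∞ (f i)) (k : ℕ) :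
    (dirDeriv v)^[k] (fun y => ∑ i ∈ s, f i y) = fun x => ∑ i ∈ s, (dirDeriv v)^[k] (f i) x := by
  induction k with
  | zero => rfl
  | succ k ih =>
    simp_rw [Function.iterate_succ_apply']
    rw [ih]
    funext x
    simp only [dirDeriv]
    rw [fderiv_fun_sum fun i _ => (contDiff_dirDeriv_iterate v (hf i) k).differentiable (by simp) x]
    simp

theorem dirDeriv_iterate_clm {G : Type*} [NormedAddCommGroup G] [NormedSpace ℝ G]
    (L : F →L[ℝ] G) (v : E) {f : E → F} (hf : ContDiff ℝ ∞ f) (k : ℕ) :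
    (dirDeriv v)^[k] (fun y => L (f y)) = fun x => L ((dirDeriv v)^[k] f x) := by
  induction k with
  | zero => rfl
  | succ k ih =>
    simp_rw [Function.iterate_succ_apply']
    rw [ih]
    funext x
    have h := (contDiff_dirDeriv_iterate v hf k).differentiable (by simp) x
    simp only [dirDeriv]
    have := (L.hasFDerivAt.comp x h.hasFDerivAt).fderiv
    rw [Function.comp_def] at this
    rw [this]
    rfl

theorem dirDeriv_iterate_eq_iteratedFDeriv (v : E) {f : E → F} (hf : ContDiff ℝ ∞ f) (k : ℕ)
    (x : E) : (dirDeriv v)^[k] f x = iteratedFDeriv ℝ k f x (fun _ => v) := by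
  induction k generalizing x with
  | zero => simp
  | succ k ih =>
    rw [Function.iterate_succ_apply', iteratedFDeriv_succ_apply_left, dirDeriv]
    have h : (dirDeriv v)^[k] f = fun x => iteratedFDeriv ℝ k f x (fun _ => v) := funext ih
    have h2 : DifferentiableAt ℝ (iteratedFDeriv ℝ k f) x :=
      hf.differentiable_iteratedFDeriv (by exact_mod_cast (ENat.natCast_lt_top k)) x
    rw [h, fderiv_continuousMultilinear_apply_const_apply h2]
    rfl

theorem norm_dirDeriv_iterate_le (v : E) {f : E → F} (hf : ContDiff ℝ ∞ f) (k : ℕ) (x : E) :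
    ‖(dirDeriv v)^[k] f x‖ ≤ ‖iteratedFDeriv ℝ k f x‖ * ‖v‖ ^ k := by
  rw [dirDeriv_iterate_eq_iteratedFDeriv v hf]
  simpa using (iteratedFDeriv ℝ k f x).le_opNorm (fun _ => v)

theorem dirDeriv_iterate_eq_zero_of_notMem_tsupport (v : E) {f : E → F} {x : E}
    (hx : x ∉ tsupport f) (k : ℕ) : (dirDeriv v)^[k] f x = 0 := by
  have h : ∀ᶠ y in 𝓝 x, (dirDeriv v)^[k] f y = 0 := by
    induction k with
    | zero => exact notMem_tsupport_iff_eventuallyEq.1 hx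
    | succ k ih =>
      rw [Function.iterate_succ_apply']
      filter_upwards [ih.eventually_nhds] with y hy
      have : (dirDeriv v)^[k] f =ᶠ[𝓝 y] fun _ => 0 := hy
      simp [dirDeriv, this.fderiv_eq]
  exact h.self_of_nhds

theorem norm_dirDeriv_iterate_mul_le {A : Type*} [NormedRing A] [NormedAlgebra ℝ A] [NormOneClass A]
    (v x : E) {f g : E → A} (hf : ContDiff ℝ ∞ f) (hg : ContDiff ℝ ∞ g) {k : ℕ} {R m : ℝ}
    (hR : ∀ j ≤ k, ‖(dirDeriv v)^[j] f x‖ ≤ R) (hm : ∀ j ≤ k, ‖(dirDeriv v)^[j] g x‖ ≤ m) :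
    ‖(dirDeriv v)^[k] (fun y => f y * g y) x‖ ≤ 2 ^ k * (R * m) := by
  have hR0 : 0 ≤ R := (norm_nonneg _).trans (hR 0 (Nat.zero_le _))
  rw [dirDeriv_iterate_mul v x hf hg]
  calc _ ≤ ∑ i ∈ Finset.range (k + 1), (k.choose i : ℝ) * (R * m) := by
        refine norm_sum_le_of_le _ fun i hi => ?_
        have hi' : i ≤ k := by simpa [Nat.lt_succ_iff] using hi
        have hc : ‖(k.choose i : A)‖ ≤ k.choose i := Nat.norm_cast_le _ |>.trans (by simp)
        calc _ ≤ ‖(k.choose i : A)‖ * ‖(dirDeriv v)^[i] f x‖ * ‖(dirDeriv v)^[k - i] g x‖ :=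
              (norm_mul_le _ _).trans (by gcongr; exact norm_mul_le _ _)
          _ ≤ k.choose i * R * m := by
              gcongr
              · exact hR i hi'
              · exact hm _ (Nat.sub_le _ _)
          _ = _ := by ring
    _ = _ := by
        rw [← Finset.sum_mul, ← Nat.cast_sum, Nat.sum_range_choose]
        simp

/-- Bound for the derivatives of a quotient `ψ = φ / τ`. The bound follows recursively from the
Leibniz rule for `φ = ψ τ`; the constants `k! 2^k` majorize the solution of the recursion. -/
theorem norm_dirDeriv_iterate_quotient_le (v x : E) {φ ψ τ : E → ℂ} (hψ : ContDiff ℝ ∞ ψ)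
    (hτ : ContDiff ℝ ∞ τ) (hφ : φ = fun y => τ y * ψ y) {n : ℕ} {R m a : ℝ} (ha : 0 < a)
    (ham : a ≤ m) (haτ : a ≤ ‖τ x‖) (hR : ∀ j ≤ n, ‖(dirDeriv v)^[j] φ x‖ ≤ R)
    (hm : ∀ j ≤ n, ‖(dirDeriv v)^[j] τ x‖ ≤ m) :
    ∀ k ≤ n, ‖(dirDeriv v)^[k] ψ x‖ ≤ k.factorial * 2 ^ k * (R * a⁻¹ * (m / a) ^ k) := by
  have hR0 : 0 ≤ R := (norm_nonneg _).trans (hR 0 (Nat.zero_le _))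
  have hμ : 1 ≤ m / a := (one_le_div ha).2 ham
  have hμ0 : 0 ≤ m / a := zero_le_one.trans hμ
  have hm0 : 0 ≤ m := ha.le.trans ham
  intro k
  induction k using Nat.strong_induction_on with
  | _ k ih =>
  intro hk
  have hL := dirDeriv_iterate_mul v x hτ hψ k
  rw [← hφ, Finset.sum_range_succ'] at hL
  simp only [Nat.choose_zero_right, Nat.cast_one, one_mul, Function.iterate_zero, id_eq,
    Nat.sub_zero] at hL
  have hterm : ∀ i ∈ Finset.range k,
      ‖(k.choose (i + 1) : ℂ) * (dirDeriv v)^[i + 1] τ x * (dirDeriv v)^[k - (i + 1)] ψ x‖ ≤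
        a * (k.factorial * (R * a⁻¹ * (m / a) ^ k)) * 2 ^ (k - 1 - i) := by
    intro i hi
    have hi' : i < k := Finset.mem_range.1 hi
    have h1 := ih (k - (i + 1)) (by omega) (by omega)
    have h2 := hm (i + 1) (by omega)
    have h3 : (k.choose (i + 1) : ℝ) * (k - (i + 1)).factorial ≤ k.factorial := by
      rw [← Nat.choose_mul_factorial_mul_factorial (show i + 1 ≤ k by omega)]
      push_cast
      have : (1 : ℝ) ≤ (i + 1).factorial := by exact_mod_cast Nat.factorial_pos _
      rw [mul_right_comm]
      exact le_mul_of_one_le_right (by positivity) this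
    have h4 : (m / a) ^ (k - (i + 1) + 1) ≤ (m / a) ^ k := pow_le_pow_right₀ hμ (by omega)
    rw [norm_mul, norm_mul, Complex.norm_natCast]
    calc _ ≤ (k.choose (i + 1) : ℝ) * m * ((k - (i + 1)).factorial * 2 ^ (k - (i + 1)) *
          (R * a⁻¹ * (m / a) ^ (k - (i + 1)))) := by gcongr
      _ = a * (((k.choose (i + 1) : ℝ) * (k - (i + 1)).factorial) *
          (R * a⁻¹ * (m / a) ^ (k - (i + 1) + 1))) * 2 ^ (k - 1 - i) := by
          rw [show k - 1 - i = k - (i + 1) by omega, pow_succ]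
          field_simp
      _ ≤ _ := by gcongr
  have hsum : ‖∑ i ∈ Finset.range k,
      (k.choose (i + 1) : ℂ) * (dirDeriv v)^[i + 1] τ x * (dirDeriv v)^[k - (i + 1)] ψ x‖ ≤
        a * (k.factorial * (R * a⁻¹ * (m / a) ^ k)) * (2 ^ k - 1) := by
    refine (norm_sum_le_of_le _ hterm).trans ?_
    rw [← Finset.mul_sum, Finset.sum_range_reflect (fun i => (2 : ℝ) ^ i) k,
      geom_sum_eq (by norm_num)]
    norm_num
  have hR' : R ≤ a * (k.factorial * (R * a⁻¹ * (m / a) ^ k)) := by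
    have h1 : (1 : ℝ) ≤ k.factorial := by exact_mod_cast Nat.factorial_pos _
    have h2 : (1 : ℝ) ≤ (m / a) ^ k := one_le_pow₀ hμ
    calc R = a * (1 * (R * a⁻¹ * 1)) := by field_simp
      _ ≤ _ := by gcongr
  have heq : τ x * (dirDeriv v)^[k] ψ x = (dirDeriv v)^[k] φ x - ∑ i ∈ Finset.range k,
      (k.choose (i + 1) : ℂ) * (dirDeriv v)^[i + 1] τ x * (dirDeriv v)^[k - (i + 1)] ψ x := by
    rw [hL]; ring
  have hfin : a * ‖(dirDeriv v)^[k] ψ x‖ ≤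
      a * (k.factorial * 2 ^ k * (R * a⁻¹ * (m / a) ^ k)) := by
    calc a * ‖(dirDeriv v)^[k] ψ x‖ ≤ ‖τ x‖ * ‖(dirDeriv v)^[k] ψ x‖ := by gcongr
      _ = ‖τ x * (dirDeriv v)^[k] ψ x‖ := (norm_mul _ _).symm
      _ ≤ R + a * (k.factorial * (R * a⁻¹ * (m / a) ^ k)) * (2 ^ k - 1) := by
          rw [heq]
          exact (norm_sub_le _ _).trans (add_le_add (hR k hk) hsum)
      _ ≤ a * (k.factorial * (R * a⁻¹ * (m / a) ^ k)) +
          a * (k.factorial * (R * a⁻¹ * (m / a) ^ k)) * (2 ^ k - 1) := by gcongr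
      _ = _ := by ring
  exact le_of_mul_le_mul_left hfin ha

end DirectionalDerivatives

/-! ### The dimensional constant -/

section Constants

/-- The Stirling sequence `n! / (√(2n) (n/e)^n)` is decreasing and starts with `e / √2`. -/
theorem factorial_le_stirling {n : ℕ} (hn : 1 ≤ n) :
    (n.factorial : ℝ) ≤ Real.exp 1 * Real.sqrt n * (n / Real.exp 1) ^ n := by
  obtain ⟨m, rfl⟩ := Nat.exists_eq_add_of_le' hn
  have h := Stirling.stirlingSeq'_antitone (Nat.zero_le m)
  simp only [Function.comp_apply, Nat.succ_eq_add_one, zero_add, Stirling.stirlingSeq_one] at h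
  unfold Stirling.stirlingSeq at h
  have hp : (0 : ℝ) < (m + 1 : ℕ) := by positivity
  rw [div_le_iff₀ (by positivity)] at h
  refine h.trans_eq ?_
  rw [Real.sqrt_mul zero_le_two]
  field_simp

theorem log_add_two_le {d : ℕ} (hd : 1 ≤ d) : Real.log (2 + d) ≤ 0.8 * ((d : ℝ) + 1) := by
  have h1 : (1 : ℝ) ≤ d := by exact_mod_cast hd
  have h := Real.log_le_sub_one_of_pos (show (0 : ℝ) < (2 + d) / 2 by positivity)
  rw [Real.log_div (by positivity) two_ne_zero] at h
  have := Real.log_two_lt_d9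
  linarith

/-- The product of the constant `(d+1)/π^d` from the Fourier estimate and of `(d+1)! 2^{d+1}` from
the quotient estimate, bounded by means of Stirling and of `ln(2+d) ≤ 0.8 (d+1)`. -/
theorem mul_factorial_le_dimConst {d : ℕ} (hd : 1 ≤ d) :
    ((d : ℝ) + 1) / Real.pi ^ d * ((d + 1).factorial * 2 ^ (d + 1)) ≤ dimConst d := by
  have hlog : 0 < Real.log (2 + (d : ℝ)) := Real.log_pos (by
    have : (0 : ℝ) ≤ d := by positivity
    linarith)
  have hl := log_add_two_le hd
  have h1 := factorial_le_stirling (n := d + 1) (by omega)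
  push_cast at h1
  have h2 : (((d : ℝ) + 1) / Real.exp 1) ^ (d + 1) ≤
      ((0.8 / Real.exp 1) * ((d : ℝ) + 1) ^ 2 / Real.log (2 + (d : ℝ))) ^ (d + 1) := by
    refine pow_le_pow_left₀ (by positivity) ?_ _
    rw [le_div_iff₀ hlog]
    calc _ ≤ ((d : ℝ) + 1) / Real.exp 1 * (0.8 * ((d : ℝ) + 1)) := by gcongr
      _ = _ := by ring
  have h3 : Real.exp 1 ≤ 3 := Real.exp_one_lt_d9.le.trans (by norm_num)
  have h4 : ((d : ℝ) + 1) ^ ((3 : ℝ) / 2) = (d + 1) * Real.sqrt (d + 1) := by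
    rw [Real.sqrt_eq_rpow, show (3 : ℝ) / 2 = 1 + 1 / 2 by norm_num,
      Real.rpow_add (by positivity), Real.rpow_one]
  unfold dimConst
  rw [h4]
  calc _ ≤ ((d : ℝ) + 1) / Real.pi ^ d * ((3 * Real.sqrt (d + 1) *
        ((0.8 / Real.exp 1) * ((d : ℝ) + 1) ^ 2 / Real.log (2 + (d : ℝ))) ^ (d + 1)) *
          2 ^ (d + 1)) := by
        gcongr
        refine h1.trans ?_
        gcongr
    _ = _ := by ring

end Constants

/-! ### Integrability of Fourier transforms of smooth functions -/

section FourierL1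

open Real in
/-- The radial profile `min (1, (2πr)^{-(d+1)})` integrates, with respect to the maximum norm, to
`(d+1)/π^d`: the cube `{r ≤ 1/(2π)}` contributes `π^{-d}` and its complement `d π^{-d}`. -/
theorem lintegral_radial_profile {d : ℕ} (hd : 1 ≤ d) :
    ∫⁻ x : Fin d → ℝ, ENNReal.ofReal (if ‖x‖ ≤ (2 * π)⁻¹ then 1 else ((2 * π * ‖x‖) ^ (d + 1))⁻¹) =
      ENNReal.ofReal (((d : ℝ) + 1) / π ^ d) := by
  set c : ℝ := (2 * π)⁻¹ with hc
  have hc0 : 0 < c := by positivity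
  set G : ℝ → ℝ := fun r => if r ≤ c then 1 else ((2 * π * r) ^ (d + 1))⁻¹ with hG
  have : Nonempty (Fin d) := ⟨⟨0, hd⟩⟩
  have hdim : Module.finrank ℝ (Fin d → ℝ) = d := by simp
  have hu : Ioi (0 : ℝ) = Ioc 0 c ∪ Ioi c := (Ioc_union_Ioi_eq_Ioi hc0.le).symm
  have e1 : EqOn (fun y : ℝ => y ^ (d - 1) • G y) (fun y => y ^ (d - 1)) (Ioc 0 c) := by
    intro y hy
    simp [hG, hy.2]
  have e2 : EqOn (fun y : ℝ => y ^ (d - 1) • G y)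
      (fun y => (2 * π) ^ (-(d + 1 : ℝ)) * y ^ (-2 : ℝ)) (Ioi c) := by
    intro y hy
    have hy' : ¬ y ≤ c := not_le.2 hy
    have hy0 : 0 < y := hc0.trans hy
    simp only [hG, hy', if_false, smul_eq_mul]
    obtain ⟨m, rfl⟩ := Nat.exists_eq_add_of_le' hd
    rw [Real.rpow_neg (by positivity), Real.rpow_neg hy0.le]
    norm_cast
    rw [mul_pow]
    field_simp
    simp only [Nat.add_sub_cancel]
    ring
  have i1 : IntegrableOn (fun y : ℝ => y ^ (d - 1) • G y) (Ioc 0 c) :=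
    ((continuous_pow _).integrableOn_Ioc).congr_fun e1.symm measurableSet_Ioc
  have i2 : IntegrableOn (fun y : ℝ => y ^ (d - 1) • G y) (Ioi c) :=
    IntegrableOn.congr_fun
      ((integrableOn_Ioi_rpow_of_lt (by norm_num : (-2 : ℝ) < -1) hc0).const_mul _) e2.symm
      measurableSet_Ioi
  have hint : IntegrableOn (fun y : ℝ => y ^ (d - 1) • G y) (Ioi 0) := by
    rw [hu]; exact i1.union i2
  have v1 : ∫ y in Ioc 0 c, y ^ (d - 1) • G y = c ^ d / d := by
    rw [setIntegral_congr_fun measurableSet_Ioc e1, ← intervalIntegral.integral_of_le hc0.le,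
      integral_pow]
    obtain ⟨m, rfl⟩ := Nat.exists_eq_add_of_le' hd
    simp
  have v2 : ∫ y in Ioi c, y ^ (d - 1) • G y = c ^ d := by
    rw [setIntegral_congr_fun measurableSet_Ioi e2, integral_const_mul,
      integral_Ioi_rpow_of_lt (by norm_num) hc0, Real.rpow_neg (by positivity)]
    rw [show (-2 : ℝ) + 1 = -1 by norm_num, Real.rpow_neg hc0.le, Real.rpow_one,
      show ((d : ℝ) + 1) = ((d + 1 : ℕ) : ℝ) by push_cast; ring, Real.rpow_natCast, hc, pow_succ]
    field_simp
    rw [one_div, inv_pow, mul_inv_cancel₀ (by positivity)]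
  have hI := integral_fun_norm_addHaar (volume : Measure (Fin d → ℝ)) G
  have hV : (volume : Measure (Fin d → ℝ)).real (Metric.ball 0 1) = 2 ^ d := by
    rw [Measure.real, Real.volume_pi_ball _ one_pos]
    simp
  rw [hdim, hu, setIntegral_union (t := Ioi c) (disjoint_left.2 fun x hx hx' => not_lt.2 hx.2 hx')
    measurableSet_Ioi i1 i2, v1, v2, hV] at hI
  have hint' : Integrable (fun x : Fin d → ℝ => G ‖x‖) := by
    rw [integrable_fun_norm_addHaar, hdim]
    exact hint
  have hG0 : ∀ r, 0 ≤ G r := fun r => by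
    by_cases h : r ≤ c
    · simp [hG, h]
    · simp only [hG, h, if_false]
      have : 0 < r := hc0.trans (not_le.1 h)
      positivity
  rw [← ofReal_integral_eq_lintegral_ofReal hint'
    (Eventually.of_forall fun x => hG0 ‖x‖), hI]
  congr 1
  have hd0 : (d : ℝ) ≠ 0 := by positivity
  simp only [nsmul_eq_mul, smul_eq_mul, hc]
  rw [inv_pow, mul_pow]
  field_simp
  ring

theorem enorm_fourier_le_lintegral {d : ℕ} (f : Rd d → ℂ) (w : Rd d) :
    ‖𝓕 f w‖ₑ ≤ ∫⁻ ξ, ‖f ξ‖ₑ := by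
  rw [Real.fourier_eq]
  refine (enorm_integral_le_lintegral_enorm _).trans_eq (lintegral_congr fun ξ => ?_)
  rw [← ofReal_norm, ← ofReal_norm, Circle.norm_smul]

theorem integrable_of_contDiff {d : ℕ} {f : Rd d → ℂ} (hf : ContDiff ℝ ∞ f)
    (hs : HasCompactSupport f) : Integrable f :=
  hf.continuous.integrable_of_hasCompactSupport hs

theorem fourier_dirDeriv {d : ℕ} (v w : Rd d) {f : Rd d → ℂ} (hf : ContDiff ℝ ∞ f)
    (hs : HasCompactSupport f) :
    𝓕 (dirDeriv v f) w = 2 * Real.pi * Complex.I * (inner ℝ v w : ℝ) * 𝓕 f w := by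
  have hi : Integrable (fderiv ℝ f) :=
    (hf.continuous_fderiv (by simp)).integrable_of_hasCompactSupport (hs.fderiv (𝕜 := ℝ))
  have h := Real.fourier_fderiv (integrable_of_contDiff hf hs) (hf.differentiable (by simp)) hi
  have h1 := Real.fourier_continuousLinearMap_apply (a := v) (v := w) hi
  rw [h] at h1
  have h2 : dirDeriv v f = fun x => fderiv ℝ f x v := rfl
  rw [h2, ← h1]
  have h3 : (innerSL ℝ w) v = (inner ℝ v w : ℝ) := by
    rw [innerSL_apply_apply, real_inner_comm]
  simp [VectorFourier.fourierSMulRight_apply, h3]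
  ring

theorem fourier_dirDeriv_iterate {d : ℕ} (v w : Rd d) {f : Rd d → ℂ} (hf : ContDiff ℝ ∞ f)
    (hs : HasCompactSupport f) (k : ℕ) :
    𝓕 ((dirDeriv v)^[k] f) w = (2 * Real.pi * Complex.I * (inner ℝ v w : ℝ)) ^ k * 𝓕 f w := by
  induction k with
  | zero => simp
  | succ k ih =>
    rw [Function.iterate_succ_apply', fourier_dirDeriv v w (contDiff_dirDeriv_iterate v hf k)
      (hasCompactSupport_dirDeriv_iterate v hs k), ih]
    ring

/-- The `l`-th coordinate vector. -/
noncomputable abbrev coordVec {d : ℕ} (l : Fin d) : Rd d := EuclideanSpace.single l (1 : ℝ)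

open Real in
/-- The Fourier transform of a smooth compactly supported function is integrable, with a bound that
only involves the function and its pure derivatives of order `d + 1`: it decays like
`(2π max_l |w_l|)^{-(d+1)}`. -/
theorem lintegral_fourier_le {d : ℕ} (hd : 1 ≤ d) {f : Rd d → ℂ} (hf : ContDiff ℝ ∞ f)
    (hs : HasCompactSupport f) {L : ℝ≥0∞} (h0 : ∫⁻ ξ, ‖f ξ‖ₑ ≤ L)
    (h1 : ∀ l : Fin d, ∫⁻ ξ, ‖(dirDeriv (coordVec l))^[d + 1] f ξ‖ₑ ≤ L) :
    ∫⁻ w, ‖𝓕 f w‖ₑ ≤ ENNReal.ofReal (((d : ℝ) + 1) / π ^ d) * L := by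
  have : Nonempty (Fin d) := ⟨⟨0, hd⟩⟩
  rw [← lintegral_radial_profile hd,
    ← (PiLp.volume_preserving_ofLp (Fin d)).lintegral_comp_emb
      (MeasurableEquiv.toLp 2 (Fin d → ℝ)).symm.measurableEmbedding,
    ← lintegral_mul_const _ ?_]
  rotate_left
  · have hm : Measurable fun w : Rd d => ‖w.ofLp‖ :=
      (PiLp.volume_preserving_ofLp (Fin d)).measurable.norm
    exact (Measurable.ite (measurableSet_le hm measurable_const) measurable_const
      ((hm.const_mul _).pow_const _).inv).ennreal_ofReal
  refine lintegral_mono fun w => ?_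
  simp only
  split_ifs with hw
  · simpa using (enorm_fourier_le_lintegral f w).trans h0
  · obtain ⟨l, hl⟩ := Finite.exists_max fun l : Fin d => ‖w l‖
    have hnorm : ‖w.ofLp‖ = ‖w l‖ :=
      le_antisymm ((pi_norm_le_iff_of_nonneg (norm_nonneg _)).2 hl) (norm_le_pi_norm w.ofLp l)
    have hpos : 0 < ‖w.ofLp‖ := (by positivity : (0 : ℝ) < (2 * π)⁻¹).trans (not_le.1 hw)
    have hk := (enorm_fourier_le_lintegral ((dirDeriv (coordVec l))^[d + 1] f) w).trans (h1 l)
    rw [fourier_dirDeriv_iterate _ _ hf hs, enorm_mul] at hk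
    have hin : (inner ℝ (coordVec l) w : ℝ) = w l := by
      simp [coordVec, EuclideanSpace.inner_single_left]
    have he : ‖(2 * (π : ℂ) * Complex.I * ((inner ℝ (coordVec l) w : ℝ) : ℂ)) ^ (d + 1)‖ₑ =
        ENNReal.ofReal ((2 * π * ‖w.ofLp‖) ^ (d + 1)) := by
      rw [← ofReal_norm, hin, norm_pow, hnorm]
      simp [abs_of_pos Real.pi_pos]
    rw [he] at hk
    rw [ENNReal.ofReal_inv_of_pos (by positivity), mul_comm, ← div_eq_mul_inv]
    rw [ENNReal.le_div_iff_mul_le (Or.inl (by simpa using by positivity)) (Or.inl (by simp))]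
    rwa [mul_comm]

theorem eLpNorm_fourierInv {d : ℕ} (f : Rd d → ℂ) :
    eLpNorm (𝓕⁻ f) 1 volume = ∫⁻ w, ‖𝓕 f w‖ₑ := by
  rw [eLpNorm_one_eq_lintegral_enorm]
  simp_rw [Real.fourierInv_eq_fourier_neg]
  exact lintegral_neg_eq_self (fun w => ‖𝓕 f w‖ₑ)

end FourierL1

/-! ### Affine changes of variables -/

section ChangeOfVariables

variable {d : ℕ}

theorem absDet_pos (A : Rd d ≃L[ℝ] Rd d) : 0 < absDet A := by
  refine abs_pos.2 ?_
  exact A.toLinearEquiv.isUnit_det'.ne_zero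

theorem map_volume_equiv (A : Rd d ≃L[ℝ] Rd d) :
    Measure.map A (volume : Measure (Rd d)) = ENNReal.ofReal (absDet A)⁻¹ • volume := by
  have h := Measure.map_linearMap_addHaar_eq_smul_addHaar (volume : Measure (Rd d))
    (f := (A : Rd d →ₗ[ℝ] Rd d)) A.toLinearEquiv.isUnit_det'.ne_zero
  rw [abs_inv] at h
  exact h

theorem integral_comp_equiv {F : Type*} [NormedAddCommGroup F] [NormedSpace ℝ F]
    (A : Rd d ≃L[ℝ] Rd d) (f : Rd d → F) :
    ∫ x, f (A x) = (absDet A)⁻¹ • ∫ x, f x := by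
  have h := A.toHomeomorph.measurableEmbedding.integral_map (μ := volume) f
  have hm : Measure.map A.toHomeomorph (volume : Measure (Rd d)) = _ := map_volume_equiv A
  rw [hm, integral_smul_measure, ENNReal.toReal_ofReal (inv_nonneg.2 (absDet_pos A).le)] at h
  exact h.symm

theorem lintegral_comp_equiv (A : Rd d ≃L[ℝ] Rd d) (f : Rd d → ℝ≥0∞) :
    ∫⁻ x, f (A x) = ENNReal.ofReal (absDet A)⁻¹ * ∫⁻ x, f x := by
  have h := A.toHomeomorph.measurableEmbedding.lintegral_map (μ := volume) f
  have hm : Measure.map A.toHomeomorph (volume : Measure (Rd d)) = _ := map_volume_equiv A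
  rw [hm, lintegral_smul_measure] at h
  exact h.symm

/-- The transpose of an invertible map, as an invertible map. -/
noncomputable def transposeEquiv (A : Rd d ≃L[ℝ] Rd d) : Rd d ≃L[ℝ] Rd d :=
  ContinuousLinearEquiv.equivOfInverse (transpose A) (transpose A.symm)
    (fun x => by
      refine ext_inner_right ℝ fun y => ?_
      simp [transpose, ContinuousLinearMap.adjoint_inner_left])
    (fun x => by
      refine ext_inner_right ℝ fun y => ?_
      simp [transpose, ContinuousLinearMap.adjoint_inner_left])

theorem inner_transpose (A : Rd d ≃L[ℝ] Rd d) (x y : Rd d) :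
    inner ℝ (transpose A x) y = inner ℝ x (A y) :=
  ContinuousLinearMap.adjoint_inner_left _ _ _

theorem transpose_transpose_symm (A : Rd d ≃L[ℝ] Rd d) (x : Rd d) :
    transpose A (transpose A.symm x) = x :=
  (transposeEquiv A).apply_symm_apply x

theorem absDet_transposeEquiv (A : Rd d ≃L[ℝ] Rd d) : absDet (transposeEquiv A) = absDet A := by
  have h : ((transposeEquiv A : Rd d ≃L[ℝ] Rd d) : Rd d →ₗ[ℝ] Rd d) =
      LinearMap.adjoint (A : Rd d →ₗ[ℝ] Rd d) := by
    ext1 x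
    refine ext_inner_right ℝ fun y => ?_
    rw [LinearMap.adjoint_inner_left]
    exact inner_transpose A x y
  have b := EuclideanSpace.basisFun (Fin d) ℝ
  unfold absDet
  rw [h, ← LinearMap.det_toMatrix b.toBasis, LinearMap.toMatrix_adjoint b b,
    Matrix.det_conjTranspose, LinearMap.det_toMatrix]
  simp

theorem absDet_symm (A : Rd d ≃L[ℝ] Rd d) : absDet A.symm = (absDet A)⁻¹ := by
  unfold absDet
  rw [← abs_inv]
  congr 1
  exact LinearEquiv.det_coe_symm A.toLinearEquiv

/-- The Fourier transform of `f ∘ S` for an affine map `S ξ = A ξ + b`. -/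
theorem fourier_comp_affMap (A : Rd d ≃L[ℝ] Rd d) (b : Rd d) (f : Rd d → ℂ) (w : Rd d) :
    𝓕 (fun ξ => f (affMap A b ξ)) w = ((absDet A)⁻¹ : ℝ) *
      (Complex.exp (2 * Real.pi * Complex.I * (inner ℝ b (transpose A.symm w) : ℝ)) *
        𝓕 f (transpose A.symm w)) := by
  set z := transpose A.symm w with hz
  have hw : w = transpose A z := (transpose_transpose_symm A w).symm
  have h1 : 𝓕 (fun ξ => f (affMap A b ξ)) w =
      ∫ ξ, (fun η => Complex.exp (2 * Real.pi * Complex.I * (inner ℝ b z : ℝ)) *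
        (Complex.exp (((-2 * Real.pi * inner ℝ (η + b) z : ℝ) : ℂ) * Complex.I) * f (η + b)))
          (A ξ) := by
    rw [Real.fourier_eq']
    refine integral_congr_ae (Eventually.of_forall fun ξ => ?_)
    simp only [affMap, smul_eq_mul]
    rw [← mul_assoc, ← Complex.exp_add]
    congr 2
    rw [hw, real_inner_comm, inner_transpose, inner_add_left, real_inner_comm]
    push_cast
    ring
  rw [h1, integral_comp_equiv A (fun η => Complex.exp (2 * Real.pi * Complex.I *
    (inner ℝ b z : ℝ)) * (Complex.exp (((-2 * Real.pi * inner ℝ (η + b) z : ℝ) : ℂ) *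
    Complex.I) * f (η + b))), integral_const_mul, Real.fourier_eq', Complex.real_smul]
  congr 2
  exact integral_add_right_eq_self (fun η => Complex.exp (((-2 * Real.pi * inner ℝ η z : ℝ) : ℂ) *
    Complex.I) * f η) b

/-- The `L^1`-norm of the Fourier transform is invariant under affine changes of variables, so it
may be computed on the normalized sets `Q_i'` instead of `Q_i`. -/
theorem lintegral_fourier_comp_affMap (A : Rd d ≃L[ℝ] Rd d) (b : Rd d) (f : Rd d → ℂ) :
    ∫⁻ w, ‖𝓕 (fun ξ => f (affMap A b ξ)) w‖ₑ = ∫⁻ w, ‖𝓕 f w‖ₑ := by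
  have hpt : ∀ w, ‖𝓕 (fun ξ => f (affMap A b ξ)) w‖ₑ =
      ENNReal.ofReal (absDet A)⁻¹ * ‖𝓕 f ((transposeEquiv A).symm w)‖ₑ := by
    intro w
    have hexp : ‖Complex.exp (2 * Real.pi * Complex.I * (inner ℝ b (transpose A.symm w) : ℝ))‖ₑ
        = 1 := by
      rw [← ofReal_norm, show (2 * Real.pi * Complex.I * (inner ℝ b (transpose A.symm w) : ℝ) : ℂ) =
        ((2 * Real.pi * inner ℝ b (transpose A.symm w) : ℝ) : ℂ) * Complex.I by push_cast; ring,
        Complex.norm_exp_ofReal_mul_I, ENNReal.ofReal_one]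
    rw [fourier_comp_affMap, enorm_mul, enorm_mul, hexp, one_mul, ← ofReal_norm,
      Complex.norm_real, Real.norm_of_nonneg (inv_nonneg.2 (absDet_pos A).le)]
    rfl
  simp_rw [hpt]
  rw [lintegral_const_mul' _ _ ENNReal.ofReal_ne_top,
    lintegral_comp_equiv _ (fun w => ‖𝓕 f w‖ₑ), absDet_symm, absDet_transposeEquiv, inv_inv,
    ← mul_assoc, ← ENNReal.ofReal_mul (inv_nonneg.2 (absDet_pos A).le),
    inv_mul_cancel₀ (absDet_pos A).ne', ENNReal.ofReal_one, one_mul]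

end ChangeOfVariables

/-! ### Derivatives on zero sets -/

section ZeroSets

/-- Almost everywhere on the zero set of a `C^1` function, its derivative vanishes as well: on each
line the zeros with nonzero derivative are isolated. -/
theorem ae_dirDeriv_eq_zero_of_eq_zero {d : ℕ} (v : Rd d) {f : Rd d → ℂ}
    (hf : ContDiff ℝ ∞ f) : ∀ᵐ x, f x = 0 → dirDeriv v f x = 0 := by
  let L : ℝ →ₗ[ℝ] Rd d := LinearMap.toSpanSingleton ℝ (Rd d) v
  have hmeas : MeasurableSet {x | f x = 0 → dirDeriv v f x = 0} := by
    have h1 : MeasurableSet {x | f x = 0} :=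
      (isClosed_eq hf.continuous continuous_const).measurableSet
    have h2 : MeasurableSet {x | dirDeriv v f x = 0} :=
      (isClosed_eq (contDiff_dirDeriv v hf).continuous continuous_const).measurableSet
    exact h1.imp h2
  refine ae_mem_of_ae_add_linearMap_mem L volume volume hmeas fun y => ?_
  have hγ : ∀ s, HasDerivAt (fun s : ℝ => f (y + s • v)) (dirDeriv v f (y + s • v)) s := by
    intro s
    have h1 : HasDerivAt (fun s : ℝ => y + s • v) v s := by
      simpa using ((hasDerivAt_id s).smul_const v).const_add y
    exact (hf.differentiable (by simp) (y + s • v)).hasFDerivAt.comp_hasDerivAt s h1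
  filter_upwards [(countable_setOfPred_isolated_right_within
    (s := {s : ℝ | f (y + s • v) = 0})).ae_notMem volume] with s hs h0
  by_contra hne
  refine hs ⟨h0, ?_⟩
  rw [← Filter.eventually_false_iff_eq_bot]
  have hev := (hγ s).eventually_ne (c := 0) hne
  have hev' := hev.filter_mono (nhdsWithin_mono s
    (fun t ht => ne_of_gt ht.2 : {s : ℝ | f (y + s • v) = 0} ∩ Ioi s ⊆ {s}ᶜ))
  filter_upwards [hev', self_mem_nhdsWithin] with t h1 h2
  exact h1 h2.1

theorem ae_dirDeriv_iterate_eq_zero_of_eq_zero {d : ℕ} (v : Rd d) {f : Rd d → ℂ}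
    (hf : ContDiff ℝ ∞ f) (k : ℕ) : ∀ᵐ x, f x = 0 → (dirDeriv v)^[k] f x = 0 := by
  induction k with
  | zero => exact Eventually.of_forall fun x h => h
  | succ k ih =>
    filter_upwards [ih, ae_dirDeriv_eq_zero_of_eq_zero v (contDiff_dirDeriv_iterate v hf k)]
      with x h1 h2 h0
    rw [Function.iterate_succ_apply']
    exact h2 (h1 h0)

end ZeroSets

/-! ### Differentiation under the integral sign -/

section ParametricIntegrals

/-- Differentiation of all orders under the integral sign. -/
theorem iteratedFDeriv_integral {X Y : Type} [NormedAddCommGroup X] [NormedSpace ℝ X]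
    [MeasurableSpace X] [OpensMeasurableSpace X] [SecondCountableTopology X]
    [NormedAddCommGroup Y] [NormedSpace ℝ Y] (μ : Measure X) (n : ℕ) :
    ∀ {E : Type} [NormedAddCommGroup E] [NormedSpace ℝ E] [CompleteSpace E] {f : X → Y → E},
      ContDiff ℝ ∞ (Function.uncurry f) →
      (∀ i, ∃ B : X → ℝ, Integrable B μ ∧ ∀ x y, ‖iteratedFDeriv ℝ i (f x) y‖ ≤ B x) →
      ∀ y, Integrable (fun x => iteratedFDeriv ℝ n (f x) y) μ ∧
        iteratedFDeriv ℝ n (fun y => ∫ x, f x y ∂μ) y = ∫ x, iteratedFDeriv ℝ n (f x) y ∂μ := by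
  have hint : ∀ (n : ℕ) {E : Type} [NormedAddCommGroup E] [NormedSpace ℝ E] {f : X → Y → E},
      ContDiff ℝ ∞ (Function.uncurry f) →
      (∀ i, ∃ B : X → ℝ, Integrable B μ ∧ ∀ x y, ‖iteratedFDeriv ℝ i (f x) y‖ ≤ B x) →
      ∀ y, Integrable (fun x => iteratedFDeriv ℝ n (f x) y) μ := by
    intro n E _ _ f hf hB y
    obtain ⟨B, hBi, hB⟩ := hB n
    have hc : Continuous fun x => iteratedFDeriv ℝ n (f x) y :=
      (continuous_iteratedFDeriv_param n hf).comp (continuous_id.prodMk continuous_const)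
    exact hBi.mono' hc.aestronglyMeasurable (Eventually.of_forall fun x => hB x y)
  induction n with
  | zero =>
    intro E _ _ _ f hf hB y
    refine ⟨hint 0 hf hB y, ?_⟩
    simp_rw [iteratedFDeriv_zero_eq_comp, Function.comp_apply]
    exact ((continuousMultilinearCurryFin0 ℝ Y E).symm.toContinuousLinearEquiv.integral_comp_comm
      (fun x => f x y)).symm
  | succ n ih =>
    intro E _ _ _ f hf hB y
    refine ⟨hint (n + 1) hf hB y, ?_⟩
    have hfx : ∀ x, ContDiff ℝ ∞ (f x) := fun x =>
      hf.comp (contDiff_const.prodMk contDiff_id)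
    have hfd : ContDiff ℝ ∞ (Function.uncurry (fun x y => fderiv ℝ (f x) y)) := by
      have h2 : ContDiff ℝ ∞ (Function.uncurry (fun (p : X × Y) (y : Y) => f p.1 y)) :=
        hf.comp ((contDiff_fst.comp contDiff_fst).prodMk contDiff_snd)
      exact h2.fderiv contDiff_snd (by simp)
    have hBd : ∀ i, ∃ B : X → ℝ, Integrable B μ ∧
        ∀ x y, ‖iteratedFDeriv ℝ i (fun y => fderiv ℝ (f x) y) y‖ ≤ B x := by
      intro i
      obtain ⟨B, hBi, hB⟩ := hB (i + 1)
      refine ⟨B, hBi, fun x y => ?_⟩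
      have := hB x y
      rwa [← norm_iteratedFDeriv_fderiv] at this
    have hder : (fderiv ℝ fun y => ∫ x, f x y ∂μ) = fun y => ∫ x, fderiv ℝ (f x) y ∂μ := by
      funext y₀
      obtain ⟨B, hBi, hB1⟩ := hBd 0
      obtain ⟨B0, hBi0, hB0⟩ := hB 0
      refine (hasFDerivAt_integral_of_dominated_of_fderiv_le (F := fun y x => f x y)
        (F' := fun y x => fderiv ℝ (f x) y) (bound := B) univ_mem ?_ ?_ ?_ ?_ hBi ?_).fderiv
      · exact Eventually.of_forall fun y =>
          (hf.continuous.comp (continuous_id.prodMk continuous_const)).aestronglyMeasurable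
      · refine hBi0.mono'
          (hf.continuous.comp (continuous_id.prodMk continuous_const)).aestronglyMeasurable
          (Eventually.of_forall fun x => ?_)
        simpa using hB0 x y₀
      · exact (hfd.continuous.comp
          (continuous_id.prodMk continuous_const)).aestronglyMeasurable
      · refine Eventually.of_forall fun x y _ => ?_
        simpa using hB1 x y
      · exact Eventually.of_forall fun x y _ =>
          ((hfx x).differentiable (by simp) y).hasFDerivAt
    have ih' := (ih hfd hBd y).2
    simp_rw [iteratedFDeriv_succ_eq_comp_right, Function.comp_apply]
    rw [hder, ih']
    let L : ContinuousMultilinearMap ℝ (fun _ : Fin n => Y) (Y →L[ℝ] E) →L[ℝ]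
        ContinuousMultilinearMap ℝ (fun _ : Fin (n + 1) => Y) E :=
      { toLinearMap := (continuousMultilinearCurryRightEquiv' ℝ n Y E).symm.toLinearMap
        cont := (continuousMultilinearCurryRightEquiv' ℝ n Y E).symm.continuous }
    exact (L.integral_comp_comm (hint n hfd hBd y)).symm

end ParametricIntegrals

/-! ### Factorization of functionals -/

section HahnBanach

/-- A linear functional that is bounded by `‖J ·‖` factors through the linear map `J`. -/
theorem exists_dual_comp_eq {V Y : Type*} [AddCommGroup V] [Module ℂ V] [NormedAddCommGroup Y]
    [NormedSpace ℂ Y] (T : V →ₗ[ℂ] ℂ) (J : V →ₗ[ℂ] Y) (C : ℝ) (h : ∀ x, ‖T x‖ ≤ C * ‖J x‖) :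
    ∃ Λ : Y →L[ℂ] ℂ, ∀ x, Λ (J x) = T x := by
  have hker : LinearMap.ker J ≤ LinearMap.ker T := by
    intro x hx
    have := h x
    rw [LinearMap.mem_ker.1 hx, norm_zero, mul_zero] at this
    exact norm_le_zero_iff.1 this
  let T' : LinearMap.range J →ₗ[ℂ] ℂ :=
    (LinearMap.ker J).liftQ T hker ∘ₗ (J.quotKerEquivRange.symm : LinearMap.range J →ₗ[ℂ] _)
  have hT' : ∀ x, T' ⟨J x, LinearMap.mem_range_self J x⟩ = T x := by
    intro x
    have : J.quotKerEquivRange.symm ⟨J x, LinearMap.mem_range_self J x⟩ =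
        (LinearMap.ker J).mkQ x := J.quotKerEquivRange_symm_apply_image x _
    simp [T', this]
  let T'' : LinearMap.range J →L[ℂ] ℂ := T'.mkContinuous C (by
    rintro ⟨_, x, rfl⟩
    rw [hT' x]
    exact h x)
  obtain ⟨Λ, hΛ, -⟩ := exists_extension_norm_eq (LinearMap.range J) T''
  exact ⟨Λ, fun x => (hΛ ⟨J x, LinearMap.mem_range_self J x⟩).trans (hT' x)⟩

end HahnBanach

/-! ### Products of test functions and Fourier inversion for distributions -/

section LocalizationFormula

variable {d : ℕ} {O : Opens (Rd d)}

/-- The product of two test functions. -/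
noncomputable def mulTest (χ θ : 𝓓(O, ℂ)) : 𝓓(O, ℂ) where
  toFun ξ := χ ξ * θ ξ
  contDiff' := χ.contDiff.mul θ.contDiff
  hasCompactSupport' := χ.hasCompactSupport.mul_right
  tsupport_subset' := (tsupport_mul_subset_left).trans χ.tsupport_subset

@[simp] theorem mulTest_apply (χ θ : 𝓓(O, ℂ)) (ξ : Rd d) : mulTest χ θ ξ = χ ξ * θ ξ := rfl

@[simp] theorem expTest_apply (χ : 𝓓(O, ℂ)) (x ξ : Rd d) :
    expTest χ x ξ = χ ξ * Complex.exp (2 * Real.pi * Complex.I * (inner ℝ x ξ : ℝ)) := rfl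

/-- The character `e_x(ξ) = exp(2πi x·ξ)`. -/
noncomputable def expChar (x ξ : Rd d) : ℂ :=
  Complex.exp (2 * Real.pi * Complex.I * (inner ℝ x ξ : ℝ))

theorem contDiff_expChar : ContDiff ℝ ∞ (Function.uncurry (expChar : Rd d → Rd d → ℂ)) :=
  ContDiff.cexp (contDiff_const.mul
    (Complex.ofRealCLM.contDiff.comp (contDiff_fst.inner ℝ contDiff_snd)))

theorem iteratedDeriv_cexp_line (c : ℂ) (k : ℕ) :
    iteratedDeriv k (fun s : ℝ => Complex.exp (c * s)) =
      fun s : ℝ => c ^ k * Complex.exp (c * s) := by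
  induction k with
  | zero => simp
  | succ k ih =>
    rw [iteratedDeriv_succ, ih]
    funext s
    have h1 : HasDerivAt (fun s : ℝ => c * (s : ℂ)) c s := by
      simpa using (Complex.ofRealCLM.hasDerivAt (x := s)).const_mul c
    have := (h1.cexp.const_mul (c ^ k)).deriv
    rw [this]
    ring

theorem norm_iteratedFDeriv_expChar_le (x ξ : Rd d) (k : ℕ) :
    ‖iteratedFDeriv ℝ k (expChar x) ξ‖ ≤ (2 * Real.pi * ‖x‖) ^ k := by
  set c : ℂ := 2 * Real.pi * Complex.I with hc
  have hcont : ContDiff ℝ ∞ (fun s : ℝ => Complex.exp (c * s)) :=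
    ContDiff.cexp (contDiff_const.mul Complex.ofRealCLM.contDiff)
  have he : expChar x = (fun s : ℝ => Complex.exp (c * s)) ∘ (innerSL ℝ x) := by
    funext η
    simp [expChar, hc]
  rw [he, ContinuousLinearMap.iteratedFDeriv_comp_right (innerSL ℝ x) hcont ξ
    (by exact_mod_cast le_top)]
  refine (ContinuousMultilinearMap.norm_compContinuousLinearMap_le _ _).trans ?_
  rw [norm_iteratedFDeriv_eq_norm_iteratedDeriv, iteratedDeriv_cexp_line]
  have h1 : ‖Complex.exp (c * (innerSL ℝ x ξ : ℝ))‖ = 1 := by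
    rw [show c * ((innerSL ℝ x ξ : ℝ) : ℂ) = ((2 * Real.pi * innerSL ℝ x ξ : ℝ) : ℂ) * Complex.I by
      rw [hc]; push_cast; ring, Complex.norm_exp_ofReal_mul_I]
  have h2 : ‖c‖ = 2 * Real.pi := by simp [hc, abs_of_pos Real.pi_pos]
  rw [norm_mul, h1, norm_pow, h2]
  simp [mul_pow]

theorem exists_bound_iteratedFDeriv_expTest (χ : 𝓓(O, ℂ)) (i : ℕ) :
    ∃ b : ℕ → ℝ, ∀ x ξ, ‖iteratedFDeriv ℝ i (expTest χ x) ξ‖ ≤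
      ∑ k ∈ Finset.range (i + 1), b k * ‖x‖ ^ k := by
  have hb : ∀ k : ℕ, ∃ B, ∀ ξ, ‖iteratedFDeriv ℝ k (χ : Rd d → ℂ) ξ‖ ≤ B := fun k =>
    (χ.hasCompactSupport.iteratedFDeriv k).exists_bound_of_continuous
      (χ.contDiff.continuous_iteratedFDeriv (m := k) (by exact_mod_cast le_top))
  choose B hB using hb
  refine ⟨fun k => (i.choose (i - k) : ℝ) * B (i - k) * (2 * Real.pi) ^ k, fun x ξ => ?_⟩
  have h := norm_iteratedFDeriv_mul_le (N := ∞) (f := (χ : Rd d → ℂ)) (g := expChar x) χ.contDiff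
    (contDiff_expChar.comp (contDiff_const.prodMk contDiff_id)) ξ (n := i)
    (by exact_mod_cast le_top)
  refine h.trans ?_
  rw [← Finset.sum_range_reflect]
  refine Finset.sum_le_sum fun k hk => ?_
  have hk' : k ≤ i := by simpa [Nat.lt_succ_iff] using hk
  rw [show i + 1 - 1 - k = i - k by omega, show i - (i - k) = k by omega]
  have h1 := norm_iteratedFDeriv_expChar_le x ξ k
  rw [mul_pow] at h1
  calc _ ≤ (i.choose (i - k) : ℝ) * B (i - k) * ((2 * Real.pi) ^ k * ‖x‖ ^ k) := by
        have h0 : 0 ≤ B (i - k) := (norm_nonneg _).trans (hB _ ξ)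
        gcongr
        exact hB _ ξ
    _ = _ := by ring

/-- The Fourier transform of a test function, as a Schwartz function. -/
theorem exists_schwartz_fourier (θ : 𝓓(O, ℂ)) :
    ∃ g : SchwartzMap (Rd d) ℂ, (g : Rd d → ℂ) = 𝓕 (θ : Rd d → ℂ) :=
  ⟨𝓕 (θ.hasCompactSupport.toSchwartzMap θ.contDiff), rfl⟩

theorem integrable_fourier_test (θ : 𝓓(O, ℂ)) : Integrable (𝓕 (θ : Rd d → ℂ)) := by
  obtain ⟨g, hg⟩ := exists_schwartz_fourier θ
  rw [← hg]
  exact g.integrable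

theorem continuous_fourier_test (θ : 𝓓(O, ℂ)) : Continuous (𝓕 (θ : Rd d → ℂ)) := by
  obtain ⟨g, hg⟩ := exists_schwartz_fourier θ
  rw [← hg]
  exact g.continuous

/-- Finite families of bounded continuous functions that take values in the spaces of multilinear
maps: the Banach space in which the derivatives of orders `i ∈ s` of a test function live. -/
def DerivSpace (d : ℕ) (s : Finset ℕ) : Type :=
  ∀ i : s, BoundedContinuousFunction (Rd d) ((Rd d) [×(i : ℕ)]→L[ℝ] ℂ)

noncomputable instance (s : Finset ℕ) : NormedAddCommGroup (DerivSpace d s) :=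
  inferInstanceAs (NormedAddCommGroup
    (∀ i : s, BoundedContinuousFunction (Rd d) ((Rd d) [×(i : ℕ)]→L[ℝ] ℂ)))

noncomputable instance (s : Finset ℕ) : NormedSpace ℂ (DerivSpace d s) :=
  inferInstanceAs (NormedSpace ℂ
    (∀ i : s, BoundedContinuousFunction (Rd d) ((Rd d) [×(i : ℕ)]→L[ℝ] ℂ)))

instance (s : Finset ℕ) : CompleteSpace (DerivSpace d s) :=
  inferInstanceAs (CompleteSpace
    (∀ i : s, BoundedContinuousFunction (Rd d) ((Rd d) [×(i : ℕ)]→L[ℝ] ℂ)))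

/-- Evaluation of the `i`-th component at `ξ`. -/
noncomputable def DerivSpace.eval {s : Finset ℕ} (i : s) (ξ : Rd d) :
    DerivSpace d s →L[ℂ] ((Rd d) [×(i : ℕ)]→L[ℝ] ℂ) :=
  (BoundedContinuousFunction.evalCLM ℂ ξ).comp (ContinuousLinearMap.proj (R := ℂ)
    (φ := fun i : s => BoundedContinuousFunction (Rd d) ((Rd d) [×(i : ℕ)]→L[ℝ] ℂ)) i)

theorem DerivSpace.ext_eval {s : Finset ℕ} {u v : DerivSpace d s}
    (h : ∀ i ξ, DerivSpace.eval i ξ u = DerivSpace.eval i ξ v) : u = v :=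
  funext fun i => BoundedContinuousFunction.ext fun ξ => h i ξ

theorem DerivSpace.norm_le {s : Finset ℕ} {u : DerivSpace d s} {C : ℝ} (hC : 0 ≤ C)
    (h : ∀ i ξ, ‖DerivSpace.eval i ξ u‖ ≤ C) : ‖u‖ ≤ C :=
  (pi_norm_le_iff_of_nonneg hC).2 fun i => (BoundedContinuousFunction.norm_le hC).2 (h i)

/-- The derivatives of orders `i ∈ s`. -/
noncomputable def derivMap (s : Finset ℕ) (K : Compacts (Rd d)) :
    ContDiffMapSupportedIn (Rd d) ℂ ⊤ K →ₗ[ℂ] DerivSpace d s :=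
  (LinearMap.pi fun i : s => ContDiffMapSupportedIn.structureMapLM ℂ ⊤ (i : ℕ) :
    ContDiffMapSupportedIn (Rd d) ℂ ⊤ K →ₗ[ℂ]
      (∀ i : s, BoundedContinuousFunction (Rd d) ((Rd d) [×(i : ℕ)]→L[ℝ] ℂ)))

theorem eval_derivMap {s : Finset ℕ} {K : Compacts (Rd d)} (i : s) (ξ : Rd d)
    (v : ContDiffMapSupportedIn (Rd d) ℂ ⊤ K) :
    DerivSpace.eval i ξ (derivMap s K v) = iteratedFDeriv ℝ (i : ℕ) v ξ := by
  rw [← ContDiffMapSupportedIn.structureMapLM_top_apply ℂ]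
  rfl

theorem seminorm_le_norm_derivMap {s : Finset ℕ} {K : Compacts (Rd d)}
    (v : ContDiffMapSupportedIn (Rd d) ℂ ⊤ K) :
    (s.sup (ContDiffMapSupportedIn.seminorm ℂ (Rd d) ℂ ⊤ K)) v ≤ ‖derivMap s K v‖ :=
  Seminorm.finset_sup_apply_le (norm_nonneg _) fun i hi =>
    norm_le_pi_norm (show ∀ i : s, BoundedContinuousFunction (Rd d)
      ((Rd d) [×(i : ℕ)]→L[ℝ] ℂ) from derivMap s K v) ⟨i, hi⟩

theorem continuous_derivMap {s : Finset ℕ} {K : Compacts (Rd d)} {X : Type*} [TopologicalSpace X]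
    {ψ : X → ContDiffMapSupportedIn (Rd d) ℂ ⊤ K}
    (h : ∀ i : ℕ, Continuous fun p : X × Rd d => iteratedFDeriv ℝ i (ψ p.1) p.2) :
    Continuous fun x => derivMap s K (ψ x) := by
  refine continuous_pi fun i => ?_
  refine continuous_of_continuous_uncurry K.isCompact _ ?_ ?_
  · exact (h i).congr fun p => (eval_derivMap i p.2 (ψ p.1)).symm
  · intro x ξ hξ
    exact (eval_derivMap i ξ (ψ x)).trans ((ψ x).iteratedFDeriv_zero_on_compl hξ)

/-- Fourier inversion on the test function side, `χ θ = ∫ 𝓕 θ (y) χ e_y dy`, may be interchanged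
with a distribution: `(𝓕 f)(χ θ) = ∫ 𝓕 θ (y) (𝓕 f)(χ e_y) dy`. On functions supported in the support
of `χ`, the distribution is controlled by finitely many derivatives, so that it extends to a
continuous functional on a Banach space in which the integral converges. -/
theorem fourier_mulTest (f : FourierDistribution O) (χ θ : 𝓓(O, ℂ)) :
    Integrable (fun y => 𝓕 (θ : Rd d → ℂ) y * localize χ f y) ∧
      f.fourier (mulTest χ θ) = ∫ y, 𝓕 (θ : Rd d → ℂ) y * localize χ f y := by
  obtain ⟨g, hg⟩ := exists_schwartz_fourier θ
  rw [← hg]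
  let K : Compacts (Rd d) := ⟨tsupport χ, χ.hasCompactSupport⟩
  have hK : (K : Set (Rd d)) ⊆ O := χ.tsupport_subset
  let V := ContDiffMapSupportedIn (Rd d) ℂ ⊤ K
  let T : V →L[ℂ] ℂ := f.fourier ∘L (TestFunction.ofSupportedInCLM ℂ hK)
  have hsup : ∀ x, Function.support (expTest χ x) ⊆ K := fun x =>
    (Function.support_mul_subset_left _ _).trans subset_closure
  let ψ : Rd d → V := fun x =>
    ContDiffMapSupportedIn.of_support_subset (expTest χ x).contDiff (hsup x)
  have hsup' : Function.support (mulTest χ θ) ⊆ K :=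
    (Function.support_mul_subset_left _ _).trans subset_closure
  let ψθ : V := ContDiffMapSupportedIn.of_support_subset (mulTest χ θ).contDiff hsup'
  have hTψ : ∀ x, T (ψ x) = localize χ f x := fun x => rfl
  have hTθ : T ψθ = f.fourier (mulTest χ θ) := rfl
  -- a Banach space of finitely many derivatives that controls `T`
  have hTc : Continuous ((normSeminorm ℂ ℂ).comp T.toLinearMap) := by
    change Continuous fun v => ‖T v‖
    exact T.continuous.norm
  obtain ⟨s, C, -, hC⟩ := Seminorm.bound_of_continuous
    (ContDiffMapSupportedIn.withSeminorms ℂ (Rd d) ℂ ⊤ K) _ hTc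
  let J := derivMap s K
  have hTJ : ∀ v, ‖T v‖ ≤ (C : ℝ) * ‖J v‖ := fun v => by
    refine (hC v).trans ?_
    rw [smul_apply]
    exact mul_le_mul_of_nonneg_left (seminorm_le_norm_derivMap v) C.2
  obtain ⟨Λ, hΛ⟩ := exists_dual_comp_eq T.toLinearMap J C hTJ
  have hF : ContDiff ℝ ∞ (Function.uncurry (fun x ξ : Rd d => (expTest χ x ξ : ℂ))) := by
    have h : ContDiff ℝ ∞ (χ : Rd d → ℂ) := χ.contDiff
    exact (h.comp contDiff_snd).mul contDiff_expChar
  have hJc : Continuous fun y => J (ψ y) :=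
    continuous_derivMap fun i => continuous_iteratedFDeriv_param i hF
  choose b hb using fun i => exists_bound_iteratedFDeriv_expTest χ i
  have hgint : ∀ i, Integrable fun y =>
      ‖g y‖ * ∑ k ∈ Finset.range (i + 1), |b i k| * ‖y‖ ^ k := by
    intro i
    simp_rw [Finset.mul_sum]
    refine integrable_finsetSum _ fun k _ => ?_
    refine ((g.integrable_pow_mul volume k).const_mul |b i k|).congr
      (Eventually.of_forall fun y => ?_)
    ring
  have hbound : ∀ i y ξ, ‖iteratedFDeriv ℝ i (expTest χ y) ξ‖ ≤
      ∑ k ∈ Finset.range (i + 1), |b i k| * ‖y‖ ^ k := fun i y ξ =>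
    (hb i y ξ).trans (Finset.sum_le_sum fun k _ => by gcongr; exact le_abs_self _)
  have hJint : Integrable fun y => g y • J (ψ y) := by
    refine (integrable_finsetSum s.attach fun i _ => hgint (i : ℕ)).mono'
      ((g.continuous.smul hJc).aestronglyMeasurable) (Eventually.of_forall fun y => ?_)
    have hnn : ∀ i : ℕ, 0 ≤ ∑ k ∈ Finset.range (i + 1), |b i k| * ‖y‖ ^ k := fun i =>
      Finset.sum_nonneg fun k _ => by positivity
    rw [norm_smul, ← Finset.mul_sum]
    refine mul_le_mul_of_nonneg_left ?_ (norm_nonneg _)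
    refine DerivSpace.norm_le (Finset.sum_nonneg fun i _ => hnn i) fun i ξ => ?_
    rw [eval_derivMap]
    exact (hbound i y ξ).trans (Finset.single_le_sum
      (f := fun i : s => ∑ k ∈ Finset.range ((i : ℕ) + 1), |b i k| * ‖y‖ ^ k)
      (fun i _ => hnn i) (Finset.mem_attach s i))
  have hsm : ContDiff ℝ ∞ (Function.uncurry (fun y ξ : Rd d => g y * expTest χ y ξ)) :=
    ((g.smooth ⊤).comp contDiff_fst).mul hF
  have hsm_i : ∀ (i : ℕ) (y ξ : Rd d), iteratedFDeriv ℝ i (fun ξ => g y * expTest χ y ξ) ξ =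
      g y • iteratedFDeriv ℝ i (expTest χ y) ξ := fun i y ξ =>
    iteratedFDeriv_const_smul_apply (a := g y) (f := (expTest χ y : Rd d → ℂ))
      ((expTest χ y).contDiff.contDiffAt.of_le (by exact_mod_cast le_top))
  have hinv : ∀ ξ, ∫ y, g y * expTest χ y ξ = χ ξ * θ ξ := by
    intro ξ
    have h1 := θ.continuous.fourierInv_fourier_eq (integrable_test θ) (integrable_fourier_test θ)
    have h2 := congrFun h1 ξ
    rw [Real.fourierInv_eq', ← hg] at h2
    rw [← h2, ← integral_const_mul]
    refine integral_congr_ae (Eventually.of_forall fun y => ?_)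
    simp only [expTest_apply, smul_eq_mul]
    rw [show (((2 * Real.pi * inner ℝ y ξ : ℝ) : ℂ) * Complex.I) =
      2 * Real.pi * Complex.I * (inner ℝ y ξ : ℝ) by push_cast; ring]
    ring
  have hJθ : ∫ y, g y • J (ψ y) = J ψθ := by
    refine DerivSpace.ext_eval fun i ξ => ?_
    have h2 := (iteratedFDeriv_integral volume (i : ℕ) hsm (fun j =>
      ⟨_, hgint j, fun y ξ => by
        rw [hsm_i, norm_smul]
        exact mul_le_mul_of_nonneg_left (hbound j y ξ) (norm_nonneg _)⟩) ξ).2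
    have h3 : (ψθ : Rd d → ℂ) = fun ξ => ∫ y, g y * expTest χ y ξ := by
      funext ξ
      exact (hinv ξ).symm
    rw [← (DerivSpace.eval i ξ).integral_comp_comm hJint, eval_derivMap, h3, h2]
    refine integral_congr_ae (Eventually.of_forall fun y => ?_)
    simp only [hsm_i]
    rw [map_smul, eval_derivMap]
    rfl
  have hfin := Λ.integrable_comp hJint
  have hpt : ∀ y, Λ (g y • J (ψ y)) = g y * localize χ f y := fun y => by
    rw [map_smul, hΛ, smul_eq_mul]
    rfl
  simp_rw [hpt] at hfin
  refine ⟨hfin, ?_⟩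
  have h4 := Λ.integral_comp_comm hJint
  simp_rw [hpt] at h4
  rw [h4, hJθ, hΛ]
  rfl

end LocalizationFormula

/-! ### Convolution with integrable kernels -/

section Convolutions

variable {d : ℕ}

/-- Symbols of convolution operators: continuous compactly supported functions whose Fourier
transform is integrable. -/
structure IsSymbol (ψ : Rd d → ℂ) : Prop where
  continuous : Continuous ψ
  hasCompactSupport : HasCompactSupport ψ
  integrable_fourier : Integrable (𝓕 ψ)

theorem IsSymbol.integrable {ψ : Rd d → ℂ} (h : IsSymbol ψ) : Integrable ψ :=
  h.continuous.integrable_of_hasCompactSupport h.hasCompactSupport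

theorem continuous_fourier {ψ : Rd d → ℂ} (h : Integrable ψ) : Continuous (𝓕 ψ) :=
  VectorFourier.fourierIntegral_continuous Real.continuous_fourierChar continuous_inner h

theorem IsSymbol.continuous_fourier {ψ : Rd d → ℂ} (h : IsSymbol ψ) : Continuous (𝓕 ψ) :=
  GSI.continuous_fourier h.integrable

theorem IsSymbol.enorm_le {f : Rd d → ℂ} (hf : IsSymbol f) (ξ : Rd d) :
    ‖f ξ‖ₑ ≤ ∫⁻ w, ‖𝓕 f w‖ₑ := by
  have hinv := congrFun
    (hf.continuous.fourierInv_fourier_eq hf.integrable hf.integrable_fourier) ξ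
  conv_lhs => rw [← hinv, Real.fourierInv_eq_fourier_neg]
  exact enorm_fourier_le_lintegral _ _

theorem fourier_sum_apply {ι : Type*} (s : Finset ι) {f : ι → Rd d → ℂ}
    (hf : ∀ i ∈ s, Integrable (f i)) (w : Rd d) :
    𝓕 (fun ξ => ∑ i ∈ s, f i ξ) w = ∑ i ∈ s, 𝓕 (f i) w := by
  simp_rw [Real.fourier_eq, Finset.smul_sum]
  exact integral_finsetSum _ fun i hi => (Real.fourierIntegral_convergent_iff w).2 (hf i hi)

theorem IsSymbol.sum {ι : Type*} (s : Finset ι) {f : ι → Rd d → ℂ} (hf : ∀ i ∈ s, IsSymbol (f i)) :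
    IsSymbol (fun ξ => ∑ i ∈ s, f i ξ) where
  continuous := continuous_finsetSum _ fun i hi => (hf i hi).continuous
  hasCompactSupport := by
    classical
    induction s using Finset.induction_on with
    | empty =>
      simp only [Finset.sum_empty]
      exact HasCompactSupport.zero
    | insert a s ha ih =>
      simp_rw [Finset.sum_insert ha]
      exact (hf a (Finset.mem_insert_self _ _)).hasCompactSupport.add
        (ih fun i hi => hf i (Finset.mem_insert_of_mem hi))
  integrable_fourier := by
    refine (integrable_finsetSum s fun i hi => (hf i hi).integrable_fourier).congr
      (Eventually.of_forall fun w => ?_)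
    exact (fourier_sum_apply s (fun i hi => (hf i hi).integrable) w).symm

theorem norm_fourier_le_integral (f : Rd d → ℂ) (w : Rd d) : ‖𝓕 f w‖ ≤ ∫ ξ, ‖f ξ‖ :=
  VectorFourier.norm_fourierIntegral_le_integral_norm _ _ _ _ _

/-- The convolution theorem for the Fourier transforms of two symbols. -/
theorem fourier_mul_eq_integral {ψ₁ ψ₂ : Rd d → ℂ} (h₁ : IsSymbol ψ₁) (h₂ : IsSymbol ψ₂)
    (z : Rd d) : 𝓕 (fun ξ => ψ₁ ξ * ψ₂ ξ) z = ∫ y, 𝓕 ψ₁ y * 𝓕 ψ₂ (z - y) := by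
  set L := ContinuousLinearMap.mul ℂ ℂ
  set c := MeasureTheory.convolution (𝓕 ψ₁) (𝓕 ψ₂) L volume with hc
  have hcont : Continuous c := by
    refine BddAbove.continuous_convolution_right_of_integrable L ?_ h₁.integrable_fourier
      h₂.continuous_fourier
    exact ⟨∫ ξ, ‖ψ₂ ξ‖, by rintro _ ⟨w, rfl⟩; exact norm_fourier_le_integral ψ₂ w⟩
  have hint : Integrable c := h₁.integrable_fourier.integrable_convolution L h₂.integrable_fourier
  have hinv : ∀ {ψ : Rd d → ℂ}, IsSymbol ψ → ∀ x, 𝓕 (𝓕 ψ) x = ψ (-x) := fun {ψ} h x => by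
    have := congrFun (h.continuous.fourierInv_fourier_eq h.integrable h.integrable_fourier) (-x)
    rwa [Real.fourierInv_eq_fourier_neg, neg_neg] at this
  have hF : 𝓕 c = fun x => (fun ξ => ψ₁ ξ * ψ₂ ξ) (-x) := by
    funext x
    rw [hc, Real.fourier_mul_convolution_eq h₁.integrable_fourier h₂.integrable_fourier,
      hinv h₁, hinv h₂]
  have hFi : Integrable (𝓕 c) := by
    rw [hF]
    exact ((h₁.continuous.mul h₂.continuous).integrable_of_hasCompactSupport
      (h₁.hasCompactSupport.mul_right)).comp_neg
  have h := congrFun (hcont.fourierInv_fourier_eq hint hFi) z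
  rw [hF, Real.fourierInv_eq_fourier_comp_neg] at h
  simp only [neg_neg] at h
  rw [h]
  rfl

/-- Iterated convolution of a bounded function with the Fourier transforms of two symbols. -/
theorem integral_fourier_mul_integral {ψ₁ ψ₂ c : Rd d → ℂ} (h₁ : IsSymbol ψ₁) (h₂ : IsSymbol ψ₂)
    (hc : Continuous c) {C : ℝ} (hC : ∀ x, ‖c x‖ ≤ C) :
    ∫ y, 𝓕 ψ₁ y * ∫ z, 𝓕 ψ₂ z * c (y + z) = ∫ z, 𝓕 (fun ξ => ψ₁ ξ * ψ₂ ξ) z * c z := by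
  have hp : Integrable (fun p : Rd d × Rd d => 𝓕 ψ₁ p.2 * 𝓕 ψ₂ (p.1 - p.2) * c p.1)
      (volume.prod volume) := by
    refine Integrable.mul_bdd (c := C) ?_ (hc.comp continuous_fst).aestronglyMeasurable
      (Eventually.of_forall fun p => hC p.1)
    exact h₁.integrable_fourier.convolution_integrand (ContinuousLinearMap.mul ℂ ℂ)
      h₂.integrable_fourier
  calc ∫ y, 𝓕 ψ₁ y * ∫ z, 𝓕 ψ₂ z * c (y + z)
      = ∫ y, ∫ z, 𝓕 ψ₁ y * 𝓕 ψ₂ (z - y) * c z := by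
        refine integral_congr_ae (Eventually.of_forall fun y => ?_)
        simp only
        rw [← integral_const_mul, ← integral_sub_right_eq_self _ y]
        refine integral_congr_ae (Eventually.of_forall fun z => ?_)
        simp only
        rw [add_sub_cancel, mul_assoc]
    _ = ∫ z, ∫ y, 𝓕 ψ₁ y * 𝓕 ψ₂ (z - y) * c z := (integral_integral_swap hp).symm
    _ = _ := by
        refine integral_congr_ae (Eventually.of_forall fun z => ?_)
        simp only
        rw [integral_mul_const, fourier_mul_eq_integral h₁ h₂]

theorem integrable_fourier_mul_shift {ψ c : Rd d → ℂ} (h : IsSymbol ψ) (hc : Continuous c) {C : ℝ}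
    (hC : ∀ x, ‖c x‖ ≤ C) (x : Rd d) : Integrable (fun y => 𝓕 ψ y * c (x + y)) :=
  Integrable.mul_bdd (c := C) h.integrable_fourier
    (hc.comp (continuous_const.add continuous_id)).aestronglyMeasurable
    (Eventually.of_forall fun y => hC (x + y))

theorem norm_integral_fourier_mul_shift_le {ψ c : Rd d → ℂ} (h : IsSymbol ψ) {C : ℝ}
    (hC : ∀ x, ‖c x‖ ≤ C) (x : Rd d) :
    ‖∫ y, 𝓕 ψ y * c (x + y)‖ ≤ (∫ y, ‖𝓕 ψ y‖) * C := by
  rw [← integral_mul_const]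
  refine norm_integral_le_of_norm_le (h.integrable_fourier.norm.mul_const C)
    (Eventually.of_forall fun y => ?_)
  rw [norm_mul]
  exact mul_le_mul_of_nonneg_left (hC _) (norm_nonneg _)

theorem continuous_integral_fourier_mul_shift {ψ c : Rd d → ℂ} (h : IsSymbol ψ) (hc : Continuous c)
    {C : ℝ} (hC : ∀ x, ‖c x‖ ≤ C) : Continuous fun x => ∫ y, 𝓕 ψ y * c (x + y) := by
  refine continuous_of_dominated (bound := fun y => ‖𝓕 ψ y‖ * C)
    (fun x => (integrable_fourier_mul_shift h hc hC x).aestronglyMeasurable)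
    (fun x => Eventually.of_forall fun y => ?_) (h.integrable_fourier.norm.mul_const C)
    (Eventually.of_forall fun y => continuous_const.mul (hc.comp (continuous_id.add_const y)))
  rw [norm_mul]
  exact mul_le_mul_of_nonneg_left (hC _) (norm_nonneg _)

/-- Young's inequality `L^1 ∗ L^p ⊆ L^p`. -/
theorem eLpNorm_integral_mul_shift_le {k c : Rd d → ℂ} (hk : Continuous k) (hc : Continuous c)
    {p : ℝ≥0∞} (hp : 1 ≤ p) :
    eLpNorm (fun x => ∫ y, k y * c (x + y)) p volume ≤
      (∫⁻ y, ‖k y‖ₑ) * eLpNorm c p volume := by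
  have hpt : ∀ x, ‖∫ y, k y * c (x + y)‖ₑ ≤ ∫⁻ y, ‖k y‖ₑ * ‖c (x + y)‖ₑ := fun x =>
    (enorm_integral_le_lintegral_enorm _).trans_eq (lintegral_congr fun y => enorm_mul _ _)
  rcases eq_or_ne p ⊤ with rfl | hpt'
  · rw [eLpNorm_exponent_top, eLpNorm_exponent_top]
    refine essSup_le_of_ae_le _ (Eventually.of_forall fun x => ?_)
    refine (hpt x).trans ?_
    rw [← lintegral_mul_const _ hk.enorm.measurable]
    refine lintegral_mono_ae ?_
    have := (quasiMeasurePreserving_add_left volume x).ae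
      (enorm_ae_le_eLpNormEssSup c volume)
    filter_upwards [this] with y hy
    gcongr
  have hp0 : p ≠ 0 := (zero_lt_one.trans_le hp).ne'
  set r := p.toReal with hr
  have hr1 : 1 ≤ r := (ENNReal.toReal_one ▸ ENNReal.toReal_mono hpt' hp :)
  have hr0 : 0 < r := zero_lt_one.trans_le hr1
  rw [eLpNorm_eq_lintegral_rpow_enorm_toReal hp0 hpt',
    eLpNorm_eq_lintegral_rpow_enorm_toReal hp0 hpt',
    ← hr]
  set κ := ∫⁻ y, ‖k y‖ₑ with hκ
  have hcm : ∀ x, Measurable fun y => ‖c (x + y)‖ₑ ^ r := fun x =>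
    (hc.comp (continuous_const.add continuous_id)).enorm.measurable.pow_const _
  -- Hölder's inequality for the weight `|k|`
  have hH : ∀ x, (∫⁻ y, ‖k y‖ₑ * ‖c (x + y)‖ₑ) ^ r ≤
      κ ^ (r - 1) * ∫⁻ y, ‖k y‖ₑ * ‖c (x + y)‖ₑ ^ r := by
    intro x
    have h := ENNReal.lintegral_mul_norm_pow_le (μ := (volume : Measure (Rd d)))
      (f := fun y => ‖k y‖ₑ) (g := fun y => ‖k y‖ₑ * ‖c (x + y)‖ₑ ^ r)
      hk.enorm.measurable.aemeasurable (hk.enorm.measurable.mul (hcm x)).aemeasurable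
      (p := 1 - 1 / r) (q := 1 / r) (by rw [sub_nonneg, div_le_one hr0]; exact hr1)
      (by positivity) (by ring)
    have he : ∀ y, ‖k y‖ₑ ^ (1 - 1 / r) * (‖k y‖ₑ * ‖c (x + y)‖ₑ ^ r) ^ (1 / r) =
        ‖k y‖ₑ * ‖c (x + y)‖ₑ := by
      intro y
      rw [ENNReal.mul_rpow_of_nonneg _ _ (by positivity), ← ENNReal.rpow_mul,
        mul_one_div_cancel hr0.ne', ENNReal.rpow_one, ← mul_assoc,
        ← ENNReal.rpow_add_of_nonneg _ _ (by rw [sub_nonneg, div_le_one hr0]; exact hr1)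
          (by positivity), sub_add_cancel, ENNReal.rpow_one]
    simp_rw [he] at h
    calc _ ≤ (κ ^ (1 - 1 / r) * (∫⁻ y, ‖k y‖ₑ * ‖c (x + y)‖ₑ ^ r) ^ (1 / r)) ^ r := by gcongr
      _ = _ := by
        rw [ENNReal.mul_rpow_of_nonneg _ _ hr0.le, ← ENNReal.rpow_mul, ← ENNReal.rpow_mul,
          one_div_mul_cancel hr0.ne', ENNReal.rpow_one, sub_mul, one_mul,
          one_div_mul_cancel hr0.ne']
  have hT : ∫⁻ x, ∫⁻ y, ‖k y‖ₑ * ‖c (x + y)‖ₑ ^ r = κ * ∫⁻ x, ‖c x‖ₑ ^ r := by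
    rw [lintegral_lintegral_swap]
    · rw [hκ, ← lintegral_mul_const _ hk.enorm.measurable]
      refine lintegral_congr fun y => ?_
      rw [lintegral_const_mul' _ _ enorm_ne_top]
      congr 1
      exact lintegral_add_right_eq_self (fun x => ‖c x‖ₑ ^ r) y
    · refine Measurable.aemeasurable ?_
      have h1 : Measurable fun q : Rd d × Rd d => ‖k q.2‖ₑ :=
        (hk.comp continuous_snd).enorm.measurable
      have h2 : Measurable fun q : Rd d × Rd d => ‖c (q.1 + q.2)‖ₑ ^ r :=
        (hc.comp (continuous_fst.add continuous_snd)).enorm.measurable.pow_const _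
      exact h1.mul h2
  calc (∫⁻ x, ‖∫ y, k y * c (x + y)‖ₑ ^ r) ^ (1 / r)
      ≤ (∫⁻ x, κ ^ (r - 1) * ∫⁻ y, ‖k y‖ₑ * ‖c (x + y)‖ₑ ^ r) ^ (1 / r) := by
        gcongr with x
        exact (ENNReal.rpow_le_rpow (hpt x) hr0.le).trans (hH x)
    _ = (κ ^ (r - 1) * (κ * ∫⁻ x, ‖c x‖ₑ ^ r)) ^ (1 / r) := by
        rw [lintegral_const_mul, hT]
        refine Measurable.lintegral_prod_right'
          (f := fun q : Rd d × Rd d => ‖k q.2‖ₑ * ‖c (q.1 + q.2)‖ₑ ^ r) ?_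
        exact (hk.comp continuous_snd).enorm.measurable.mul
          ((hc.comp (continuous_fst.add continuous_snd)).enorm.measurable.pow_const _)
    _ = κ * (∫⁻ x, ‖c x‖ₑ ^ r) ^ (1 / r) := by
        rw [← mul_assoc]
        nth_rewrite 2 [← ENNReal.rpow_one κ]
        rw [← ENNReal.rpow_add_of_nonneg _ _ (by linarith) zero_le_one, sub_add_cancel,
          ENNReal.mul_rpow_of_nonneg _ _ (by positivity), ← ENNReal.rpow_mul,
          mul_one_div_cancel hr0.ne', ENNReal.rpow_one]

end Convolutions

/-! ### Localized pieces of Fourier distributions -/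

section Localization

variable {d : ℕ} {O : Opens (Rd d)}

theorem exists_eq_testFourier (v : FourierTestSpace O) : ∃ θ, v = testFourier O θ := by
  obtain ⟨θ, hθ⟩ := (testFourierLM O).surjective_rangeRestrict v
  exact ⟨θ, hθ.symm⟩

theorem FourierDistribution.ext_fourier {f g : FourierDistribution O}
    (h : ∀ θ, f.fourier θ = g.fourier θ) : f = g := by
  refine ContinuousLinearMap.ext fun v => ?_
  obtain ⟨θ, rfl⟩ := exists_eq_testFourier v
  exact h θ

theorem isSymbol_test (θ : 𝓓(O, ℂ)) : IsSymbol (θ : Rd d → ℂ) :=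
  ⟨θ.continuous, θ.hasCompactSupport, integrable_fourier_test θ⟩

theorem mulTest_comm (χ θ : 𝓓(O, ℂ)) : mulTest χ θ = mulTest θ χ :=
  TestFunction.ext fun _ => mul_comm _ _

theorem expTest_mulTest (χ θ : 𝓓(O, ℂ)) (x : Rd d) :
    expTest (mulTest χ θ) x = mulTest χ (expTest θ x) :=
  TestFunction.ext fun ξ => by simp [mul_assoc]

theorem expTest_expTest (χ : 𝓓(O, ℂ)) (x y : Rd d) :
    expTest (expTest χ x) y = expTest χ (x + y) :=
  TestFunction.ext fun ξ => by
    simp only [expTest_apply, mul_assoc]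
    rw [← Complex.exp_add, inner_add_left]
    push_cast
    ring_nf

theorem localize_expTest (χ : 𝓓(O, ℂ)) (f : FourierDistribution O) (x y : Rd d) :
    localize (expTest χ x) f y = localize χ f (x + y) := by
  simp only [localize, expTest_expTest]

theorem fourier_expTest (θ : 𝓓(O, ℂ)) (x w : Rd d) :
    𝓕 (expTest θ x : Rd d → ℂ) w = 𝓕 (θ : Rd d → ℂ) (w - x) := by
  rw [Real.fourier_eq', Real.fourier_eq']
  refine integral_congr_ae (Eventually.of_forall fun ξ => ?_)
  simp only [expTest_apply, smul_eq_mul]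
  rw [mul_comm (θ ξ), ← mul_assoc, ← Complex.exp_add, inner_sub_right, real_inner_comm x ξ]
  congr 2
  push_cast
  ring

/-- Multiplying by a further test function `θ` on the Fourier side convolves the localized piece
with `𝓕 θ` (up to a reflection). -/
theorem localize_mulTest (χ θ : 𝓓(O, ℂ)) (f : FourierDistribution O) (x : Rd d) :
    localize (mulTest χ θ) f x = ∫ y, 𝓕 (θ : Rd d → ℂ) y * localize χ f (x + y) := by
  have h := (fourier_mulTest f χ (expTest θ x)).2
  rw [← expTest_mulTest] at h
  refine h.trans ?_
  rw [← integral_add_right_eq_self _ x]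
  refine integral_congr_ae (Eventually.of_forall fun y => ?_)
  simp only
  rw [fourier_expTest, add_sub_cancel_right, add_comm]

theorem localize_sum {ι : Type*} (s : Finset ι) (χ : ι → 𝓓(O, ℂ)) (f : FourierDistribution O)
    (x : Rd d) : localize (∑ i ∈ s, χ i) f x = ∑ i ∈ s, localize (χ i) f x := by
  have h : expTest (∑ i ∈ s, χ i) x = ∑ i ∈ s, expTest (χ i) x :=
    TestFunction.ext fun ξ => by
      simp [Finset.sum_mul]
  simp only [localize]
  rw [h, map_sum]

/-- Moving a test function factor from the distribution to the symbol. -/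
theorem integral_fourier_mul_localize_mulTest {ψ : Rd d → ℂ} (hψ : IsSymbol ψ) (χ θ : 𝓓(O, ℂ))
    (f : FourierDistribution O) {C : ℝ} (hC : ∀ x, ‖localize χ f x‖ ≤ C) :
    ∫ z, 𝓕 ψ z * localize (mulTest χ θ) f z =
      ∫ z, 𝓕 (fun ξ => ψ ξ * θ ξ) z * localize χ f z := by
  simp_rw [localize_mulTest]
  exact integral_fourier_mul_integral hψ (isSymbol_test θ) (continuous_localize χ f) hC

end Localization

/-! ### Partitions of unity -/

section Partitions

variable {d : ℕ} {I : Type*} {O : Opens (Rd d)}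

/-- Smooth partitions of unity subordinate to an open admissible cover. -/
structure IsSubordinatePartition (O : Opens (Rd d)) (Q : I → Set (Rd d)) (φ : I → 𝓓(O, ℂ)) :
    Prop where
  isOpen : ∀ i, IsOpen (Q i)
  admissible : IsAdmissibleCover O Q
  sum_eq_one : ∀ ξ ∈ O, HasSum (fun i => φ i ξ) 1
  eq_zero : ∀ i, ∀ ξ ∉ Q i, φ i ξ = 0

theorem test_eq_zero_of_notMem (θ : 𝓓(O, ℂ)) {ξ : Rd d} (h : ξ ∉ O) : θ ξ = 0 :=
  image_eq_zero_of_notMem_tsupport fun hξ => h (θ.tsupport_subset hξ)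

theorem isOpen_affCover {A : I → Rd d ≃L[ℝ] Rd d} {b : I → Rd d} {Q' : I → Set (Rd d)}
    (h : ∀ i, IsOpen (Q' i)) (i : I) : IsOpen (affCover A b Q' i) := by
  have : affMap (A i) (b i) = (Homeomorph.addRight (b i)) ∘ (A i).toHomeomorph := rfl
  unfold affCover
  rw [this]
  exact ((Homeomorph.addRight (b i)).isOpenMap.comp (A i).toHomeomorph.isOpenMap) _ (h i)

theorem IsRegularPartition.isSubordinatePartition {A : I → Rd d ≃L[ℝ] Rd d} {b : I → Rd d}
    {Q' : I → Set (Rd d)} (hQ : IsAffinelyGeneratedCover O A b Q') {φ : I → 𝓓(O, ℂ)}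
    (hφ : IsRegularPartition A b Q' φ) : IsSubordinatePartition O (affCover A b Q') φ where
  isOpen := isOpen_affCover hQ.isOpen
  admissible := hQ.admissible
  sum_eq_one := hφ.sum_eq_one
  eq_zero i ξ h := by
    by_cases hξ : ξ ∈ O
    · exact hφ.eq_zero i ξ hξ h
    · exact test_eq_zero_of_notMem _ hξ

/-- The finite set `S` of indices suffices to resolve `θ`: the `φ_l` with `l ∈ S` add up to one
where `θ` does not vanish, and the other `φ_l` do not meet `θ`. -/
structure Resolves (φ : I → 𝓓(O, ℂ)) (S : Finset I) (θ : 𝓓(O, ℂ)) : Prop where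
  sum_eq_one : ∀ ξ, θ ξ ≠ 0 → ∑ l ∈ S, φ l ξ = 1
  mul_eq_zero : ∀ l ∉ S, ∀ ξ, φ l ξ * θ ξ = 0

theorem Resolves.expTest {φ : I → 𝓓(O, ℂ)} {S : Finset I} {θ : 𝓓(O, ℂ)} (h : Resolves φ S θ)
    (x : Rd d) : Resolves φ S (expTest θ x) where
  sum_eq_one ξ hξ := h.sum_eq_one ξ fun h0 => hξ (by simp [h0])
  mul_eq_zero l hl ξ := by
    rw [expTest_apply, ← mul_assoc, h.mul_eq_zero l hl ξ, zero_mul]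

variable {Q : I → Set (Rd d)} {φ : I → 𝓓(O, ℂ)}

theorem IsAdmissibleCover.finite_neighbors (h : IsAdmissibleCover O Q) (i : I) :
    (neighbors Q i).Finite := by
  rw [← Set.encard_lt_top_iff]
  exact (le_iSup (fun i => (neighbors Q i).encard) i).trans_lt h.finite_number

/-- Compact subsets of `O` meet only finitely many sets of the cover. -/
theorem IsSubordinatePartition.exists_finset (h : IsSubordinatePartition O Q φ)
    {K : Set (Rd d)} (hK : IsCompact K) (hKO : K ⊆ O) :
    ∃ S : Finset I, ∀ l ∉ S, ∀ ξ ∈ K, φ l ξ = 0 := by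
  classical
  obtain ⟨t, ht⟩ := hK.elim_finite_subcover Q h.isOpen (hKO.trans h.admissible.cover.ge)
  refine ⟨t.biUnion fun i => (h.admissible.finite_neighbors i).toFinset, fun l hl ξ hξ => ?_⟩
  obtain ⟨i, hi, hξi⟩ := mem_iUnion₂.1 (ht hξ)
  refine h.eq_zero l ξ fun hξl => hl (Finset.mem_biUnion.2 ⟨i, hi, ?_⟩)
  exact (Set.Finite.mem_toFinset _).2 ⟨ξ, hξl, hξi⟩

theorem IsSubordinatePartition.sum_eq_one_of_forall (h : IsSubordinatePartition O Q φ)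
    {S : Finset I} {ξ : Rd d} (hξ : ξ ∈ O) (hS : ∀ l ∉ S, φ l ξ = 0) : ∑ l ∈ S, φ l ξ = 1 :=
  (hasSum_sum_of_ne_finset_zero hS).unique (h.sum_eq_one ξ hξ)

theorem IsSubordinatePartition.exists_resolves (h : IsSubordinatePartition O Q φ)
    (θ : 𝓓(O, ℂ)) : ∃ S, Resolves φ S θ := by
  obtain ⟨S, hS⟩ := h.exists_finset θ.hasCompactSupport θ.tsupport_subset
  refine ⟨S, fun ξ hξ => ?_, fun l hl ξ => ?_⟩
  · have hξ' : ξ ∈ tsupport θ := subset_tsupport _ hξ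
    exact h.sum_eq_one_of_forall (θ.tsupport_subset hξ') fun l hl => hS l hl ξ hξ'
  · by_cases hξ : θ ξ = 0
    · rw [hξ, mul_zero]
    · rw [hS l hl ξ (subset_tsupport _ hξ), zero_mul]

/-- The index cluster `i*` as a finite set. -/
noncomputable def IsSubordinatePartition.cluster (h : IsSubordinatePartition O Q φ) (i : I) :
    Finset I := (h.admissible.finite_neighbors i).toFinset

theorem IsSubordinatePartition.resolves_cluster (h : IsSubordinatePartition O Q φ) (i : I) :
    Resolves φ (h.cluster i) (φ i) := by
  have key : ∀ l ∉ h.cluster i, ∀ ξ ∈ Q i, φ l ξ = 0 := fun l hl ξ hξ =>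
    h.eq_zero l ξ fun hξl => hl ((Set.Finite.mem_toFinset _).2 ⟨ξ, hξl, hξ⟩)
  have hmem : ∀ ξ, φ i ξ ≠ 0 → ξ ∈ Q i := fun ξ hξ => by_contra fun hn => hξ (h.eq_zero i ξ hn)
  refine ⟨fun ξ hξ => ?_, fun l hl ξ => ?_⟩
  · refine h.sum_eq_one_of_forall ?_ fun l hl => key l hl ξ (hmem ξ hξ)
    exact by_contra fun hn => hξ (test_eq_zero_of_notMem _ hn)
  · by_cases hξ : φ i ξ = 0
    · rw [hξ, mul_zero]
    · rw [key l hl ξ (hmem ξ hξ), zero_mul]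

theorem IsSubordinatePartition.starSum_eq (h : IsSubordinatePartition O Q φ) (i : I) (ξ : Rd d) :
    starSum Q φ i ξ = ∑ l ∈ h.cluster i, φ l ξ :=
  finsum_mem_eq_finite_toFinset_sum _ _

theorem IsSubordinatePartition.card_cluster_le (h : IsSubordinatePartition O Q φ) (i : I) :
    (((h.cluster i).card : ℕ∞)) ≤ coverNumber Q := by
  have : ((h.cluster i).card : ℕ∞) = (neighbors Q i).encard :=
    ((h.admissible.finite_neighbors i).encard_eq_coe_toFinset_card).symm
  rw [this]
  exact le_iSup (fun i => (neighbors Q i).encard) i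

/-- The function `φ_S h = ∑_{l ∈ S} φ_l h`. -/
noncomputable def partSymbol (φ : I → 𝓓(O, ℂ)) (S : Finset I) (h : Rd d → ℂ) (ξ : Rd d) : ℂ :=
  ∑ l ∈ S, φ l ξ * h ξ

theorem continuous_test_mul (θ : 𝓓(O, ℂ)) {h : Rd d → ℂ} (hh : ContinuousOn h O) :
    Continuous (fun ξ => θ ξ * h ξ) := by
  rw [continuous_iff_continuousAt]
  intro ξ
  by_cases hξ : ξ ∈ O
  · exact (θ).continuous.continuousAt.mul (hh.continuousAt (O.isOpen.mem_nhds hξ))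
  · have hn : ξ ∉ tsupport (θ) := fun h => hξ ((θ).tsupport_subset h)
    have : (fun ξ => θ ξ * h ξ) =ᶠ[𝓝 ξ] fun _ => 0 := by
      filter_upwards [notMem_tsupport_iff_eventuallyEq.1 hn] with η hη
      rw [hη]
      simp
    exact continuousAt_const.congr this.symm

/-- Every `φ_l h` has an integrable Fourier transform if `h` is tame. -/
theorem isSymbol_of_isTame {h : Rd d → ℂ} (hh : IsTame φ h) (l : I) :
    IsSymbol (fun ξ => φ l ξ * h ξ) where
  continuous := continuous_test_mul (φ l) hh.1
  hasCompactSupport := (φ l).hasCompactSupport.mul_right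
  integrable_fourier := by
    have hint : Integrable (fun ξ => φ l ξ * h ξ) :=
      (continuous_test_mul (φ l) hh.1).integrable_of_hasCompactSupport
        (φ l).hasCompactSupport.mul_right
    refine ⟨(continuous_fourier hint).aestronglyMeasurable, ?_⟩
    rw [hasFiniteIntegral_iff_enorm, ← eLpNorm_fourierInv]
    exact (le_iSup (fun i => eLpNorm (𝓕⁻ (fun ξ => φ i ξ * h ξ)) 1 volume) l).trans_lt hh.2

theorem isSymbol_partSymbol {h : Rd d → ℂ} (hh : IsTame φ h) (S : Finset I) :
    IsSymbol (partSymbol φ S h) :=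
  IsSymbol.sum S fun l _ => isSymbol_of_isTame hh l

end Partitions

/-! ### Bounded functions as Fourier distributions -/

section Distributions

variable {d : ℕ} {O : Opens (Rd d)}

/-- On the test functions supported in a fixed compact set, `‖𝓕 θ‖_{L^1}` is controlled by finitely
many of the seminorms that define the topology. -/
theorem exists_integral_norm_fourier_le (hd : 1 ≤ d) (K : Compacts (Rd d)) :
    ∃ (s : Finset ℕ) (C : ℝ), 0 ≤ C ∧ ∀ θ : ContDiffMapSupportedIn (Rd d) ℂ ⊤ K,
      ∫ y, ‖𝓕 (θ : Rd d → ℂ) y‖ ≤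
        C * (s.sup fun i => ContDiffMapSupportedIn.seminorm ℂ (Rd d) ℂ ⊤ K i) θ := by
  have hK : volume (K : Set (Rd d)) < ⊤ := K.isCompact.measure_lt_top
  set V := (volume (K : Set (Rd d))).toReal with hV
  set c : ℝ := ((d : ℝ) + 1) / Real.pi ^ d with hc
  have hc0 : 0 ≤ c := by positivity
  have hV0 : 0 ≤ V := ENNReal.toReal_nonneg
  refine ⟨{0, d + 1}, c * V, by positivity, fun θ => ?_⟩
  set N := (({0, d + 1} : Finset ℕ).sup fun i =>
    ContDiffMapSupportedIn.seminorm ℂ (Rd d) ℂ ⊤ K i) θ with hN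
  have hN0 : 0 ≤ N := apply_nonneg _ _
  have hθ : ContDiff ℝ ∞ (θ : Rd d → ℂ) := θ.contDiff
  have hts : tsupport θ ⊆ K := θ.tsupport_subset
  have hcs : HasCompactSupport (θ : Rd d → ℂ) := θ.hasCompactSupport
  have key : ∀ (k : ℕ), k ∈ ({0, d + 1} : Finset ℕ) → ∀ l : Fin d,
      ∫⁻ ξ, ‖(dirDeriv (coordVec l))^[k] θ ξ‖ₑ ≤ ENNReal.ofReal (V * N) := by
    intro k hk l
    have hz : ∀ ξ ∉ (K : Set (Rd d)), ‖(dirDeriv (coordVec l))^[k] θ ξ‖ₑ = 0 := fun ξ hξ => by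
      rw [dirDeriv_iterate_eq_zero_of_notMem_tsupport _ (fun h => hξ (hts h)), enorm_zero]
    rw [← setLIntegral_eq_of_support_subset (s := (K : Set (Rd d)))
      (fun ξ hξ => by_contra fun hn => hξ (hz ξ hn))]
    have hb : ∀ ξ, ‖(dirDeriv (coordVec l))^[k] θ ξ‖ₑ ≤ ENNReal.ofReal N := fun ξ => by
      rw [← ofReal_norm]
      refine ENNReal.ofReal_le_ofReal ?_
      have h1 := norm_dirDeriv_iterate_le (coordVec l) hθ k ξ
      have h2 : ‖(coordVec l : Rd d)‖ = 1 := by simp [coordVec]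
      rw [h2, one_pow, mul_one] at h1
      refine h1.trans
        ((ContDiffMapSupportedIn.norm_iteratedFDeriv_apply_le_seminorm_top ℂ).trans ?_)
      exact Seminorm.le_finset_sup_apply
        (p := fun i => ContDiffMapSupportedIn.seminorm ℂ (Rd d) ℂ ⊤ K i) hk
    calc _ ≤ ∫⁻ _ in (K : Set (Rd d)), ENNReal.ofReal N := lintegral_mono fun ξ => hb ξ
      _ = _ := by
        rw [setLIntegral_const, mul_comm, ENNReal.ofReal_mul hV0, hV, ENNReal.ofReal_toReal hK.ne]
  have hfin := lintegral_fourier_le hd hθ hcs (L := ENNReal.ofReal (V * N))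
    (by simpa using key 0 (by simp) ⟨0, hd⟩) (fun l => key (d + 1) (by simp) l)
  rw [← ENNReal.ofReal_mul hc0] at hfin
  rw [integral_norm_eq_lintegral_enorm
    (continuous_fourier (hθ.continuous.integrable_of_hasCompactSupport hcs)).aestronglyMeasurable,
    mul_assoc]
  exact ENNReal.toReal_le_of_le_ofReal (by positivity) hfin

/-- Linear functionals on `Z(O)` that are continuous on every `𝓕 (C_K^∞)` define Fourier
distributions. -/
noncomputable def mkFourierDistribution (Λ : FourierTestSpace O →ₗ[ℂ] ℂ)
    (h : ∀ (K : Compacts (Rd d)) (hK : (K : Set (Rd d)) ⊆ O),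
      Continuous fun θ : ContDiffMapSupportedIn (Rd d) ℂ ⊤ K =>
        Λ (testFourier O (TestFunction.ofSupportedIn hK θ))) :
    FourierDistribution O :=
  (⟨Λ, continuous_coinduced_dom.2
    ((TestFunction.continuous_iff_continuous_comp (Λ ∘ₗ testFourier O)).2 h)⟩ :
    FourierTestSpace O →L[ℂ] ℂ)

theorem integrable_mul_toFun {G : Rd d → ℂ} (hG : Continuous G) {C : ℝ} (hC : ∀ x, ‖G x‖ ≤ C)
    (v : FourierTestSpace O) : Integrable (fun x => G x * v.toFun x) := by
  obtain ⟨θ, rfl⟩ := exists_eq_testFourier v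
  exact (integrable_fourier_test θ).bdd_mul hG.aestronglyMeasurable (Eventually.of_forall hC)

/-- Bounded continuous functions are Fourier distributions. -/
theorem exists_isGivenBy (hd : 1 ≤ d) {G : Rd d → ℂ} (hG : Continuous G) {C : ℝ}
    (hC : ∀ x, ‖G x‖ ≤ C) : ∃ τ : FourierDistribution O, IsGivenBy τ G := by
  have hC0 : 0 ≤ C := (norm_nonneg _).trans (hC 0)
  let Λ : FourierTestSpace O →ₗ[ℂ] ℂ :=
    { toFun := fun v => ∫ x, G x * v.toFun x
      map_add' := fun v w => by
        rw [← integral_add (integrable_mul_toFun hG hC v) (integrable_mul_toFun hG hC w)]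
        refine integral_congr_ae (Eventually.of_forall fun x => ?_)
        exact mul_add _ _ _
      map_smul' := fun c v => by
        rw [RingHom.id_apply, smul_eq_mul, ← integral_const_mul]
        refine integral_congr_ae (Eventually.of_forall fun x => ?_)
        exact mul_left_comm _ _ _ }
  refine ⟨mkFourierDistribution Λ fun K hK => ?_, fun v => ⟨integrable_mul_toFun hG hC v, rfl⟩⟩
  obtain ⟨s, c, hc, hb⟩ := exists_integral_norm_fourier_le hd K
  let ι : ContDiffMapSupportedIn (Rd d) ℂ ⊤ K →ₗ[ℂ] 𝓓(O, ℂ) :=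
    (TestFunction.ofSupportedInCLM ℂ hK).toLinearMap
  exact (ContDiffMapSupportedIn.mkCLMtoNormedSpace ℂ
    (fun θ : ContDiffMapSupportedIn (Rd d) ℂ ⊤ K => (Λ ∘ₗ testFourier O ∘ₗ ι) θ)
    (fun f g => map_add _ f g) (fun c f => map_smul _ c f)
    ⟨s, C * c, by positivity, fun θ => by
      refine (norm_integral_le_integral_norm _).trans ?_
      have h1 : ∫ x, ‖G x * 𝓕 (θ : Rd d → ℂ) x‖ ≤ ∫ x, C * ‖𝓕 (θ : Rd d → ℂ) x‖ := by
        have hi := integrable_fourier_test (TestFunction.ofSupportedIn hK θ)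
        refine integral_mono_of_nonneg (Eventually.of_forall fun x => norm_nonneg _)
          (hi.norm.const_mul C) (Eventually.of_forall fun x => ?_)
        simp only [norm_mul]
        gcongr
        exact hC x
      rw [integral_const_mul] at h1
      refine h1.trans ?_
      rw [mul_assoc]
      gcongr
      exact hb θ⟩).continuous

end Distributions

/-! ### Fourier multipliers by duality -/

section Multipliers

variable {d : ℕ} {I : Type*} {O : Opens (Rd d)} {Q : I → Set (Rd d)} {φ : I → 𝓓(O, ℂ)}

/-- All the frequency-localized pieces `𝓕⁻ (φ_i · 𝓕 f)` are bounded functions. -/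
def HasBoundedPieces (φ : I → 𝓓(O, ℂ)) (f : FourierDistribution O) : Prop :=
  ∀ i, ∃ C : ℝ, ∀ x, ‖localize (φ i) f x‖ ≤ C

theorem Resolves.sum_mulTest {S : Finset I} {θ : 𝓓(O, ℂ)} (h : Resolves φ S θ) :
    ∑ l ∈ S, mulTest (φ l) θ = θ := by
  refine TestFunction.ext fun ξ => ?_
  have : (∑ l ∈ S, mulTest (φ l) θ) ξ = (∑ l ∈ S, φ l ξ) * θ ξ := by
    simp [Finset.sum_mul]
  rw [this]
  by_cases hξ : θ ξ = 0
  · rw [hξ, mul_zero]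
  · rw [h.sum_eq_one ξ hξ, one_mul]

/-- Every localization of a distribution with bounded pieces is bounded, since `θ` is a finite sum
of the products `φ_l θ`. -/
theorem HasBoundedPieces.exists_bound {f : FourierDistribution O} (hf : HasBoundedPieces φ f)
    (hφ : IsSubordinatePartition O Q φ) (θ : 𝓓(O, ℂ)) : ∃ C : ℝ, ∀ x, ‖localize θ f x‖ ≤ C := by
  obtain ⟨S, hS⟩ := hφ.exists_resolves θ
  choose C hC using hf
  refine ⟨∑ l ∈ S, (∫ y, ‖𝓕 (θ : Rd d → ℂ) y‖) * C l, fun x => ?_⟩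
  rw [← hS.sum_mulTest, localize_sum]
  refine (norm_sum_le _ _).trans (Finset.sum_le_sum fun l _ => ?_)
  rw [localize_mulTest, hS.sum_mulTest]
  exact norm_integral_fourier_mul_shift_le (isSymbol_test θ) (hC l) x

theorem Resolves.partSymbol_mul {S : Finset I} {θ : 𝓓(O, ℂ)} (h : Resolves φ S θ)
    (g : Rd d → ℂ) (ξ : Rd d) : partSymbol φ S g ξ * θ ξ = θ ξ * g ξ := by
  rw [partSymbol, ← Finset.sum_mul]
  by_cases hξ : θ ξ = 0
  · simp [hξ]
  · rw [h.sum_eq_one ξ hξ]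
    ring

/-- `u` is the image of `f` under the Fourier multiplier with symbol `h`, expressed by duality:
`(𝓕 u)(θ) = (𝓕 f)(h θ)`. As `h θ` need not be smooth, `h` is replaced by `φ_S h` with `φ_S = 1` on
the support of `θ`, and its Fourier transform is integrated against the function
`𝓕⁻ (θ · 𝓕 f)`. -/
def IsMultiplierImage (φ : I → 𝓓(O, ℂ)) (h : Rd d → ℂ) (f u : FourierDistribution O) : Prop :=
  ∀ (S : Finset I) (θ : 𝓓(O, ℂ)), Resolves φ S θ →
    u.fourier θ = ∫ y, 𝓕 (partSymbol φ S h) y * localize θ f y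

/-- The localized pieces of `u` are convolutions of those of `f`. -/
theorem IsMultiplierImage.localize_eq {h : Rd d → ℂ} {f u : FourierDistribution O}
    (hu : IsMultiplierImage φ h f u) {S : Finset I} {θ : 𝓓(O, ℂ)} (hS : Resolves φ S θ)
    (x : Rd d) : localize θ u x = ∫ y, 𝓕 (partSymbol φ S h) y * localize θ f (x + y) := by
  refine (hu S _ (hS.expTest x)).trans ?_
  simp_rw [localize_expTest]

theorem IsMultiplierImage.unique (hφ : IsSubordinatePartition O Q φ) {h : Rd d → ℂ}
    {f u v : FourierDistribution O} (hu : IsMultiplierImage φ h f u)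
    (hv : IsMultiplierImage φ h f v) : u = v := by
  refine FourierDistribution.ext_fourier fun θ => ?_
  obtain ⟨S, hS⟩ := hφ.exists_resolves θ
  rw [hu S θ hS, hv S θ hS]

theorem IsMultiplierImage.add (hφ : IsSubordinatePartition O Q φ) {h : Rd d → ℂ}
    (hh : IsTame φ h) {f g u v : FourierDistribution O} (hf : HasBoundedPieces φ f)
    (hg : HasBoundedPieces φ g) (hu : IsMultiplierImage φ h f u)
    (hv : IsMultiplierImage φ h g v) : IsMultiplierImage φ h (f + g) (u + v) := by
  intro S θ hS
  obtain ⟨C, hC⟩ := hf.exists_bound hφ θ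
  obtain ⟨D, hD⟩ := hg.exists_bound hφ θ
  have h1 : (u + v).fourier θ = u.fourier θ + v.fourier θ := rfl
  rw [h1, hu S θ hS, hv S θ hS, localize_add]
  have i1 := integrable_fourier_mul_shift (isSymbol_partSymbol hh S) (continuous_localize θ f) hC 0
  have i2 := integrable_fourier_mul_shift (isSymbol_partSymbol hh S) (continuous_localize θ g) hD 0
  simp only [zero_add] at i1 i2
  rw [← integral_add i1 i2]
  simp only [Pi.add_apply, mul_add]

theorem IsMultiplierImage.smul {h : Rd d → ℂ} (c : ℂ) {f u : FourierDistribution O}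
    (hu : IsMultiplierImage φ h f u) : IsMultiplierImage φ h (c • f) (c • u) := by
  intro S θ hS
  have h1 : (c • u).fourier θ = c * u.fourier θ := rfl
  rw [h1, hu S θ hS, localize_smul, ← integral_const_mul]
  refine integral_congr_ae (Eventually.of_forall fun y => ?_)
  simp only [Pi.smul_apply, smul_eq_mul]
  ring

/-- The multipliers with symbols `h` and `g` are inverse to each other if `g h = 1` on `O`: by the
convolution theorem the composition has the symbol `φ_S g φ_S h = φ_S²`, which is one where `θ` does
not vanish. -/
theorem IsMultiplierImage.comp_eq (hφ : IsSubordinatePartition O Q φ) {h g : Rd d → ℂ}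
    (hh : IsTame φ h) (hg : IsTame φ g) (hgh : ∀ ξ ∈ O, g ξ * h ξ = 1)
    {f u v : FourierDistribution O} (hf : HasBoundedPieces φ f)
    (hu : IsMultiplierImage φ h f u) (hv : IsMultiplierImage φ g u v) : v = f := by
  refine FourierDistribution.ext_fourier fun θ => ?_
  obtain ⟨S, hS⟩ := hφ.exists_resolves θ
  obtain ⟨C, hC⟩ := hf.exists_bound hφ θ
  rw [hv S θ hS]
  simp_rw [hu.localize_eq hS]
  rw [integral_fourier_mul_integral (isSymbol_partSymbol hg S) (isSymbol_partSymbol hh S)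
    (continuous_localize θ f) hC]
  set σ : 𝓓(O, ℂ) := ∑ l ∈ S, φ l with hσ
  have hσ' : ∀ ξ, σ ξ = ∑ l ∈ S, φ l ξ := fun ξ => by simp [hσ]
  have h1 : (fun ξ => partSymbol φ S g ξ * partSymbol φ S h ξ) = (mulTest σ σ : 𝓓(O, ℂ)) := by
    funext ξ
    rw [mulTest_apply, hσ', partSymbol, partSymbol, ← Finset.sum_mul, ← Finset.sum_mul]
    by_cases hξ : ξ ∈ O
    · linear_combination (∑ l ∈ S, φ l ξ) * (∑ l ∈ S, φ l ξ) * hgh ξ hξ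
    · have h0 : ∑ l ∈ S, φ l ξ = 0 :=
        Finset.sum_eq_zero fun l _ => test_eq_zero_of_notMem _ hξ
      simp [h0]
  rw [h1, ← (fourier_mulTest f θ (mulTest σ σ)).2]
  congr 1
  refine TestFunction.ext fun ξ => ?_
  rw [mulTest_apply, mulTest_apply]
  by_cases hξ : θ ξ = 0
  · simp [hξ]
  · rw [hσ', hS.sum_eq_one ξ hξ]
    ring

theorem starSum_mul_eq_partSymbol (hφ : IsSubordinatePartition O Q φ) (i : I) (h : Rd d → ℂ) :
    (fun ξ => starSum Q φ i ξ * h ξ) = partSymbol φ (hφ.cluster i) h := by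
  funext ξ
  rw [hφ.starSum_eq, partSymbol, Finset.sum_mul]

/-- The terms of the series that defines the multiplier, in terms of `φ_i^* h = ∑_{l ∈ i*} φ_l h`.
-/
theorem multiplierTerm_eq (hφ : IsSubordinatePartition O Q φ) (h : Rd d → ℂ)
    (f : FourierDistribution O) (i : I) (x : Rd d) :
    multiplierTerm Q φ h f i x =
      ∫ y, 𝓕 (partSymbol φ (hφ.cluster i) h) y * localize (φ i) f (x + y) := by
  rw [multiplierTerm, MeasureTheory.convolution_def, ← integral_neg_eq_self]
  refine integral_congr_ae (Eventually.of_forall fun y => ?_)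
  simp only [ContinuousLinearMap.mul_apply', sub_neg_eq_add]
  rw [multiplierKernel, starSum_mul_eq_partSymbol hφ, Real.fourierInv_eq_fourier_neg, neg_neg]

/-- The `i`-th term of the series, tested against `𝓕 θ`. The cutoff `φ_i^*` disappears because
`φ_i^* φ_i = φ_i`. -/
theorem integral_multiplierTerm_mul_fourier (hφ : IsSubordinatePartition O Q φ) {h : Rd d → ℂ}
    (hh : IsTame φ h) {f : FourierDistribution O} (hf : HasBoundedPieces φ f) (i : I)
    (θ : 𝓓(O, ℂ)) :
    ∫ x, multiplierTerm Q φ h f i x * 𝓕 (θ : Rd d → ℂ) x =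
      ∫ y, 𝓕 (fun ξ => φ i ξ * h ξ) y * localize θ f y := by
  obtain ⟨C, hC⟩ := hf i
  obtain ⟨D, hD⟩ := hf.exists_bound hφ θ
  have hψ := isSymbol_partSymbol hh (hφ.cluster i)
  calc _ = ∫ x, 𝓕 (θ : Rd d → ℂ) x *
        ∫ y, 𝓕 (partSymbol φ (hφ.cluster i) h) y * localize (φ i) f (x + y) := by
        refine integral_congr_ae (Eventually.of_forall fun x => ?_)
        simp only
        rw [multiplierTerm_eq hφ, mul_comm]
    _ = ∫ z, 𝓕 (fun ξ => partSymbol φ (hφ.cluster i) h ξ * θ ξ) z * localize (φ i) f z := by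
        rw [integral_fourier_mul_integral (isSymbol_test θ) hψ (continuous_localize (φ i) f) hC]
        simp_rw [mul_comm]
    _ = ∫ z, 𝓕 (partSymbol φ (hφ.cluster i) h) z * localize (mulTest θ (φ i)) f z := by
        rw [← integral_fourier_mul_localize_mulTest hψ (φ i) θ f hC, mulTest_comm]
    _ = _ := by
        rw [integral_fourier_mul_localize_mulTest hψ θ (φ i) f hD]
        simp_rw [(hφ.resolves_cluster i).partSymbol_mul]

/-- Tested against a fixed `𝓕 θ`, all but finitely many terms of the series vanish. -/
theorem integral_fourier_mul_localize_eq_zero {h : Rd d → ℂ} (hh : IsTame φ h)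
    (hφ : IsSubordinatePartition O Q φ) {f : FourierDistribution O} (hf : HasBoundedPieces φ f)
    (i : I) {θ : 𝓓(O, ℂ)} (h0 : ∀ ξ, φ i ξ * θ ξ = 0) :
    ∫ y, 𝓕 (fun ξ => φ i ξ * h ξ) y * localize θ f y = 0 := by
  obtain ⟨D, hD⟩ := hf.exists_bound hφ θ
  have hψ := isSymbol_partSymbol hh (hφ.cluster i)
  have h1 := integral_fourier_mul_localize_mulTest hψ θ (φ i) f hD
  simp_rw [(hφ.resolves_cluster i).partSymbol_mul] at h1
  rw [← h1]
  have h2 : mulTest θ (φ i) = 0 := TestFunction.ext fun ξ => by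
    rw [mulTest_apply, mul_comm, h0]
    rfl
  have h3 : ∀ z, localize (mulTest θ (φ i)) f z = 0 := fun z => by
    have : expTest (0 : 𝓓(O, ℂ)) z = 0 := TestFunction.ext fun ξ => by simp
    rw [h2, localize, this, map_zero]
  simp [h3]

/-- Existence of `Φ_h f`, as the sum of its defining series, for every `f` with bounded pieces. -/
theorem exists_isMultiplierImage (hd : 1 ≤ d) (hφ : IsSubordinatePartition O Q φ) {h : Rd d → ℂ}
    (hh : IsTame φ h) {f : FourierDistribution O} (hf : HasBoundedPieces φ f) :
    ∃ u : FourierDistribution O, IsMultiplierImage φ h f u ∧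
      ∃ τ : I → FourierDistribution O, (∀ i, IsGivenBy (τ i) (multiplierTerm Q φ h f i)) ∧
        ∀ v : FourierTestSpace O, HasSum (fun i => (τ i).pair v) (u.pair v) := by
  have hτ : ∀ i, ∃ τ : FourierDistribution O, IsGivenBy τ (multiplierTerm Q φ h f i) := by
    intro i
    obtain ⟨C, hC⟩ := hf i
    have hψ := isSymbol_partSymbol hh (hφ.cluster i)
    have he : multiplierTerm Q φ h f i = _ := funext fun x => multiplierTerm_eq hφ h f i x
    rw [he]
    exact exists_isGivenBy hd
      (continuous_integral_fourier_mul_shift hψ (continuous_localize (φ i) f) hC)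
      (norm_integral_fourier_mul_shift_le hψ hC)
  choose τ hτ using hτ
  have hpair : ∀ i (θ : 𝓓(O, ℂ)), (τ i).pair (testFourier O θ) =
      ∫ y, 𝓕 (fun ξ => φ i ξ * h ξ) y * localize θ f y := fun i θ =>
    (hτ i (testFourier O θ)).2.trans (integral_multiplierTerm_mul_fourier hφ hh hf i θ)
  have hzero : ∀ i (θ : 𝓓(O, ℂ)), (∀ ξ, φ i ξ * θ ξ = 0) → (τ i).pair (testFourier O θ) = 0 :=
    fun i θ h0 => (hpair i θ).trans (integral_fourier_mul_localize_eq_zero hh hφ hf i h0)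
  have hsum : ∀ (S : Finset I) (θ : 𝓓(O, ℂ)), (∀ l ∉ S, ∀ ξ, φ l ξ * θ ξ = 0) →
      ∑ᶠ i, (τ i).pair (testFourier O θ) = ∑ i ∈ S, (τ i).pair (testFourier O θ) := by
    intro S θ hS
    refine finsum_eq_finsetSum_of_support_subset _ fun i hi => ?_
    by_contra hn
    exact hi (hzero i θ (hS i hn))
  have hfin : ∀ v : FourierTestSpace O, (Function.support fun i => (τ i).pair v).Finite := by
    intro v
    obtain ⟨θ, rfl⟩ := exists_eq_testFourier v
    obtain ⟨S, hS⟩ := hφ.exists_resolves θ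
    refine S.finite_toSet.subset fun i hi => ?_
    by_contra hn
    exact hi (hzero i θ (hS.mul_eq_zero i hn))
  let Λ : FourierTestSpace O →ₗ[ℂ] ℂ :=
    { toFun := fun v => ∑ᶠ i, (τ i).pair v
      map_add' := fun v w => by
        rw [← finsum_add_distrib (hfin v) (hfin w)]
        exact finsum_congr fun i => map_add (show FourierTestSpace O →L[ℂ] ℂ from τ i) v w
      map_smul' := fun c v => by
        rw [RingHom.id_apply, smul_finsum]
        exact finsum_congr fun i => map_smul (show FourierTestSpace O →L[ℂ] ℂ from τ i) c v }
  have hcont : ∀ (K : Compacts (Rd d)) (hK : (K : Set (Rd d)) ⊆ O),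
      Continuous fun θ : ContDiffMapSupportedIn (Rd d) ℂ ⊤ K =>
        Λ (testFourier O (TestFunction.ofSupportedIn hK θ)) := by
    intro K hK
    obtain ⟨S, hS⟩ := hφ.exists_finset K.isCompact hK
    have he : ∀ θ : ContDiffMapSupportedIn (Rd d) ℂ ⊤ K,
        Λ (testFourier O (TestFunction.ofSupportedIn hK θ)) =
          ∑ i ∈ S, (τ i).fourier (TestFunction.ofSupportedIn hK θ) := fun θ => by
      refine hsum S _ fun l hl ξ => ?_
      by_cases hξ : ξ ∈ (K : Set (Rd d))
      · rw [hS l hl ξ hξ, zero_mul]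
      · have : (TestFunction.ofSupportedIn hK θ : 𝓓(O, ℂ)) ξ = 0 :=
          image_eq_zero_of_notMem_tsupport fun h => hξ (θ.tsupport_subset h)
        rw [this, mul_zero]
    simp_rw [he]
    exact continuous_finsetSum _ fun i _ =>
      (τ i).fourier.continuous.comp (TestFunction.continuous_ofSupportedIn hK)
  refine ⟨mkFourierDistribution Λ hcont, fun S θ hS => ?_, τ, hτ, fun v => ?_⟩
  · refine (hsum S θ hS.mul_eq_zero).trans ?_
    simp_rw [hpair]
    obtain ⟨D, hD⟩ := hf.exists_bound hφ θ
    have hi : ∀ i ∈ S, Integrable fun y => 𝓕 (fun ξ => φ i ξ * h ξ) y * localize θ f y := by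
      intro i _
      have := integrable_fourier_mul_shift (isSymbol_of_isTame hh i) (continuous_localize θ f) hD 0
      simpa only [zero_add] using this
    rw [← integral_finsetSum S hi]
    refine integral_congr_ae (Eventually.of_forall fun y => ?_)
    have h1 : 𝓕 (partSymbol φ S h) y = ∑ i ∈ S, 𝓕 (fun ξ => φ i ξ * h ξ) y :=
      fourier_sum_apply S (fun i _ => (isSymbol_of_isTame hh i).integrable) y
    simp only
    rw [h1, Finset.sum_mul]
  · have : (mkFourierDistribution Λ hcont).pair v = ∑ i ∈ (hfin v).toFinset, (τ i).pair v :=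
      finsum_eq_sum _ (hfin v)
    rw [this]
    exact hasSum_sum_of_ne_finset_zero fun i hi => by_contra fun hn =>
      hi ((hfin v).mem_toFinset.2 hn)

end Multipliers

/-! ### Fourier multipliers on decomposition spaces -/

section MultiplierOperators

variable {d : ℕ} {I : Type*} {O : Opens (Rd d)} {Q : I → Set (Rd d)} {φ : I → 𝓓(O, ℂ)}

theorem memLp_fourier_test (θ : 𝓓(O, ℂ)) (p : ℝ≥0∞) : MemLp (𝓕 (θ : Rd d → ℂ)) p volume := by
  obtain ⟨g, hg⟩ := exists_schwartz_fourier θ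
  rw [← hg]
  exact g.memLp p

/-- Band-limited `L^p` functions are bounded: the piece equals its own convolution with `𝓕 φ_i^*`,
so that Hölder's inequality applies. -/
theorem exists_bound_localize_of_eLpNorm_lt_top (hφ : IsSubordinatePartition O Q φ)
    (f : FourierDistribution O) (i : I) {p : ℝ≥0∞} [hp : Fact (1 ≤ p)]
    (h : eLpNorm (localize (φ i) f) p volume < ⊤) : ∃ C : ℝ, ∀ x, ‖localize (φ i) f x‖ ≤ C := by
  set σ : 𝓓(O, ℂ) := ∑ l ∈ hφ.cluster i, φ l with hσ
  set D := eLpNorm (𝓕 (σ : Rd d → ℂ)) (ENNReal.conjExponent p) volume *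
    eLpNorm (localize (φ i) f) p volume with hD
  have hDt : D < ⊤ := ENNReal.mul_lt_top (memLp_fourier_test σ _).2 h
  have hm : mulTest (φ i) σ = φ i := TestFunction.ext fun ξ => by
    have h1 : σ ξ = ∑ l ∈ hφ.cluster i, φ l ξ := by simp [hσ]
    rw [mulTest_apply, h1]
    by_cases hξ : φ i ξ = 0
    · rw [hξ, zero_mul]
    · rw [(hφ.resolves_cluster i).sum_eq_one ξ hξ, mul_one]
  refine ⟨D.toReal, fun x => ?_⟩
  have hc := continuous_localize (φ i) f
  have key : ‖localize (φ i) f x‖ₑ ≤ D := by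
    have h1 : localize (φ i) f x = ∫ y, 𝓕 (σ : Rd d → ℂ) y * localize (φ i) f (x + y) := by
      conv_lhs => rw [← hm]
      exact localize_mulTest _ _ _ _
    have hmp := measurePreserving_add_left (volume : Measure (Rd d)) x
    have h2 : eLpNorm (fun y => localize (φ i) f (x + y)) p volume =
        eLpNorm (localize (φ i) f) p volume :=
      eLpNorm_comp_measurePreserving hc.aestronglyMeasurable hmp
    have : (ENNReal.conjExponent p).HolderConjugate p :=
      (ENNReal.HolderConjugate.conjExponent hp.out).symm
    have h3 := eLpNorm_smul_le_mul_eLpNorm (p := ENNReal.conjExponent p) (q := p) (r := 1)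
      (μ := volume) (φ := 𝓕 (σ : Rd d → ℂ)) (f := fun y => localize (φ i) f (x + y))
      (hc.comp (continuous_const.add continuous_id)).aestronglyMeasurable
      (continuous_fourier_test σ).aestronglyMeasurable
    rw [h2, eLpNorm_one_eq_lintegral_enorm] at h3
    rw [h1]
    exact (enorm_integral_le_lintegral_enorm _).trans h3
  have := ENNReal.toReal_mono hDt.ne key
  rwa [toReal_enorm] at this

/-- The weights are positive, so each single piece of an element of the decomposition space is in
`L^p`. -/
theorem eLpNorm_localize_lt_top {w : I → ℝ} (hw : ∀ i, 0 < w i) {p q : ℝ≥0∞} (hq : 1 ≤ q)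
    {f : FourierDistribution O} (hf : decompENorm φ w p q f < ⊤) (i : I) :
    eLpNorm (localize (φ i) f) p volume < ⊤ := by
  let _ : MeasurableSpace I := ⊤
  have h1 := enorm_le_eLpNorm_count
    (fun i => ENNReal.ofReal (w i) * eLpNorm (localize (φ i) f) p volume) i
    (zero_lt_one.trans_le hq).ne'
  have h2 := h1.trans_lt hf
  rw [enorm_eq_self] at h2
  exact ENNReal.lt_top_of_mul_ne_top_right h2.ne (ENNReal.ofReal_pos.2 (hw i)).ne'

theorem hasBoundedPieces_of_decompENorm_lt_top (hφ : IsSubordinatePartition O Q φ) {w : I → ℝ}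
    (hw : ∀ i, 0 < w i) {p q : ℝ≥0∞} [Fact (1 ≤ p)] [hq : Fact (1 ≤ q)]
    {f : FourierDistribution O} (hf : decompENorm φ w p q f < ⊤) : HasBoundedPieces φ f :=
  fun i => exists_bound_localize_of_eLpNorm_lt_top hφ f i (eLpNorm_localize_lt_top hw hq.out hf i)

/-- `sup_i ‖𝓕⁻ (φ_i h)‖_{L^1}`. -/
noncomputable def tameConst (φ : I → 𝓓(O, ℂ)) (h : Rd d → ℂ) : ℝ≥0∞ :=
  ⨆ i, eLpNorm (𝓕⁻ (fun ξ => φ i ξ * h ξ)) 1 volume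

theorem lintegral_fourier_partSymbol_le {h : Rd d → ℂ} (hh : IsTame φ h) (S : Finset I) :
    ∫⁻ y, ‖𝓕 (partSymbol φ S h) y‖ₑ ≤ S.card * tameConst φ h := by
  calc ∫⁻ y, ‖𝓕 (partSymbol φ S h) y‖ₑ
      ≤ ∫⁻ y, ∑ l ∈ S, ‖𝓕 (fun ξ => φ l ξ * h ξ) y‖ₑ := by
        refine lintegral_mono fun y => ?_
        have h1 : 𝓕 (partSymbol φ S h) y = ∑ i ∈ S, 𝓕 (fun ξ => φ i ξ * h ξ) y :=
          fourier_sum_apply S (fun i _ => (isSymbol_of_isTame hh i).integrable) y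
        rw [h1]
        exact enorm_sum_le _ _
    _ = ∑ l ∈ S, ∫⁻ y, ‖𝓕 (fun ξ => φ l ξ * h ξ) y‖ₑ :=
        lintegral_finsetSum _ fun l _ =>
          (isSymbol_of_isTame hh l).continuous_fourier.enorm.measurable
    _ ≤ ∑ _l ∈ S, tameConst φ h := by
        refine Finset.sum_le_sum fun l _ => ?_
        rw [← eLpNorm_fourierInv]
        exact le_iSup (fun i => eLpNorm (𝓕⁻ (fun ξ => φ i ξ * h ξ)) 1 volume) l
    _ = _ := by rw [Finset.sum_const, nsmul_eq_mul]

theorem lintegral_fourier_partSymbol_cluster_le (hφ : IsSubordinatePartition O Q φ)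
    {h : Rd d → ℂ} (hh : IsTame φ h) (i : I) :
    ∫⁻ y, ‖𝓕 (partSymbol φ (hφ.cluster i) h) y‖ₑ ≤
      ((coverNumber Q : ℕ∞) : ℝ≥0∞) * tameConst φ h := by
  refine (lintegral_fourier_partSymbol_le hh _).trans ?_
  gcongr
  exact ENat.toENNReal_le.2 (hφ.card_cluster_le i)

theorem coverNumber_mul_tameConst_lt_top (hφ : IsSubordinatePartition O Q φ) {h : Rd d → ℂ}
    (hh : IsTame φ h) : ((coverNumber Q : ℕ∞) : ℝ≥0∞) * tameConst φ h < ⊤ := by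
  refine ENNReal.mul_lt_top ?_ hh.2
  rw [← ENat.toENNReal_top]
  exact ENat.toENNReal_lt.2 hφ.admissible.finite_number

/-- Fourier multipliers are bounded on decomposition spaces. -/
theorem IsMultiplierImage.decompENorm_le (hφ : IsSubordinatePartition O Q φ) {h : Rd d → ℂ}
    (hh : IsTame φ h) {f u : FourierDistribution O} (hu : IsMultiplierImage φ h f u) (w : I → ℝ)
    {p : ℝ≥0∞} (hp : 1 ≤ p) (q : ℝ≥0∞) :
    decompENorm φ w p q u ≤
      ((coverNumber Q : ℕ∞) : ℝ≥0∞) * tameConst φ h * decompENorm φ w p q f := by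
  have ht := (coverNumber_mul_tameConst_lt_top hφ hh).ne
  rw [← ENNReal.coe_toNNReal ht]
  refine le_trans (weightedLqNorm_mono w q fun i => ?_) (weightedLqNorm_const_mul_le w q _ _)
  rw [ENNReal.coe_toNNReal ht]
  have he : localize (φ i) u = _ := funext fun x => hu.localize_eq (hφ.resolves_cluster i) x
  rw [he]
  refine (eLpNorm_integral_mul_shift_le (isSymbol_partSymbol hh _).continuous_fourier
    (continuous_localize _ _) hp).trans ?_
  gcongr
  exact lintegral_fourier_partSymbol_cluster_le hφ hh i

theorem memLp_multiplierKernel (hφ : IsSubordinatePartition O Q φ) {h : Rd d → ℂ}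
    (hh : IsTame φ h) (i : I) : MemLp (multiplierKernel Q φ h i) 1 volume := by
  rw [multiplierKernel, starSum_mul_eq_partSymbol hφ]
  refine ⟨?_, ?_⟩
  · have : 𝓕⁻ (partSymbol φ (hφ.cluster i) h) =
        fun x => 𝓕 (partSymbol φ (hφ.cluster i) h) (-x) :=
      funext fun x => Real.fourierInv_eq_fourier_neg _ _
    rw [this]
    exact ((isSymbol_partSymbol hh _).continuous_fourier.comp
      continuous_neg).aestronglyMeasurable
  · rw [eLpNorm_fourierInv]
    exact (lintegral_fourier_partSymbol_cluster_le hφ hh i).trans_lt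
      (coverNumber_mul_tameConst_lt_top hφ hh)

/-- The Fourier multiplier as a bounded operator on a decomposition space. -/
theorem exists_multiplierOperator (hd : 1 ≤ d) (hφ : IsSubordinatePartition O Q φ) {h : Rd d → ℂ}
    (hh : IsTame φ h) {w : I → ℝ} (hw : ∀ i, 0 < w i) (p q : ℝ≥0∞) [hp : Fact (1 ≤ p)]
    [hq : Fact (1 ≤ q)] :
    ∃ T : DecompSpace φ w p q →ₗ[ℂ] DecompSpace φ w p q,
      (∀ f, IsMultiplierImage φ h f.toDist (T f).toDist) ∧
      (∀ f, IsMultiplierValue Q φ h p f.toDist (T f).toDist) ∧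
      ∀ f, ‖T f‖ ≤ (((coverNumber Q : ℕ∞) : ℝ≥0∞) * tameConst φ h).toReal * ‖f‖ := by
  have hb : ∀ f : DecompSpace φ w p q, HasBoundedPieces φ f.toDist := fun f =>
    hasBoundedPieces_of_decompENorm_lt_top hφ hw f.2
  choose U hU τ hτ using fun f : DecompSpace φ w p q =>
    exists_isMultiplierImage hd hφ hh (hb f)
  have hle : ∀ f, decompENorm φ w p q (U f) ≤ _ := fun f =>
    (hU f).decompENorm_le hφ hh w hp.out q
  have hlt := (coverNumber_mul_tameConst_lt_top hφ hh)
  have hmem : ∀ f, decompENorm φ w p q (U f) < ⊤ := fun f =>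
    (hle f).trans_lt (ENNReal.mul_lt_top hlt f.2)
  let T : DecompSpace φ w p q →ₗ[ℂ] DecompSpace φ w p q :=
    { toFun := fun f => ⟨U f, hmem f⟩
      map_add' := fun f g => Subtype.ext
        ((hU (f + g)).unique hφ ((hU f).add hφ hh (hb f) (hb g) (hU g)))
      map_smul' := fun c f => Subtype.ext ((hU (c • f)).unique hφ ((hU f).smul c)) }
  refine ⟨T, hU, fun f => ⟨memLp_multiplierKernel hφ hh, fun i => ?_, τ f, hτ f⟩, fun f => ?_⟩
  · exact ⟨(continuous_localize _ _).aestronglyMeasurable,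
      eLpNorm_localize_lt_top hw hq.out f.2 i⟩
  · have := ENNReal.toReal_mono (ENNReal.mul_lt_top hlt f.2).ne (hle f)
    rwa [ENNReal.toReal_mul] at this

/-- A tame symbol `h` with a tame inverse `g` gives boundedly invertible Fourier multipliers; the
inverse is the multiplier with symbol `g`. -/
theorem isMultiplierInvertible_of_mul_eq_one (hd : 1 ≤ d) (hφ : IsSubordinatePartition O Q φ)
    {h g : Rd d → ℂ} (hh : IsTame φ h) (hg : IsTame φ g) (hgh : ∀ ξ ∈ O, g ξ * h ξ = 1)
    {K : ℝ≥0∞} (hK : ((coverNumber Q : ℕ∞) : ℝ≥0∞) * tameConst φ g ≤ K) :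
    IsMultiplierInvertible Q φ h K := by
  intro p q _ _ w hw
  obtain ⟨T, hT, hTv, hTn⟩ := exists_multiplierOperator hd hφ hh hw.pos p q
  obtain ⟨R, hR, -, hRn⟩ := exists_multiplierOperator hd hφ hg hw.pos p q
  have hb : ∀ f : DecompSpace φ w p q, HasBoundedPieces φ f.toDist := fun f =>
    hasBoundedPieces_of_decompENorm_lt_top hφ hw.pos f.2
  have hTR : ∀ f, T (R f) = f := fun f => Subtype.ext
    ((hR f).comp_eq hφ hg hh (fun ξ hξ => by rw [mul_comm, hgh ξ hξ]) (hb f) (hT (R f)))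
  have hRT : ∀ f, R (T f) = f := fun f => Subtype.ext
    ((hT f).comp_eq hφ hh hg hgh (hb f) (hR (T f)))
  let e : DecompSpace φ w p q ≃ₗ[ℂ] DecompSpace φ w p q :=
    LinearEquiv.ofLinearMap T R (LinearMap.ext hTR) (LinearMap.ext hRT)
  let E := e.toContinuousLinearEquivOfBounds _ _ hTn hRn
  refine ⟨E, hTv, le_trans ?_ hK⟩
  have hlt := coverNumber_mul_tameConst_lt_top hφ hg
  have hn : ‖(E.symm : DecompSpace φ w p q →L[ℂ] DecompSpace φ w p q)‖ ≤
      (((coverNumber Q : ℕ∞) : ℝ≥0∞) * tameConst φ g).toReal :=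
    ContinuousLinearMap.opNorm_le_bound _ ENNReal.toReal_nonneg hRn
  rw [← ofReal_norm, ← ENNReal.ofReal_toReal hlt.ne]
  exact ENNReal.ofReal_le_ofReal hn

/-- At a point of `Q_i` the `φ_l` with `l ∈ i*` add up to one, and each of them is at most `C_Φ`.
This makes room for the additional factor `N_Q C_Φ` in the bound for the inverse. -/
theorem one_le_coverNumber_mul_bapuConst (hφ : IsSubordinatePartition O Q φ) :
    1 ≤ ((coverNumber Q : ℕ∞) : ℝ≥0∞) * bapuConst φ := by
  obtain ⟨ξ, hξ⟩ := hφ.admissible.nonempty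
  have hξ' := hξ
  rw [← hφ.admissible.cover] at hξ'
  obtain ⟨i, hi⟩ := mem_iUnion.1 hξ'
  have h0 : ∀ l ∉ hφ.cluster i, φ l ξ = 0 := fun l hl =>
    hφ.eq_zero l ξ fun hξl => hl ((Set.Finite.mem_toFinset _).2 ⟨ξ, hξl, hi⟩)
  have h1 := hφ.sum_eq_one_of_forall hξ h0
  have hpt : ∀ l, ‖φ l ξ‖ₑ ≤ bapuConst φ := by
    intro l
    refine ((isSymbol_test (φ l)).enorm_le ξ).trans ?_
    rw [← eLpNorm_fourierInv]
    exact le_iSup (fun i => eLpNorm (𝓕⁻ (φ i : Rd d → ℂ)) 1 volume) l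
  calc (1 : ℝ≥0∞) = ‖∑ l ∈ hφ.cluster i, φ l ξ‖ₑ := by rw [h1, enorm_one]
    _ ≤ ∑ l ∈ hφ.cluster i, ‖φ l ξ‖ₑ := enorm_sum_le _ _
    _ ≤ ∑ _l ∈ hφ.cluster i, bapuConst φ := Finset.sum_le_sum fun l _ => hpt l
    _ = (hφ.cluster i).card * bapuConst φ := by rw [Finset.sum_const, nsmul_eq_mul]
    _ ≤ _ := by
        gcongr
        exact ENat.toENNReal_le.2 (hφ.card_cluster_le i)

end MultiplierOperators

/-! ### Pointwise consequences of the regularity of the partition -/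

section Regularity

variable {d : ℕ}

/-- Pure partial derivatives are multi-index derivatives, and thus covered by the constants
`C_{Q,Φ,α}` and by `maxDeriv`. -/
theorem multiDeriv_single {F : Type*} [NormedAddCommGroup F] [NormedSpace ℝ F] (l : Fin d) (k : ℕ)
    (f : Rd d → F) : multiDeriv (Pi.single l k) f = (dirDeriv (coordVec l))^[k] f := by
  have key : ∀ L : List (Fin d), L.Nodup →
      L.foldr (fun m h => (partialDeriv m)^[(Pi.single l k : Fin d → ℕ) m] h) f =
        if l ∈ L then (dirDeriv (coordVec l))^[k] f else f := by
    intro L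
    induction L with
    | nil => simp
    | cons m L ih =>
      intro hL
      rw [List.nodup_cons] at hL
      rw [List.foldr_cons, ih hL.2]
      by_cases hm : m = l
      · subst hm
        simp [hL.1]
        rfl
      · rw [Pi.single_eq_of_ne hm]
        simp [Ne.symm hm]
  have := key _ (List.nodup_finRange d)
  simpa [multiDeriv] using this

theorem sum_single_le {l : Fin d} {k n : ℕ} (hk : k ≤ n) :
    ∑ m, (Pi.single l k : Fin d → ℕ) m ≤ n := by
  rw [Finset.sum_pi_single']
  simpa using hk

theorem finite_multiIndex (n : ℕ) : Finite {α : Fin d → ℕ // ∑ l, α l ≤ n} := by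
  have : {α : Fin d → ℕ | ∑ l, α l ≤ n} ⊆ Set.Iic (fun _ => n) := fun α hα l =>
    (Finset.single_le_sum (fun _ _ => Nat.zero_le _) (Finset.mem_univ l)).trans hα
  exact ((Set.finite_Iic _).subset this).to_subtype

theorem enorm_dirDeriv_iterate_le_maxDeriv {F : Type*} [NormedAddCommGroup F] [NormedSpace ℝ F]
    (l : Fin d) {k n : ℕ} (hk : k ≤ n) (f : Rd d → F) (x : Rd d) :
    ‖(dirDeriv (coordVec l))^[k] f x‖ₑ ≤ maxDeriv n f x := by
  rw [← multiDeriv_single]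
  exact le_iSup (fun ν : {ν : Fin d → ℕ // ∑ l, ν l ≤ n} => ‖multiDeriv ν.1 f x‖ₑ)
    ⟨Pi.single l k, sum_single_le hk⟩

/-- Weak inequalities that hold almost everywhere on an open set propagate by continuity. -/
theorem le_of_ae_of_continuousOn {f : Rd d → ℝ} {O : Opens (Rd d)} (hf : ContinuousOn f O) {a : ℝ}
    (h : ∀ᵐ ξ, ξ ∈ O → a ≤ f ξ) {ξ : Rd d} (hξ : ξ ∈ O) : a ≤ f ξ := by
  by_contra! hlt
  have hev : ∀ᶠ η in 𝓝 ξ, η ∈ O ∧ f η < a :=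
    Filter.Eventually.and (O.isOpen.mem_nhds hξ)
      ((hf.continuousAt (O.isOpen.mem_nhds hξ)).eventually_lt_const hlt)
  have hpos : volume {η | η ∈ O ∧ f η < a} ≠ 0 :=
    (Measure.measure_pos_of_mem_nhds volume hev).ne'
  refine hpos (measure_mono_null (fun η hη => ?_) h)
  simp only [mem_compl_iff, mem_ofPred_eq, Classical.not_imp, not_le]
  exact hη

theorem enorm_le_eLpNorm_top_of_continuous {f : Rd d → ℂ} (hf : Continuous f) (x : Rd d) :
    ‖f x‖ₑ ≤ eLpNorm f ⊤ volume := by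
  by_contra! hlt
  have hev : ∀ᶠ y in 𝓝 x, eLpNorm f ⊤ volume < ‖f y‖ₑ :=
    hf.enorm.continuousAt.eventually_const_lt hlt
  refine (Measure.measure_pos_of_mem_nhds volume hev).ne' ?_
  have := enorm_ae_le_eLpNormEssSup f volume
  exact measure_mono_null (fun y hy => by simpa using hy) this

variable {I : Type*} {O : Opens (Rd d)} {A : I → Rd d ≃L[ℝ] Rd d} {b : I → Rd d}
  {Q' : I → Set (Rd d)} {φ : I → 𝓓(O, ℂ)}

theorem contDiff_affMap (A : Rd d ≃L[ℝ] Rd d) (b : Rd d) : ContDiff ℝ ∞ (affMap A b) :=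
  A.contDiff.add contDiff_const

/-- `S ξ = A ξ + b` as a homeomorphism. -/
noncomputable def affHomeomorph (A : Rd d ≃L[ℝ] Rd d) (b : Rd d) : Rd d ≃ₜ Rd d :=
  A.toHomeomorph.trans (Homeomorph.addRight b)

theorem contDiff_test_comp_affMap (θ : 𝓓(O, ℂ)) (A : Rd d ≃L[ℝ] Rd d) (b : Rd d) :
    ContDiff ℝ ∞ (fun ξ => θ (affMap A b ξ)) := by
  have h : ContDiff ℝ ∞ (θ : Rd d → ℂ) := θ.contDiff
  exact h.comp (contDiff_affMap A b)

theorem hasCompactSupport_comp_affMap {f : Rd d → ℂ} (hf : HasCompactSupport f)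
    (A : Rd d ≃L[ℝ] Rd d) (b : Rd d) : HasCompactSupport (fun ξ => f (affMap A b ξ)) :=
  hf.comp_homeomorph (affHomeomorph A b)

theorem IsRegularPartition.maxRegularityConst_lt_top (hφ : IsRegularPartition A b Q' φ) (n : ℕ) :
    maxRegularityConst n A b φ < ⊤ := by
  have := finite_multiIndex (d := d) n
  have : Nonempty {α : Fin d → ℕ // ∑ l, α l ≤ n} := ⟨⟨0, by simp⟩⟩
  obtain ⟨α, hα⟩ := exists_eq_ciSup_of_finite
    (f := fun α : {α : Fin d → ℕ // ∑ l, α l ≤ n} => regularityConst A b φ α.1)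
  rw [maxRegularityConst, ← hα]
  exact hφ.regular α.1

/-- The bounds for the `φ_i ∘ S_i` hold at every point, by continuity. -/
theorem IsRegularPartition.norm_dirDeriv_iterate_le (hφ : IsRegularPartition A b Q' φ) {n k : ℕ}
    (hk : k ≤ n) (i : I) (l : Fin d) (ξ : Rd d) :
    ‖(dirDeriv (coordVec l))^[k] (fun ξ => φ i (affMap (A i) (b i) ξ)) ξ‖ ≤
      (maxRegularityConst n A b φ).toReal := by
  have hc : Continuous ((dirDeriv (coordVec l))^[k] (fun ξ => φ i (affMap (A i) (b i) ξ))) :=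
    (contDiff_dirDeriv_iterate _ (contDiff_test_comp_affMap (φ i) (A i) (b i)) k).continuous
  have h1 := enorm_le_eLpNorm_top_of_continuous hc ξ
  rw [← multiDeriv_single] at h1 ⊢
  have h2 : eLpNorm (multiDeriv (Pi.single l k) (fun ξ => φ i (affMap (A i) (b i) ξ))) ⊤ volume ≤
      maxRegularityConst n A b φ :=
    (le_iSup (fun i => eLpNorm (multiDeriv (Pi.single l k)
      (fun ξ => φ i (affMap (A i) (b i) ξ))) ⊤ volume) i).trans
      (le_iSup (fun α : {α : Fin d → ℕ // ∑ l, α l ≤ n} => regularityConst A b φ α.1)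
        ⟨Pi.single l k, sum_single_le hk⟩)
  have := ENNReal.toReal_mono (hφ.maxRegularityConst_lt_top n).ne (h1.trans h2)
  rwa [toReal_enorm] at this

end Regularity

/-! ### Norms in `L^{d+1}` on the pieces of the cover -/

section LqNorms

variable {d : ℕ}

/-- The norm `‖m‖_{L^{d+1}(Q)}`. -/
noncomputable def localNorm (Q : Set (Rd d)) (m : Rd d → ℝ≥0∞) : ℝ≥0∞ :=
  (∫⁻ ξ in Q, m ξ ^ (d + 1)) ^ ((1 : ℝ) / (d + 1))

theorem localNorm_eq (Q : Set (Rd d)) (m : Rd d → ℝ≥0∞) :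
    localNorm Q m = eLpNorm' m ((d : ℝ) + 1) (volume.restrict Q) := by
  have h : ∀ ξ, m ξ ^ (d + 1) = ‖m ξ‖ₑ ^ ((d : ℝ) + 1) := fun ξ => by
    rw [enorm_eq_self, ← ENNReal.rpow_natCast]
    push_cast
    rfl
  simp only [localNorm, eLpNorm', h]

theorem localNorm_pow (Q : Set (Rd d)) (m : Rd d → ℝ≥0∞) :
    localNorm Q m ^ (d + 1) = ∫⁻ ξ in Q, m ξ ^ (d + 1) := by
  rw [localNorm, ← ENNReal.rpow_natCast, ← ENNReal.rpow_mul]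
  push_cast
  rw [one_div_mul_cancel (by positivity), ENNReal.rpow_one]

theorem localNorm_sum_le {J : Type*} (F : Finset J) (Q : Set (Rd d)) {m : J → Rd d → ℝ≥0∞}
    (hm : ∀ j, Measurable (m j)) :
    localNorm Q (fun ξ => ∑ j ∈ F, m j ξ) ≤ ∑ j ∈ F, localNorm Q (m j) := by
  simp only [localNorm_eq]
  have h := eLpNorm'_sum_le (μ := volume.restrict Q) (f := m) (s := F) (q := (d : ℝ) + 1)
    (fun j _ => (hm j).aestronglyMeasurable) (by linarith [(Nat.cast_nonneg d : (0 : ℝ) ≤ d)])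
  have he : (fun ξ => ∑ j ∈ F, m j ξ) = ∑ j ∈ F, m j := by
    funext ξ
    rw [Finset.sum_apply]
  rw [he]
  exact h

theorem setLIntegral_le_localNorm_mul {Q : Set (Rd d)} {m : Rd d → ℝ≥0∞} (hm : Measurable m)
    {V : ℝ≥0∞} (hV : 1 ≤ V) (hQ : volume Q ≤ V) : ∫⁻ ξ in Q, m ξ ≤ localNorm Q m * V := by
  have hd : (1 : ℝ) ≤ (d : ℝ) + 1 := by linarith [(Nat.cast_nonneg d : (0 : ℝ) ≤ d)]
  have h := eLpNorm'_le_eLpNorm'_mul_rpow_measure_univ (μ := volume.restrict Q) (f := m)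
    zero_lt_one hd hm.aestronglyMeasurable
  rw [← localNorm_eq] at h
  have h1 : eLpNorm' m 1 (volume.restrict Q) = ∫⁻ ξ in Q, m ξ := by
    simp [eLpNorm']
  rw [h1] at h
  refine h.trans ?_
  gcongr
  rw [Measure.restrict_apply_univ]
  have he0 : 0 ≤ 1 / 1 - 1 / ((d : ℝ) + 1) := by
    rw [one_div_one, sub_nonneg, div_le_one (by linarith)]
    exact hd
  have he1 : 1 / 1 - 1 / ((d : ℝ) + 1) ≤ 1 := by
    rw [one_div_one]
    have : 0 ≤ 1 / ((d : ℝ) + 1) := by positivity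
    linarith
  calc volume Q ^ (1 / 1 - 1 / ((d : ℝ) + 1)) ≤ V ^ (1 / 1 - 1 / ((d : ℝ) + 1)) := by gcongr
    _ ≤ V ^ (1 : ℝ) := ENNReal.rpow_le_rpow_of_exponent_le hV he1
    _ = V := ENNReal.rpow_one V

end LqNorms

/-! ### Limits and localization of `L^1`-bounds for Fourier transforms -/

section FourierL1

variable {d : ℕ}

theorem lintegral_le_setLIntegral_of_ae {Q : Set (Rd d)} (hQ : MeasurableSet Q)
    {f v : Rd d → ℝ≥0∞} (h : ∀ᵐ ξ, ξ ∈ Q → f ξ ≤ v ξ) (h0 : ∀ᵐ ξ, ξ ∉ Q → f ξ = 0) :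
    ∫⁻ ξ, f ξ ≤ ∫⁻ ξ in Q, v ξ := by
  rw [← lintegral_indicator hQ]
  refine lintegral_mono_ae ?_
  filter_upwards [h, h0] with ξ h1 h2
  by_cases hξ : ξ ∈ Q
  · rw [indicator_of_mem hξ]
    exact h1 hξ
  · rw [indicator_of_notMem hξ, h2 hξ]

/-- The `L^1`-norm of a Fourier transform is controlled by pointwise bounds for the derivatives on a
set outside of which the function vanishes. -/
theorem lintegral_fourier_le_setLIntegral (hd : 1 ≤ d) {f : Rd d → ℂ} (hf : ContDiff ℝ ∞ f)
    (hs : HasCompactSupport f) {Q : Set (Rd d)} (hQ : MeasurableSet Q) (h0 : ∀ ξ ∉ Q, f ξ = 0)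
    {v : Rd d → ℝ≥0∞} (hv : ∀ (l : Fin d), ∀ k ≤ d + 1, ∀ᵐ ξ, ξ ∈ Q →
      ‖(dirDeriv (coordVec l))^[k] f ξ‖ₑ ≤ v ξ) :
    ∫⁻ w, ‖𝓕 f w‖ₑ ≤ ENNReal.ofReal (((d : ℝ) + 1) / Real.pi ^ d) * ∫⁻ ξ in Q, v ξ := by
  have key : ∀ (l : Fin d), ∀ k ≤ d + 1,
      ∫⁻ ξ, ‖(dirDeriv (coordVec l))^[k] f ξ‖ₑ ≤ ∫⁻ ξ in Q, v ξ := by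
    intro l k hk
    refine lintegral_le_setLIntegral_of_ae hQ (hv l k hk) ?_
    filter_upwards [ae_dirDeriv_iterate_eq_zero_of_eq_zero (coordVec l) hf k] with ξ hξ hn
    rw [hξ (h0 ξ hn), enorm_zero]
  exact lintegral_fourier_le hd hf hs (by simpa using key ⟨0, hd⟩ 0 (by omega))
    (fun l => key l (d + 1) le_rfl)

theorem isSymbol_of_lintegral_lt_top {f : Rd d → ℂ} (hf : Continuous f) (hs : HasCompactSupport f)
    (h : ∫⁻ w, ‖𝓕 f w‖ₑ < ⊤) : IsSymbol f :=
  ⟨hf, hs, (continuous_fourier (hf.integrable_of_hasCompactSupport hs)).aestronglyMeasurable, h⟩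

/-- Lower semicontinuity of `f ↦ ‖𝓕 f‖_{L^1}` under dominated convergence. -/
theorem lintegral_fourier_le_of_tendsto {f : ℕ → Rd d → ℂ} {g : Rd d → ℂ} {G : Rd d → ℝ}
    (hf : ∀ n, AEStronglyMeasurable (f n) volume) (hG : Integrable G)
    (hb : ∀ n ξ, ‖f n ξ‖ ≤ G ξ) (hlim : ∀ ξ, Tendsto (fun n => f n ξ) atTop (𝓝 (g ξ)))
    {B : ℝ≥0∞} (hB : ∀ n, ∫⁻ w, ‖𝓕 (f n) w‖ₑ ≤ B) : ∫⁻ w, ‖𝓕 g w‖ₑ ≤ B := by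
  have hint : ∀ n, Integrable (f n) := fun n =>
    hG.mono' (hf n) (Eventually.of_forall (hb n))
  have hpt : ∀ w, Tendsto (fun n => 𝓕 (f n) w) atTop (𝓝 (𝓕 g w)) := by
    intro w
    simp_rw [Real.fourier_eq]
    refine tendsto_integral_of_dominated_convergence G (fun n => ?_) hG (fun n => ?_) ?_
    · exact ((Real.fourierIntegral_convergent_iff w).2 (hint n)).aestronglyMeasurable
    · refine Eventually.of_forall fun ξ => ?_
      rw [Circle.norm_smul]
      exact hb n ξ
    · exact Eventually.of_forall fun ξ => (hlim ξ).const_smul _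
  calc ∫⁻ w, ‖𝓕 g w‖ₑ = ∫⁻ w, liminf (fun n => ‖𝓕 (f n) w‖ₑ) atTop :=
        lintegral_congr fun w => ((hpt w).enorm.liminf_eq).symm
    _ ≤ liminf (fun n => ∫⁻ w, ‖𝓕 (f n) w‖ₑ) atTop :=
        lintegral_liminf_le fun n => (continuous_fourier (hint n)).enorm.measurable
    _ ≤ B := by
        refine (liminf_le_liminf (Eventually.of_forall hB)).trans ?_
        simp

theorem contDiff_div_of_ne_zero_on_tsupport {φ τ : Rd d → ℂ} (hφ : ContDiff ℝ ∞ φ)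
    (hτ : ContDiff ℝ ∞ τ) (h : ∀ ξ ∈ tsupport φ, τ ξ ≠ 0) :
    ContDiff ℝ ∞ (fun ξ => φ ξ / τ ξ) := by
  rw [contDiff_iff_contDiffAt]
  intro ξ
  by_cases hξ : ξ ∈ tsupport φ
  · simp_rw [div_eq_mul_inv]
    exact hφ.contDiffAt.mul (hτ.contDiffAt.inv (h ξ hξ))
  · have : (fun ξ => φ ξ / τ ξ) =ᶠ[𝓝 ξ] fun _ => 0 := by
      filter_upwards [notMem_tsupport_iff_eventuallyEq.1 hξ] with η hη
      rw [hη]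
      simp
    exact contDiffAt_const.congr_of_eventuallyEq this

end FourierL1

/-! ### Sums of dominated families -/

section Symbols

variable {d : ℕ} {I J : Type*} {O : Opens (Rd d)} {A : I → Rd d ≃L[ℝ] Rd d} {b : I → Rd d}
  {Q' : I → Set (Rd d)} {φ : I → 𝓓(O, ℂ)} {h : J → Rd d → ℝ} {m : I → J → Rd d → ℝ≥0∞} {M : ℝ}

/-- Families of smooth nonnegative functions `h_j` whose pullbacks `h_j ∘ S_i` have pure partial
derivatives up to order `d + 1` dominated by functions `m_{i,j}` with
`∑_j ‖m_{i,j}‖_{L^{d+1}(Q_i')} ≤ M`, uniformly in `i`. -/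
structure IsDominatedFamily (A : I → Rd d ≃L[ℝ] Rd d) (b : I → Rd d) (Q' : I → Set (Rd d))
    (h : J → Rd d → ℝ) (m : I → J → Rd d → ℝ≥0∞) (M : ℝ) : Prop where
  const_nonneg : 0 ≤ M
  contDiff : ∀ j, ContDiff ℝ ∞ (h j)
  nonneg : ∀ j ξ, 0 ≤ h j ξ
  measurable : ∀ i j, Measurable (m i j)
  bound : ∀ i j (l : Fin d), ∀ k ≤ d + 1, ∀ ξ,
    ‖(dirDeriv (coordVec l))^[k] (fun η => h j (affMap (A i) (b i) η)) ξ‖ₑ ≤ m i j ξ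
  sum_le : ∀ i, ∑' j, localNorm (Q' i) (m i j) ≤ ENNReal.ofReal M

theorem contDiff_ofReal_comp {f : Rd d → ℝ} (hf : ContDiff ℝ ∞ f) :
    ContDiff ℝ ∞ (fun ξ => (f ξ : ℂ)) :=
  Complex.ofRealCLM.contDiff.comp hf

theorem norm_dirDeriv_iterate_ofReal (v : Rd d) {f : Rd d → ℝ} (hf : ContDiff ℝ ∞ f) (k : ℕ)
    (ξ : Rd d) : ‖(dirDeriv v)^[k] (fun η => (f η : ℂ)) ξ‖ = ‖(dirDeriv v)^[k] f ξ‖ := by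
  have := congrFun (dirDeriv_iterate_clm Complex.ofRealCLM v hf k) ξ
  simp only [Complex.ofRealCLM_apply] at this
  rw [this, Complex.norm_real]

/-- The sets `Q_i'` are uniformly bounded, hence of uniformly bounded volume. -/
theorem IsAffinelyGeneratedCover.exists_volume_le (hQ : IsAffinelyGeneratedCover O A b Q') :
    ∃ V : ℝ≥0∞, 1 ≤ V ∧ V < ⊤ ∧ ∀ i, volume (Q' i) ≤ V := by
  obtain ⟨R, hR⟩ := hQ.bounded
  refine ⟨max 1 (volume (Metric.closedBall (0 : Rd d) R)), le_max_left _ _,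
    max_lt ENNReal.one_lt_top measure_closedBall_lt_top, fun i => le_trans ?_ (le_max_right _ _)⟩
  exact measure_mono fun ξ hξ => by simpa using hR i ξ hξ

theorem pullback_eq_zero (hQ : IsAffinelyGeneratedCover O A b Q') (hφ : IsRegularPartition A b Q' φ)
    (i : I) {ξ : Rd d} (hξ : ξ ∉ Q' i) : φ i (affMap (A i) (b i) ξ) = 0 := by
  refine (hφ.isSubordinatePartition hQ).eq_zero i _ ?_
  rintro ⟨η, hη, he⟩
  have : η = ξ := (affHomeomorph (A i) (b i)).injective he
  exact hξ (this ▸ hη)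

/-- The `L^1`-norm of `𝓕 (φ_i h_j)` is controlled by `‖m_{i,j}‖_{L^{d+1}(Q_i')}`, with a constant
that depends neither on `i` and `j` nor on the family. -/
theorem IsDominatedFamily.lintegral_fourier_mul_le (hd : 1 ≤ d)
    (hQ : IsAffinelyGeneratedCover O A b Q') (hφ : IsRegularPartition A b Q' φ) :
    ∃ C : ℝ≥0∞, C < ⊤ ∧ ∀ {h : J → Rd d → ℝ} {m : I → J → Rd d → ℝ≥0∞} {M : ℝ},
      IsDominatedFamily A b Q' h m M → ∀ i j,
        ∫⁻ w, ‖𝓕 (fun ξ => φ i ξ * (h j ξ : ℂ)) w‖ₑ ≤ C * localNorm (Q' i) (m i j) := by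
  obtain ⟨V, hV1, hVt, hV⟩ := hQ.exists_volume_le
  set R : ℝ := (maxRegularityConst (d + 1) A b φ).toReal with hR
  have hR0 : 0 ≤ R := ENNReal.toReal_nonneg
  -- `R + 1` instead of `R` keeps `D` nonzero, so that `D * m` is infinite where `m` is
  set D : ℝ≥0∞ := ENNReal.ofReal (2 ^ (d + 1) * (R + 1)) with hD
  have hD0 : D ≠ 0 := (ENNReal.ofReal_pos.2 (by positivity)).ne'
  refine ⟨ENNReal.ofReal (((d : ℝ) + 1) / Real.pi ^ d) * (D * V),
    ENNReal.mul_lt_top ENNReal.ofReal_lt_top (ENNReal.mul_lt_top ENNReal.ofReal_lt_top hVt),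
    fun {h m M} hh i j => ?_⟩
  rw [← lintegral_fourier_comp_affMap (A i) (b i) (fun ξ => φ i ξ * (h j ξ : ℂ))]
  have hφs := contDiff_test_comp_affMap (φ i) (A i) (b i)
  have hhr : ContDiff ℝ ∞ (fun η => h j (affMap (A i) (b i) η)) :=
    (hh.contDiff j).comp (contDiff_affMap _ _)
  have hhs := contDiff_ofReal_comp hhr
  have hcs : HasCompactSupport (fun ξ => φ i (affMap (A i) (b i) ξ)) :=
    hasCompactSupport_comp_affMap (φ i).hasCompactSupport _ _
  refine (lintegral_fourier_le_setLIntegral hd (hφs.mul hhs) hcs.mul_right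
    (hQ.isOpen i).measurableSet (fun ξ hξ => by rw [pullback_eq_zero hQ hφ i hξ, zero_mul])
    (v := fun ξ => D * m i j ξ) fun l k hk => Eventually.of_forall fun ξ _ => ?_).trans ?_
  · by_cases ht : m i j ξ = ⊤
    · simp only [ht, ENNReal.mul_top hD0, le_top]
    have h1 := norm_dirDeriv_iterate_mul_le (coordVec l) ξ hφs hhs (k := k) (R := R)
      (m := (m i j ξ).toReal) (fun s hs => hφ.norm_dirDeriv_iterate_le (hs.trans hk) i l ξ)
      (fun s hs => by
        rw [norm_dirDeriv_iterate_ofReal _ hhr, ← toReal_enorm]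
        exact ENNReal.toReal_mono ht (hh.bound i j l s (hs.trans hk) ξ))
    rw [← ofReal_norm, ← ENNReal.ofReal_toReal ht, hD, ← ENNReal.ofReal_mul (by positivity)]
    refine ENNReal.ofReal_le_ofReal (h1.trans ?_)
    rw [mul_assoc]
    have hm0 : 0 ≤ (m i j ξ).toReal := ENNReal.toReal_nonneg
    gcongr
    · norm_num
    · linarith
  · rw [lintegral_const_mul _ (hh.measurable i j), mul_assoc, mul_assoc, mul_comm V]
    gcongr
    exact setLIntegral_le_localNorm_mul (hh.measurable i j) hV1 (hV i)

/-- `t = ∑_j h_j`. -/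
noncomputable def familySum (h : J → Rd d → ℝ) (ξ : Rd d) : ℝ := ∑' j, h j ξ

/-- Uniform bounds for `φ_i h_j` that are summable over `j`, from Fourier inversion and the
summability of `‖𝓕 (φ_i h_j)‖_{L^1}`. -/
theorem IsDominatedFamily.exists_summable_bound (hd : 1 ≤ d)
    (hQ : IsAffinelyGeneratedCover O A b Q') (hφ : IsRegularPartition A b Q' φ)
    (hh : IsDominatedFamily A b Q' h m M) (i : I) :
    ∃ u : J → ℝ, Summable u ∧ ∀ j ξ, ‖φ i ξ‖ * h j ξ ≤ u j := by
  obtain ⟨C, hC, hle⟩ := IsDominatedFamily.lintegral_fourier_mul_le (J := J) hd hQ hφ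
  have hsum : ∑' j, ∫⁻ w, ‖𝓕 (fun ξ => φ i ξ * (h j ξ : ℂ)) w‖ₑ < ⊤ := by
    refine (ENNReal.tsum_le_tsum fun j => hle hh i j).trans_lt ?_
    rw [ENNReal.tsum_mul_left]
    exact ENNReal.mul_lt_top hC ((hh.sum_le i).trans_lt ENNReal.ofReal_lt_top)
  refine ⟨_, ENNReal.summable_toReal hsum.ne, fun j ξ => ?_⟩
  have hlt := (ENNReal.le_tsum j).trans_lt hsum
  have hs : IsSymbol (fun ξ => φ i ξ * (h j ξ : ℂ)) :=
    isSymbol_of_lintegral_lt_top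
      ((φ i).continuous.mul (contDiff_ofReal_comp (hh.contDiff j)).continuous)
      (φ i).hasCompactSupport.mul_right hlt
  have := ENNReal.toReal_mono hlt.ne (hs.enorm_le ξ)
  rwa [toReal_enorm, norm_mul, Complex.norm_real, Real.norm_of_nonneg (hh.nonneg j ξ)] at this

theorem IsSubordinatePartition.exists_ne_zero {Q : I → Set (Rd d)}
    (hφ : IsSubordinatePartition O Q φ) {ξ : Rd d} (hξ : ξ ∈ O) : ∃ i, φ i ξ ≠ 0 := by
  by_contra! h0
  have h1 := hφ.sum_eq_one ξ hξ
  simp only [h0] at h1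
  exact zero_ne_one (hasSum_zero.unique h1)

/-- The Weierstrass M-test in the neighborhood of `ξ` where some `φ_i` stays away from zero. -/
theorem IsDominatedFamily.summable_and_continuousAt (hd : 1 ≤ d)
    (hQ : IsAffinelyGeneratedCover O A b Q') (hφ : IsRegularPartition A b Q' φ)
    (hh : IsDominatedFamily A b Q' h m M) {ξ : Rd d} (hξ : ξ ∈ O) :
    Summable (fun j => h j ξ) ∧ ContinuousAt (familySum h) ξ := by
  obtain ⟨i, hi⟩ := (hφ.isSubordinatePartition hQ).exists_ne_zero hξ
  obtain ⟨u, hu, hle⟩ := hh.exists_summable_bound hd hQ hφ i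
  -- on `U` the factor `φ_i` can be divided out of the bounds
  set ε := ‖φ i ξ‖ / 2 with hε
  have hε0 : 0 < ε := half_pos (norm_pos_iff.2 hi)
  let U : Set (Rd d) := {η | ε < ‖φ i η‖}
  have hU : IsOpen U := isOpen_lt continuous_const (φ i).continuous.norm
  have hξU : ξ ∈ U := half_lt_self (norm_pos_iff.2 hi)
  have hb : ∀ j, ∀ η ∈ U, h j η ≤ ε⁻¹ * u j := fun j η hη => by
    rw [← div_eq_inv_mul, le_div_iff₀ hε0, mul_comm]
    refine le_trans ?_ (hle j η)
    have := hh.nonneg j η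
    gcongr
    exact le_of_lt hη
  have hs : Summable fun j => ε⁻¹ * u j := hu.mul_left _
  refine ⟨Summable.of_nonneg_of_le (fun j => hh.nonneg j ξ) (fun j => hb j ξ hξU) hs, ?_⟩
  have : ContinuousOn (familySum h) U :=
    continuousOn_tsum (fun j => (hh.contDiff j).continuous.continuousOn) hs fun j η hη => by
      rw [Real.norm_of_nonneg (hh.nonneg j η)]
      exact hb j η hη
  exact this.continuousAt (hU.mem_nhds hξU)

theorem IsDominatedFamily.continuousOn (hd : 1 ≤ d)
    (hQ : IsAffinelyGeneratedCover O A b Q') (hφ : IsRegularPartition A b Q' φ)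
    (hh : IsDominatedFamily A b Q' h m M) : ContinuousOn (familySum h) O := fun _ hξ =>
  (hh.summable_and_continuousAt hd hQ hφ hξ).2.continuousWithinAt

/-- Unconditional sums over a countable index set are limits of sequences of partial sums, as needed
for dominated convergence and Fatou's lemma. -/
theorem exists_seq_finset_tendsto_atTop [Countable J] (F₀ : Finset J) :
    ∃ F : ℕ → Finset J, (∀ n, F₀ ⊆ F n) ∧ Tendsto F atTop atTop := by
  classical
  obtain ⟨s, hs⟩ := exists_seq_tendsto (atTop : Filter (Finset J))
  exact ⟨fun n => s n ∪ F₀, fun n => Finset.subset_union_right,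
    tendsto_atTop_mono (fun n => Finset.subset_union_left) hs⟩

/-- The sum of a dominated family is tame: the bounds for `𝓕 (φ_i h_j)` add up, and pass to the
limit of the partial sums. -/
theorem IsDominatedFamily.isTame [Countable J] (hd : 1 ≤ d)
    (hQ : IsAffinelyGeneratedCover O A b Q') (hφ : IsRegularPartition A b Q' φ)
    (hh : IsDominatedFamily A b Q' h m M) : IsTame φ (fun ξ => (familySum h ξ : ℂ)) := by
  obtain ⟨C, hC, hle⟩ := IsDominatedFamily.lintegral_fourier_mul_le (J := J) hd hQ hφ
  have hcont : ContinuousOn (fun ξ => (familySum h ξ : ℂ)) O :=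
    Complex.continuous_ofReal.comp_continuousOn (hh.continuousOn hd hQ hφ)
  refine ⟨hcont, lt_of_le_of_lt (iSup_le fun i => ?_)
    (ENNReal.mul_lt_top hC (ENNReal.ofReal_lt_top (r := M)))⟩
  rw [eLpNorm_fourierInv]
  obtain ⟨F, -, hF⟩ := exists_seq_finset_tendsto_atTop (∅ : Finset J)
  have hzero : ∀ ξ ∉ O, φ i ξ = 0 := fun ξ => test_eq_zero_of_notMem _
  have hsum : ∀ ξ ∈ O, Summable (fun j => h j ξ) := fun ξ hξ =>
    (hh.summable_and_continuousAt hd hQ hφ hξ).1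
  have hcs : ∀ j, Continuous (fun ξ => φ i ξ * (h j ξ : ℂ)) := fun j =>
    (φ i).continuous.mul (contDiff_ofReal_comp (hh.contDiff j)).continuous
  refine lintegral_fourier_le_of_tendsto (f := fun n ξ => ∑ j ∈ F n, φ i ξ * (h j ξ : ℂ))
    (G := fun ξ => ‖φ i ξ * (familySum h ξ : ℂ)‖) (fun n => ?_) ?_ (fun n ξ => ?_) (fun ξ => ?_)
    (fun n => ?_)
  · exact (continuous_finsetSum _ fun j _ => hcs j).aestronglyMeasurable
  · exact ((continuous_test_mul (φ i) hcont).integrable_of_hasCompactSupport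
      (φ i).hasCompactSupport.mul_right).norm
  · by_cases hξ : ξ ∈ O
    · rw [← Finset.mul_sum, norm_mul, norm_mul, ← Complex.ofReal_sum, Complex.norm_real,
        Complex.norm_real, Real.norm_of_nonneg (Finset.sum_nonneg fun j _ => hh.nonneg j ξ),
        Real.norm_of_nonneg (show 0 ≤ familySum h ξ from tsum_nonneg fun j => hh.nonneg j ξ)]
      gcongr
      exact (hsum ξ hξ).sum_le_tsum _ fun j _ => hh.nonneg j ξ
    · simp [hzero ξ hξ]
  · by_cases hξ : ξ ∈ O
    · simp_rw [← Finset.mul_sum, ← Complex.ofReal_sum]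
      refine Tendsto.const_mul _ ((Complex.continuous_ofReal.tendsto _).comp ?_)
      exact (hsum ξ hξ).hasSum.comp hF
    · simp [hzero ξ hξ]
  · calc _ ≤ ∫⁻ w, ∑ j ∈ F n, ‖𝓕 (fun ξ => φ i ξ * (h j ξ : ℂ)) w‖ₑ := by
          refine lintegral_mono fun w => ?_
          rw [fourier_sum_apply (F n) fun j _ => (hcs j).integrable_of_hasCompactSupport
            (φ i).hasCompactSupport.mul_right]
          exact enorm_sum_le _ _
      _ = ∑ j ∈ F n, ∫⁻ w, ‖𝓕 (fun ξ => φ i ξ * (h j ξ : ℂ)) w‖ₑ :=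
          lintegral_finsetSum _ fun j _ => (continuous_fourier
            ((hcs j).integrable_of_hasCompactSupport
              (φ i).hasCompactSupport.mul_right)).enorm.measurable
      _ ≤ ∑ j ∈ F n, C * localNorm (Q' i) (m i j) := Finset.sum_le_sum fun j _ => hle hh i j
      _ ≤ C * ENNReal.ofReal M := by
          rw [← Finset.mul_sum]
          gcongr
          exact (ENNReal.sum_le_tsum _).trans (hh.sum_le i)

end Symbols

/-! ### Inverses of sums of dominated families -/

section InverseSymbols

variable {d : ℕ} {I J : Type*} {O : Opens (Rd d)} {A : I → Rd d ≃L[ℝ] Rd d} {b : I → Rd d}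
  {Q' : I → Set (Rd d)} {φ : I → 𝓓(O, ℂ)} {h : J → Rd d → ℝ} {m : I → J → Rd d → ℝ≥0∞} {M : ℝ}

/-- On compact sets, finitely many of the `h_j` almost attain a lower bound for the full sum. -/
theorem exists_finset_lt_sum {K : Set (Rd d)} (hK : IsCompact K) (hc : ∀ j, Continuous (h j))
    (h0 : ∀ j ξ, 0 ≤ h j ξ) (hs : ∀ ξ ∈ K, Summable fun j => h j ξ) {a : ℝ}
    (ha : ∀ ξ ∈ K, a < ∑' j, h j ξ) :
    ∃ F₀ : Finset J, ∀ F, F₀ ⊆ F → ∀ ξ ∈ K, a ≤ ∑ j ∈ F, h j ξ := by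
  classical
  have hmono : ∀ {F G : Finset J}, F ⊆ G → ∀ ξ, ∑ j ∈ F, h j ξ ≤ ∑ j ∈ G, h j ξ := fun hFG ξ =>
    Finset.sum_le_sum_of_subset_of_nonneg hFG fun j _ _ => h0 j ξ
  obtain ⟨F₀, hF₀⟩ := hK.elim_directed_cover (fun F : Finset J => {ξ | a < ∑ j ∈ F, h j ξ})
    (fun F => isOpen_lt continuous_const (continuous_finsetSum _ fun j _ => hc j))
    (fun ξ hξ => by
      obtain ⟨F, hF⟩ := ((hs ξ hξ).hasSum.eventually_const_lt (ha ξ hξ)).exists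
      exact mem_iUnion.2 ⟨F, hF⟩)
    (fun F G => ⟨F ∪ G,
      fun ξ hξ => lt_of_lt_of_le hξ (hmono Finset.subset_union_left ξ),
      fun ξ hξ => lt_of_lt_of_le hξ (hmono Finset.subset_union_right ξ)⟩)
  exact ⟨F₀, fun F hF ξ hξ => (le_of_lt (hF₀ hξ)).trans (hmono hF ξ)⟩

/-- The quotient of `φ_i` by a finite partial sum. The factor `(M/a)^{d+1}` comes from the quotient
estimate for derivatives and Minkowski's inequality in `L^{d+1}(Q_i')`. -/
theorem IsDominatedFamily.lintegral_fourier_div_le (hd : 1 ≤ d)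
    (hQ : IsAffinelyGeneratedCover O A b Q') (hφ : IsRegularPartition A b Q' φ)
    (hh : IsDominatedFamily A b Q' h m M) (i : I) {a : ℝ} (ha : 0 < a) (F : Finset J)
    (hF : ∀ ξ ∈ tsupport (φ i), a ≤ ∑ j ∈ F, h j ξ) :
    ∫⁻ w, ‖𝓕 (fun ξ => φ i ξ / ((∑ j ∈ F, h j ξ : ℝ) : ℂ)) w‖ₑ ≤
      ENNReal.ofReal (((d : ℝ) + 1) / Real.pi ^ d * ((d + 1).factorial * 2 ^ (d + 1) *
        ((maxRegularityConst (d + 1) A b φ).toReal * a⁻¹ * (M / a) ^ (d + 1)))) := by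
  set R : ℝ := (maxRegularityConst (d + 1) A b φ).toReal with hR
  have hR0 : 0 ≤ R := ENNReal.toReal_nonneg
  have hM0 := hh.const_nonneg
  set S := affMap (A i) (b i) with hS
  set f : Rd d → ℂ := fun ξ => φ i ξ / ((∑ j ∈ F, h j ξ : ℝ) : ℂ) with hf
  have hτ₀ : ContDiff ℝ ∞ (fun ξ => ((∑ j ∈ F, h j ξ : ℝ) : ℂ)) :=
    contDiff_ofReal_comp (ContDiff.sum fun j _ => hh.contDiff j)
  have hφ₀ : ContDiff ℝ ∞ (φ i : Rd d → ℂ) := (φ i).contDiff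
  have hne : ∀ ξ ∈ tsupport (φ i), ((∑ j ∈ F, h j ξ : ℝ) : ℂ) ≠ 0 := fun ξ hξ =>
    Complex.ofReal_ne_zero.2 (ha.trans_le (hF ξ hξ)).ne'
  have hf₀ : ContDiff ℝ ∞ f := contDiff_div_of_ne_zero_on_tsupport hφ₀ hτ₀ hne
  have hfs : HasCompactSupport f := by
    simp_rw [hf, div_eq_mul_inv]
    exact (φ i).hasCompactSupport.mul_right
  set ψ : Rd d → ℂ := fun ξ => f (S ξ) with hψ
  set τ : Rd d → ℂ := fun ξ => ((∑ j ∈ F, h j (S ξ) : ℝ) : ℂ) with hτ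
  have hψs : ContDiff ℝ ∞ ψ := hf₀.comp (contDiff_affMap _ _)
  have hτs : ContDiff ℝ ∞ τ := hτ₀.comp (contDiff_affMap _ _)
  have hhs : ∀ j, ContDiff ℝ ∞ (fun ξ => h j (S ξ)) := fun j =>
    (hh.contDiff j).comp (contDiff_affMap _ _)
  have hprod : (fun ξ => φ i (S ξ)) = fun ξ => τ ξ * ψ ξ := by
    funext ξ
    by_cases hξ : φ i (S ξ) = 0
    · simp [hψ, hf, hξ]
    · exact (mul_div_cancel₀ _ (hne _ (subset_tsupport _ hξ))).symm
  set μ : Rd d → ℝ≥0∞ := fun ξ => ∑ j ∈ F, m i j ξ with hμ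
  have hμm : Measurable μ := Finset.measurable_fun_sum _ fun j _ => hh.measurable i j
  have hμn : localNorm (Q' i) μ ≤ ENNReal.ofReal M :=
    (localNorm_sum_le F (Q' i) (hh.measurable i)).trans
      ((ENNReal.sum_le_tsum _).trans (hh.sum_le i))
  have hμpow : ∫⁻ ξ in Q' i, μ ξ ^ (d + 1) ≤ ENNReal.ofReal (M ^ (d + 1)) := by
    rw [← localNorm_pow, ENNReal.ofReal_pow hM0]
    gcongr
  have hμfin : ∀ᵐ ξ, ξ ∈ Q' i → μ ξ < ⊤ := by
    have h1 := ae_lt_top (hμm.pow_const (d + 1)) (hμpow.trans_lt ENNReal.ofReal_lt_top).ne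
    filter_upwards [(ae_restrict_iff' (hQ.isOpen i).measurableSet).1 h1] with ξ h2 hξ
    exact (ENNReal.pow_lt_top_iff (n := d + 1)).1 (h2 hξ) |>.resolve_right (by omega)
  set D : ℝ := (d + 1).factorial * 2 ^ (d + 1) * (R * a⁻¹ * (a⁻¹) ^ (d + 1)) with hD
  have hD0 : 0 ≤ D := by positivity
  rw [← lintegral_fourier_comp_affMap (A i) (b i) f]
  refine (lintegral_fourier_le_setLIntegral hd hψs (hasCompactSupport_comp_affMap hfs _ _)
    (hQ.isOpen i).measurableSet (fun ξ hξ => by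
      change φ i (affMap (A i) (b i) ξ) / _ = 0
      rw [pullback_eq_zero hQ hφ i hξ, zero_div])
    (v := fun ξ => ENNReal.ofReal D * μ ξ ^ (d + 1)) fun l k hk => ?_).trans ?_
  · filter_upwards [hμfin, ae_dirDeriv_iterate_eq_zero_of_eq_zero (coordVec l) hψs k]
      with ξ hfin h0 hξ
    -- where `φ_i ∘ S_i` vanishes the lower bound for the partial sum may fail, but there almost all
    -- derivatives of the quotient vanish as well
    by_cases hz : φ i (S ξ) = 0
    · rw [h0 (by simp [hψ, hf, hz]), enorm_zero]
      exact zero_le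
    have ht := (hfin hξ).ne
    have htj : ∀ j ∈ F, m i j ξ ≠ ⊤ := fun j hj => ((ENNReal.sum_lt_top.1 (hfin hξ)) j hj).ne
    have hlow : a ≤ ∑ j ∈ F, h j (S ξ) := hF _ (subset_tsupport _ hz)
    have hτn : ‖τ ξ‖ = ∑ j ∈ F, h j (S ξ) := by
      rw [hτ, Complex.norm_real, Real.norm_of_nonneg (ha.le.trans hlow)]
    have hτb : ∀ s ≤ d + 1, ‖(dirDeriv (coordVec l))^[s] τ ξ‖ ≤ (μ ξ).toReal := by
      intro s hs
      rw [hτ, norm_dirDeriv_iterate_ofReal _ (ContDiff.sum fun j _ => hhs j),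
        dirDeriv_iterate_sum F _ hhs, hμ, ENNReal.toReal_sum htj]
      refine (norm_sum_le _ _).trans (Finset.sum_le_sum fun j hj => ?_)
      rw [← toReal_enorm]
      exact ENNReal.toReal_mono (htj j hj) (hh.bound i j l s hs ξ)
    -- the pointwise bound `μ` also bounds the partial sum itself, hence is at least `a`
    have ham : a ≤ (μ ξ).toReal := by
      refine (hlow.trans_eq hτn.symm).trans ?_
      simpa using hτb 0 (Nat.zero_le _)
    have hq := norm_dirDeriv_iterate_quotient_le (coordVec l) ξ hψs hτs hprod ha ham
      (hlow.trans_eq hτn.symm) (fun s hs => hφ.norm_dirDeriv_iterate_le hs i l ξ) hτb k hk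
    rw [← ofReal_norm, ← ENNReal.ofReal_toReal ht, ← ENNReal.ofReal_pow ENNReal.toReal_nonneg,
      ← ENNReal.ofReal_mul hD0]
    refine ENNReal.ofReal_le_ofReal (hq.trans ?_)
    have h1 : 1 ≤ (μ ξ).toReal / a := (one_le_div ha).2 ham
    have h2 : (k.factorial : ℝ) ≤ (d + 1).factorial := by exact_mod_cast Nat.factorial_le hk
    calc (k.factorial : ℝ) * 2 ^ k * (R * a⁻¹ * ((μ ξ).toReal / a) ^ k)
        ≤ (d + 1).factorial * 2 ^ (d + 1) * (R * a⁻¹ * ((μ ξ).toReal / a) ^ (d + 1)) := by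
          gcongr
          norm_num
      _ = D * (μ ξ).toReal ^ (d + 1) := by
          rw [hD, div_eq_mul_inv, mul_pow]
          ring
  · rw [lintegral_const_mul _ (hμm.pow_const _)]
    calc _ ≤ ENNReal.ofReal (((d : ℝ) + 1) / Real.pi ^ d) *
          (ENNReal.ofReal D * ENNReal.ofReal (M ^ (d + 1))) := by gcongr
      _ = _ := by
        rw [← ENNReal.ofReal_mul hD0, ← ENNReal.ofReal_mul (by positivity), hD,
          div_eq_mul_inv M, mul_pow M]
        congr 1
        ring

/-- The bound for `φ_i / t`, as a limit of the bounds for the quotients by partial sums. -/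
theorem IsDominatedFamily.lintegral_fourier_inv_le [Countable J] (hd : 1 ≤ d)
    (hQ : IsAffinelyGeneratedCover O A b Q') (hφ : IsRegularPartition A b Q' φ)
    (hh : IsDominatedFamily A b Q' h m M) {a : ℝ} (ha : 0 < a)
    (hlow : ∀ ξ ∈ O, a ≤ familySum h ξ) (i : I) :
    ∫⁻ w, ‖𝓕 (fun ξ => φ i ξ * ((familySum h ξ : ℂ))⁻¹) w‖ₑ ≤
      ENNReal.ofReal (((d : ℝ) + 1) / Real.pi ^ d * ((d + 1).factorial * 2 ^ (d + 1) *
        ((maxRegularityConst (d + 1) A b φ).toReal * a⁻¹ * (M / a) ^ (d + 1)))) := by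
  have hsum : ∀ ξ ∈ O, Summable (fun j => h j ξ) := fun ξ hξ =>
    (hh.summable_and_continuousAt hd hQ hφ hξ).1
  have hzero : ∀ ξ ∉ O, φ i ξ = 0 := fun ξ => test_eq_zero_of_notMem _
  -- it suffices to prove the estimate for all smaller positive lower bounds `a'`, which on the
  -- compact support of `φ_i` hold for large finite partial sums
  have key : ∀ a', 0 < a' → a' < a →
      ∫⁻ w, ‖𝓕 (fun ξ => φ i ξ * ((familySum h ξ : ℂ))⁻¹) w‖ₑ ≤
      ENNReal.ofReal (((d : ℝ) + 1) / Real.pi ^ d * ((d + 1).factorial * 2 ^ (d + 1) *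
        ((maxRegularityConst (d + 1) A b φ).toReal * a'⁻¹ * (M / a') ^ (d + 1)))) := by
    intro a' ha' haa
    obtain ⟨F₀, hF₀⟩ := exists_finset_lt_sum (h := h) (a := a') (φ i).hasCompactSupport
      (fun j => (hh.contDiff j).continuous) hh.nonneg
      (fun ξ hξ => hsum ξ ((φ i).tsupport_subset hξ))
      (fun ξ hξ => haa.trans_le (hlow ξ ((φ i).tsupport_subset hξ)))
    obtain ⟨F, hF, hFt⟩ := exists_seq_finset_tendsto_atTop F₀
    refine lintegral_fourier_le_of_tendsto
      (f := fun n ξ => φ i ξ / ((∑ j ∈ F n, h j ξ : ℝ) : ℂ)) (G := fun ξ => ‖φ i ξ‖ * a'⁻¹)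
      (fun n => ?_) ((integrable_test (φ i)).norm.mul_const _) (fun n ξ => ?_) (fun ξ => ?_)
      (fun n => hh.lintegral_fourier_div_le hd hQ hφ i ha' (F n) (hF₀ _ (hF n)))
    · have hm : Measurable fun ξ => ((∑ j ∈ F n, h j ξ : ℝ) : ℂ) :=
        (Complex.continuous_ofReal.comp (continuous_finsetSum _ fun j _ =>
          (hh.contDiff j).continuous)).measurable
      exact ((φ i).continuous.measurable.div hm).aestronglyMeasurable
    · by_cases hξ : φ i ξ = 0
      · simp [hξ]
      · have h1 := hF₀ _ (hF n) ξ (subset_tsupport _ hξ)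
        rw [norm_div, Complex.norm_real, Real.norm_of_nonneg (ha'.le.trans h1), div_eq_mul_inv]
        gcongr
    · by_cases hξ : ξ ∈ O
      · simp_rw [div_eq_mul_inv]
        refine Tendsto.const_mul _ (Tendsto.inv₀ ?_ ?_)
        · exact (Complex.continuous_ofReal.tendsto _).comp ((hsum ξ hξ).hasSum.comp hFt)
        · exact Complex.ofReal_ne_zero.2 (ha.trans_le (hlow ξ hξ)).ne'
      · simp [hzero ξ hξ]
  have hcont : ContinuousAt (fun x : ℝ => ENNReal.ofReal (((d : ℝ) + 1) / Real.pi ^ d *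
      ((d + 1).factorial * 2 ^ (d + 1) *
        ((maxRegularityConst (d + 1) A b φ).toReal * x⁻¹ * (M / x) ^ (d + 1))))) a := by
    refine ENNReal.continuous_ofReal.continuousAt.comp ?_
    have h1 : ContinuousAt (fun x : ℝ => x⁻¹) a := continuousAt_inv₀ ha.ne'
    have h2 : ContinuousAt (fun x : ℝ => M / x) a := continuousAt_const.div continuousAt_id ha.ne'
    exact continuousAt_const.mul (continuousAt_const.mul
      ((continuousAt_const.mul h1).mul (h2.pow _)))
  refine ge_of_tendsto (hcont.mono_left nhdsWithin_le_nhds : Tendsto _ (𝓝[<] a) _) ?_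
  filter_upwards [Ioo_mem_nhdsLT ha] with x hx
  exact key x hx.1 hx.2

/-- If the sum `t = ∑_j h_j` of a dominated family is bounded below by `a > 0`, then `1/t` is tame.
-/
theorem IsDominatedFamily.isTame_inv [Countable J] (hd : 1 ≤ d)
    (hQ : IsAffinelyGeneratedCover O A b Q') (hφ : IsRegularPartition A b Q' φ)
    (hh : IsDominatedFamily A b Q' h m M) {a : ℝ} (ha : 0 < a)
    (hlow : ∀ ξ ∈ O, a ≤ familySum h ξ) :
    IsTame φ (fun ξ => ((familySum h ξ : ℂ))⁻¹) := by
  refine ⟨ContinuousOn.inv₀ (Complex.continuous_ofReal.comp_continuousOn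
    (hh.continuousOn hd hQ hφ)) fun ξ hξ =>
      Complex.ofReal_ne_zero.2 (ha.trans_le (hlow ξ hξ)).ne', ?_⟩
  refine lt_of_le_of_lt (iSup_le fun i => ?_)
    (ENNReal.ofReal_lt_top (r := ((d : ℝ) + 1) / Real.pi ^ d * ((d + 1).factorial * 2 ^ (d + 1) *
      ((maxRegularityConst (d + 1) A b φ).toReal * a⁻¹ * (M / a) ^ (d + 1)))))
  rw [eLpNorm_fourierInv]
  exact hh.lintegral_fourier_inv_le hd hQ hφ ha hlow i

/-- If the sum `t = ∑_j h_j` of a dominated family is bounded below by `a > 0`, then the Fourier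
multiplier with symbol `t` is boundedly invertible, with the norm bound in terms of `C_d`. -/
theorem IsDominatedFamily.isMultiplierInvertible [Countable J] (hd : 1 ≤ d)
    (hQ : IsAffinelyGeneratedCover O A b Q') (hφ : IsRegularPartition A b Q' φ)
    (hh : IsDominatedFamily A b Q' h m M) {a : ℝ} (ha : 0 < a)
    (hlow : ∀ ξ ∈ O, a ≤ familySum h ξ) :
    IsMultiplierInvertible (affCover A b Q') φ (fun ξ => (familySum h ξ : ℂ))
      (ENNReal.ofReal (dimConst d) * ((coverNumber (affCover A b Q') : ℕ∞) : ℝ≥0∞) ^ 2 *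
        bapuConst φ * maxRegularityConst (d + 1) A b φ *
        ENNReal.ofReal (a⁻¹ * (M / a) ^ (d + 1))) := by
  have hsub := hφ.isSubordinatePartition hQ
  have hM0 := hh.const_nonneg
  refine isMultiplierInvertible_of_mul_eq_one hd hsub (hh.isTame hd hQ hφ)
    (hh.isTame_inv hd hQ hφ ha hlow) (fun ξ hξ => inv_mul_cancel₀
      (Complex.ofReal_ne_zero.2 (ha.trans_le (hlow ξ hξ)).ne')) ?_
  have ht : tameConst φ (fun ξ => ((familySum h ξ : ℂ))⁻¹) ≤
      ENNReal.ofReal (dimConst d) * maxRegularityConst (d + 1) A b φ *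
        ENNReal.ofReal (a⁻¹ * (M / a) ^ (d + 1)) := by
    refine iSup_le fun i => ?_
    rw [eLpNorm_fourierInv]
    refine (hh.lintegral_fourier_inv_le hd hQ hφ ha hlow i).trans ?_
    rw [← ENNReal.ofReal_toReal (hφ.maxRegularityConst_lt_top (d + 1)).ne,
      ENNReal.toReal_ofReal ENNReal.toReal_nonneg]
    set R := (maxRegularityConst (d + 1) A b φ).toReal with hR
    have hR0 : 0 ≤ R := ENNReal.toReal_nonneg
    have hc := mul_factorial_le_dimConst hd
    have hc0 : 0 ≤ dimConst d := le_trans (by positivity) hc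
    rw [← ENNReal.ofReal_mul hc0, ← ENNReal.ofReal_mul (by positivity)]
    refine ENNReal.ofReal_le_ofReal ?_
    calc _ = (((d : ℝ) + 1) / Real.pi ^ d * ((d + 1).factorial * 2 ^ (d + 1))) *
          (R * (a⁻¹ * (M / a) ^ (d + 1))) := by ring
      _ ≤ dimConst d * (R * (a⁻¹ * (M / a) ^ (d + 1))) := by gcongr
      _ = _ := by ring
  set N : ℝ≥0∞ := ((coverNumber (affCover A b Q') : ℕ∞) : ℝ≥0∞) with hN
  have h1 := one_le_coverNumber_mul_bapuConst hsub
  rw [← hN] at h1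
  -- the natural bound carries only one factor `N_Q`; the others are supplied by `h1`
  calc N * tameConst φ (fun ξ => ((familySum h ξ : ℂ))⁻¹)
      ≤ N * (ENNReal.ofReal (dimConst d) * maxRegularityConst (d + 1) A b φ *
        ENNReal.ofReal (a⁻¹ * (M / a) ^ (d + 1))) * 1 := by
        rw [mul_one]
        gcongr
    _ ≤ N * (ENNReal.ofReal (dimConst d) * maxRegularityConst (d + 1) A b φ *
        ENNReal.ofReal (a⁻¹ * (M / a) ^ (d + 1))) * (N * bapuConst φ) := by gcongr
    _ = _ := by ring

end InverseSymbols

/-! ### Fourier transforms of the generators -/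

section Generators

variable {d : ℕ}

theorem fourier_const_mul (c : ℂ) (f : Rd d → ℂ) (ξ : Rd d) :
    𝓕 (fun x => c * f x) ξ = c * 𝓕 f ξ := by
  rw [Real.fourier_eq', Real.fourier_eq', ← integral_const_mul]
  refine integral_congr_ae (Eventually.of_forall fun x => ?_)
  simp only [smul_eq_mul]
  ring

theorem fourier_modulate (b : Rd d) (f : Rd d → ℂ) (ξ : Rd d) :
    𝓕 (modulate b f) ξ = 𝓕 f (ξ - b) := by
  rw [Real.fourier_eq', Real.fourier_eq']
  refine integral_congr_ae (Eventually.of_forall fun x => ?_)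
  simp only [modulate, smul_eq_mul]
  rw [← mul_assoc, ← Complex.exp_add, inner_sub_right, real_inner_comm x b]
  congr 2
  push_cast
  ring

theorem fourier_comp_transpose (A : Rd d ≃L[ℝ] Rd d) (f : Rd d → ℂ) (ξ : Rd d) :
    𝓕 (fun x => f (transpose A x)) ξ = ((absDet A)⁻¹ : ℝ) * 𝓕 f (A.symm ξ) := by
  have h1 : 𝓕 (fun x => f (transpose A x)) ξ =
      ∫ x, (fun y => Complex.exp (((-2 * Real.pi * inner ℝ y (A.symm ξ) : ℝ) : ℂ) * Complex.I) •
        f y) (transposeEquiv A x) := by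
    rw [Real.fourier_eq']
    refine integral_congr_ae (Eventually.of_forall fun x => ?_)
    have : inner ℝ (transpose A x) (A.symm ξ) = inner ℝ x ξ := by
      rw [inner_transpose, A.apply_symm_apply]
    change _ = Complex.exp (((-2 * Real.pi * inner ℝ (transpose A x) (A.symm ξ) : ℝ) : ℂ) *
      Complex.I) • f (transpose A x)
    rw [this]
  rw [h1, integral_comp_equiv (transposeEquiv A) (fun y =>
    Complex.exp (((-2 * Real.pi * inner ℝ y (A.symm ξ) : ℝ) : ℂ) * Complex.I) • f y),
    absDet_transposeEquiv, Real.fourier_eq', Complex.real_smul]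

theorem fourier_natural (A : Rd d ≃L[ℝ] Rd d) (b : Rd d) (g : Rd d → ℂ) (ξ : Rd d) :
    𝓕 (natural A b g) ξ = 𝓕 g (affMap A b ξ) := by
  have h1 : natural A b g =
      fun x => (((absDet A)⁻¹ : ℝ) : ℂ) * (fun x => modulate (-b) g (transpose A.symm x)) x := rfl
  rw [h1, fourier_const_mul, fourier_comp_transpose, absDet_symm, inv_inv, ← mul_assoc,
    ← Complex.ofReal_mul, inv_mul_cancel₀ (absDet_pos A).ne', Complex.ofReal_one, one_mul,
    fourier_modulate, sub_neg_eq_add]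
  rfl

/-- `𝓕 g_j = |det A_j|^{-1/2} 𝓕 g ∘ S_j⁻¹`; the exponent is written as `1/2 - 1`. -/
theorem fourier_structuredGenerator {J : Type*} (A : J → Rd d ≃L[ℝ] Rd d) (b : J → Rd d)
    (g : Rd d → ℂ) (j : J) (ξ : Rd d) :
    𝓕 (structuredGenerator A b g j) ξ =
      ((Real.sqrt (absDet (A j)) * (absDet (A j))⁻¹ : ℝ) : ℂ) *
        𝓕 g (affMapInv (A j) (b j) ξ) := by
  have h1 : structuredGenerator A b g j =
      fun x => ((Real.sqrt (absDet (A j)) : ℝ) : ℂ) *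
        modulate (b j) (fun y => g (transpose (A j) y)) x := rfl
  rw [h1, fourier_const_mul, fourier_modulate, fourier_comp_transpose, ← mul_assoc,
    ← Complex.ofReal_mul]
  rfl

theorem norm_fourier_structuredGenerator_sq {J : Type*} (A : J → Rd d ≃L[ℝ] Rd d) (b : J → Rd d)
    (g : Rd d → ℂ) (j : J) (ξ : Rd d) :
    ‖𝓕 (structuredGenerator A b g j) ξ‖ ^ 2 =
      (absDet (A j))⁻¹ * ‖𝓕 g (affMapInv (A j) (b j) ξ)‖ ^ 2 := by
  have hp := absDet_pos (A j)
  rw [fourier_structuredGenerator, norm_mul, mul_pow, Complex.norm_real, Real.norm_eq_abs, sq_abs,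
    mul_pow, Real.sq_sqrt hp.le]
  congr 1
  field_simp

theorem absDet_eq_of_eq_smul_transpose {A C : Rd d ≃L[ℝ] Rd d} {δ : ℝ} (hδ : 0 < δ)
    (h : (C : Rd d →L[ℝ] Rd d) = δ • transpose A.symm) :
    absDet C = δ ^ d * (absDet A)⁻¹ := by
  have h1 : (C : Rd d →ₗ[ℝ] Rd d) =
      δ • ((transposeEquiv A.symm : Rd d ≃L[ℝ] Rd d) : Rd d →ₗ[ℝ] Rd d) := by
    ext1 x
    exact congrArg (fun L : Rd d →L[ℝ] Rd d => L x) h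
  rw [← absDet_symm, ← absDet_transposeEquiv A.symm]
  unfold absDet
  rw [h1, LinearMap.det_smul, abs_mul, abs_of_pos (pow_pos hδ _), finrank_euclideanSpace_fin]

end Generators

/-! ### Partial derivatives and directional derivatives -/

section PartialDerivatives

variable {d : ℕ} {F : Type*} [NormedAddCommGroup F] [NormedSpace ℝ F]

theorem contDiff_partialDeriv_iterate (l : Fin d) {f : Rd d → F} (hf : ContDiff ℝ ∞ f) (k : ℕ) :
    ContDiff ℝ ∞ ((partialDeriv l)^[k] f) := contDiff_dirDeriv_iterate (coordVec l) hf k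

theorem contDiff_foldr_partialDeriv (ν : Fin d → ℕ) {f : Rd d → F} (hf : ContDiff ℝ ∞ f)
    (L : List (Fin d)) :
    ContDiff ℝ ∞ (L.foldr (fun l h => (partialDeriv l)^[ν l] h) f) := by
  induction L with
  | nil => exact hf
  | cons l L ih => exact contDiff_partialDeriv_iterate l ih _

theorem contDiff_multiDeriv (ν : Fin d → ℕ) {f : Rd d → F} (hf : ContDiff ℝ ∞ f) :
    ContDiff ℝ ∞ (multiDeriv ν f) := contDiff_foldr_partialDeriv ν hf _

theorem measurable_maxDeriv (n : ℕ) {f : Rd d → F} (hf : ContDiff ℝ ∞ f) :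
    Measurable (maxDeriv n f) :=
  Measurable.iSup fun ν => (contDiff_multiDeriv ν.1 hf).continuous.enorm.measurable

/-- Partial derivatives commute. -/
theorem partialDeriv_comm (l m : Fin d) {f : Rd d → F} (hf : ContDiff ℝ ∞ f) :
    partialDeriv l (partialDeriv m f) = partialDeriv m (partialDeriv l f) := by
  funext x
  have hd : DifferentiableAt ℝ (fderiv ℝ f) x :=
    (hf.fderiv_right (m := ∞) (by simp)).differentiable (by simp) x
  have h1 : ∀ v w : Rd d, fderiv ℝ (fun y => fderiv ℝ f y v) x w = fderiv ℝ (fderiv ℝ f) x w v :=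
    fun v w => by
      rw [fderiv_clm_apply hd (differentiableAt_const v)]
      simp
  have hs : IsSymmSndFDerivAt ℝ f x := hf.contDiffAt.isSymmSndFDerivAt
    (by rw [minSmoothness_of_isRCLikeNormedField]; exact ENat.LEInfty.out)
  exact (h1 _ _).trans ((hs _ _).trans (h1 _ _).symm)

theorem partialDeriv_iterate_comm (l m : Fin d) {f : Rd d → F} (hf : ContDiff ℝ ∞ f) (k : ℕ) :
    partialDeriv l ((partialDeriv m)^[k] f) = (partialDeriv m)^[k] (partialDeriv l f) := by
  induction k with
  | zero => rfl
  | succ k ih =>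
    rw [Function.iterate_succ_apply', Function.iterate_succ_apply', ← ih,
      partialDeriv_comm l m (contDiff_partialDeriv_iterate m hf k)]

/-- Raising one entry of a multi-index. The order in which `multiDeriv` applies the partial
derivatives is irrelevant as they commute. -/
theorem partialDeriv_multiDeriv (l : Fin d) (ν : Fin d → ℕ) {f : Rd d → F}
    (hf : ContDiff ℝ ∞ f) : partialDeriv l (multiDeriv ν f) = multiDeriv (ν + Pi.single l 1) f := by
  have hcongr : ∀ L : List (Fin d), l ∉ L →
      L.foldr (fun m h => (partialDeriv m)^[ν m] h) f =
        L.foldr (fun m h => (partialDeriv m)^[(ν + Pi.single l 1 : Fin d → ℕ) m] h) f := by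
    intro L
    induction L with
    | nil => simp
    | cons m L ih =>
      intro hl
      rw [List.mem_cons, not_or] at hl
      rw [List.foldr_cons, List.foldr_cons, ih hl.2, Pi.add_apply,
        Pi.single_eq_of_ne (Ne.symm hl.1), add_zero]
  have key : ∀ L : List (Fin d), L.Nodup → l ∈ L →
      partialDeriv l (L.foldr (fun m h => (partialDeriv m)^[ν m] h) f) =
        L.foldr (fun m h => (partialDeriv m)^[(ν + Pi.single l 1 : Fin d → ℕ) m] h) f := by
    intro L
    induction L with
    | nil => simp
    | cons m L ih =>
      intro hL hl
      rw [List.nodup_cons] at hL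
      rw [List.foldr_cons, List.foldr_cons]
      by_cases hm : m = l
      · subst hm
        rw [← hcongr L hL.1, Pi.add_apply, Pi.single_eq_same, Function.iterate_succ_apply']
      · have hl' : l ∈ L := (List.mem_cons.1 hl).resolve_left (Ne.symm hm)
        rw [partialDeriv_iterate_comm l m (contDiff_foldr_partialDeriv ν hf L), ih hL.2 hl',
          Pi.add_apply, Pi.single_eq_of_ne hm, add_zero]
  exact key _ (List.nodup_finRange d) (List.mem_finRange l)

theorem dirDeriv_eq_sum (v : Rd d) (f : Rd d → F) :
    dirDeriv v f = fun x => ∑ m, v m • partialDeriv m f x := by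
  funext x
  have hv : v = ∑ m, v m • (EuclideanSpace.single m (1 : ℝ) : Rd d) := by
    ext l
    simp [Pi.single_apply]
  conv_lhs => rw [dirDeriv, hv, map_sum]
  simp only [map_smul]
  rfl

/-- Directional derivatives are controlled by the partial derivatives: expand
`(v · ∂)^k = (∑_m v_m ∂_m)^k`. -/
theorem norm_dirDeriv_iterate_multiDeriv_le (v x : Rd d) {n : ℕ} {B : ℝ} {f : Rd d → F}
    (hf : ContDiff ℝ ∞ f)
    (hB : ∀ α : Fin d → ℕ, ∑ l, α l ≤ n → ‖multiDeriv α f x‖ ≤ B) (k : ℕ) :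
    ∀ α : Fin d → ℕ, ∑ l, α l + k ≤ n →
      ‖(dirDeriv v)^[k] (multiDeriv α f) x‖ ≤ (∑ m, |v m|) ^ k * B := by
  induction k with
  | zero =>
    intro α hα
    simpa using hB α hα
  | succ k ih =>
    intro α hα
    have h1 : dirDeriv v (multiDeriv α f) =
        fun x => ∑ m, (v m • ContinuousLinearMap.id ℝ F)
          (multiDeriv (α + Pi.single m 1) f x) := by
      rw [dirDeriv_eq_sum]
      simp only [partialDeriv_multiDeriv _ α hf]
      rfl
    have hs : ∀ m : Fin d, ContDiff ℝ ∞ (multiDeriv (α + Pi.single m 1) f) := fun m =>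
      contDiff_multiDeriv _ hf
    rw [Function.iterate_succ_apply, h1, dirDeriv_iterate_sum Finset.univ v
      (f := fun m x => (v m • ContinuousLinearMap.id ℝ F) (multiDeriv (α + Pi.single m 1) f x))
      (fun m => (v m • ContinuousLinearMap.id ℝ F).contDiff.comp (hs m)), pow_succ', mul_assoc,
      Finset.sum_mul]
    refine (norm_sum_le _ _).trans (Finset.sum_le_sum fun m _ => ?_)
    rw [dirDeriv_iterate_clm _ _ (hs m)]
    simp only [_root_.smul_apply, ContinuousLinearMap.id_apply]
    rw [norm_smul, Real.norm_eq_abs]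
    gcongr
    refine ih _ ?_
    simp only [Pi.add_apply, Finset.sum_add_distrib, Finset.sum_pi_single', Finset.mem_univ,
      if_true]
    omega

theorem norm_dirDeriv_iterate_le_mul_maxDeriv (v x : Rd d) {k n : ℕ} (hk : k ≤ n)
    {f : Rd d → F} (hf : ContDiff ℝ ∞ f) :
    ‖(dirDeriv v)^[k] f x‖ ≤ (∑ m, |v m|) ^ k * (maxDeriv n f x).toReal := by
  have hfin : maxDeriv n f x < ⊤ := by
    have := finite_multiIndex (d := d) n
    have : Nonempty {α : Fin d → ℕ // ∑ l, α l ≤ n} := ⟨⟨0, by simp⟩⟩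
    obtain ⟨α, hα⟩ := exists_eq_ciSup_of_finite
      (f := fun ν : {ν : Fin d → ℕ // ∑ l, ν l ≤ n} => ‖multiDeriv ν.1 f x‖ₑ)
    rw [maxDeriv, ← hα]
    exact enorm_lt_top
  have h0 : multiDeriv (0 : Fin d → ℕ) f = f := by
    have key : ∀ L : List (Fin d),
        L.foldr (fun m h => (partialDeriv m)^[(0 : Fin d → ℕ) m] h) f = f := by
      intro L
      induction L with
      | nil => rfl
      | cons m L ih => simp
    exact key _
  have := norm_dirDeriv_iterate_multiDeriv_le v x (n := n) hf (fun α hα => by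
    have h2 := ENNReal.toReal_mono hfin.ne
      (le_iSup (fun ν : {ν : Fin d → ℕ // ∑ l, ν l ≤ n} => ‖multiDeriv ν.1 f x‖ₑ) ⟨α, hα⟩)
    rwa [toReal_enorm] at h2) k 0 (by simp [hk])
  rwa [h0] at this

theorem dirDeriv_iterate_comp_affine (B : Rd d →L[ℝ] Rd d) (e v : Rd d) {f : Rd d → F}
    (hf : ContDiff ℝ ∞ f) (k : ℕ) :
    (dirDeriv v)^[k] (fun ξ => f (B ξ + e)) = fun ξ => (dirDeriv (B v))^[k] f (B ξ + e) := by
  induction k generalizing f with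
  | zero => rfl
  | succ k ih =>
    rw [Function.iterate_succ_apply, Function.iterate_succ_apply,
      ← ih (contDiff_dirDeriv (B v) hf)]
    congr 1
    funext ξ
    have h1 : HasFDerivAt (fun ξ => B ξ + e) B ξ := B.hasFDerivAt.add_const e
    have h2 := ((hf.differentiable (by simp)) (B ξ + e)).hasFDerivAt.comp ξ h1
    change fderiv ℝ (f ∘ fun ξ => B ξ + e) ξ v = _
    rw [h2.fderiv]
    rfl

theorem sum_abs_le_mul_norm (v : Rd d) : ∑ m, |v m| ≤ d * ‖v‖ := by
  calc ∑ m, |v m| ≤ ∑ _m : Fin d, ‖v‖ := Finset.sum_le_sum fun m _ => PiLp.norm_apply_le v m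
    _ = d * ‖v‖ := by simp

/-- Derivatives of the squared modulus of `f` along an affine map, by the Leibniz rule for `|f|² = f
* conj f`. The chain rule turns `v` into the direction `B v`, whose coordinates have absolute sum at
most `d ‖B‖`; the factor `2^n` is the sum of the binomial coefficients. -/
theorem norm_dirDeriv_iterate_norm_sq_comp_le (hd : 1 ≤ d) (B : Rd d →L[ℝ] Rd d) (e v x : Rd d)
    (hv : ‖v‖ ≤ 1) {f : Rd d → ℂ} (hf : ContDiff ℝ ∞ f) {k n : ℕ} (hk : k ≤ n) :
    ‖(dirDeriv v)^[k] (fun ξ => ‖f (B ξ + e)‖ ^ 2) x‖ ≤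
      (2 * d) ^ n * max 1 (‖B‖ ^ n) * (maxDeriv n f (B x + e)).toReal ^ 2 := by
  set β : ℝ := d * ‖B‖ with hβ
  set y := B x + e with hy
  set μ := (maxDeriv n f y).toReal with hμ
  have hμ0 : 0 ≤ μ := ENNReal.toReal_nonneg
  have hd' : (1 : ℝ) ≤ d := by exact_mod_cast hd
  have hβ0 : 0 ≤ β := by positivity
  have haff : ContDiff ℝ ∞ (fun ξ => f (B ξ + e)) := hf.comp (B.contDiff.add contDiff_const)
  have hconj : ContDiff ℝ ∞ (fun ξ => Complex.conjCLE (f (B ξ + e))) :=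
    Complex.conjCLE.contDiff.comp haff
  have hsq : ContDiff ℝ ∞ (fun ξ => ‖f (B ξ + e)‖ ^ 2) := haff.norm_sq ℝ
  have hb : ∀ s ≤ n, ‖(dirDeriv v)^[s] (fun ξ => f (B ξ + e)) x‖ ≤ β ^ s * μ := by
    intro s hs
    rw [dirDeriv_iterate_comp_affine B e v hf]
    refine (norm_dirDeriv_iterate_le_mul_maxDeriv (B v) y hs hf).trans ?_
    gcongr
    refine (sum_abs_le_mul_norm _).trans ?_
    rw [hβ]
    gcongr
    exact (B.le_opNorm v).trans (mul_le_of_le_one_right (norm_nonneg _) hv)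
  have hb' : ∀ s ≤ n, ‖(dirDeriv v)^[s] (fun ξ => Complex.conjCLE (f (B ξ + e))) x‖ ≤
      β ^ s * μ := by
    intro s hs
    have h1 := congrFun (dirDeriv_iterate_clm
      (Complex.conjCLE : ℂ →L[ℝ] ℂ) v haff s) x
    simp only [ContinuousLinearEquiv.coe_coe] at h1
    rw [h1, Complex.conjCLE_apply, RCLike.norm_conj]
    exact hb s hs
  rw [← norm_dirDeriv_iterate_ofReal v hsq]
  have he : (fun ξ => ((‖f (B ξ + e)‖ ^ 2 : ℝ) : ℂ)) =
      fun ξ => f (B ξ + e) * Complex.conjCLE (f (B ξ + e)) := by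
    funext ξ
    rw [Complex.conjCLE_apply, Complex.mul_conj, Complex.normSq_eq_norm_sq]
  rw [he, dirDeriv_iterate_mul v x haff hconj]
  calc _ ≤ ∑ s ∈ Finset.range (k + 1), (k.choose s : ℝ) * (β ^ k * μ ^ 2) := by
        refine (norm_sum_le _ _).trans (Finset.sum_le_sum fun s hs => ?_)
        have hsk : s ≤ k := Nat.lt_succ_iff.1 (Finset.mem_range.1 hs)
        rw [norm_mul, norm_mul, Complex.norm_natCast, mul_assoc]
        refine mul_le_mul_of_nonneg_left ?_ (Nat.cast_nonneg _)
        calc _ ≤ (β ^ s * μ) * (β ^ (k - s) * μ) :=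
              mul_le_mul (hb s (hsk.trans hk)) (hb' _ ((Nat.sub_le _ _).trans hk))
                (norm_nonneg _) (by positivity)
          _ = β ^ (s + (k - s)) * μ ^ 2 := by
              rw [pow_add]
              ring
          _ = β ^ k * μ ^ 2 := by rw [Nat.add_sub_cancel' hsk]
    _ = 2 ^ k * (β ^ k * μ ^ 2) := by
        rw [← Finset.sum_mul]
        congr 1
        exact_mod_cast Nat.sum_range_choose k
    _ = (2 * d) ^ k * ‖B‖ ^ k * μ ^ 2 := by
        rw [hβ, mul_pow, mul_pow]
        ring
    _ ≤ _ := by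
        gcongr
        · linarith
        · by_cases h1 : ‖B‖ ≤ 1
          · exact (pow_le_one₀ (norm_nonneg _) h1).trans (le_max_left _ _)
          · exact (pow_le_pow_right₀ (not_le.1 h1).le hk).trans (le_max_right _ _)

end PartialDerivatives

/-! ### The symbols of general and of structured systems -/

section Systems

variable {d : ℕ} {I J : Type*} {O : Opens (Rd d)} {A : I → Rd d ≃L[ℝ] Rd d} {b : I → Rd d}
  {Q' : I → Set (Rd d)} {φ : I → 𝓓(O, ℂ)}

theorem localNorm_const_mul (Q : Set (Rd d)) (c : ℝ≥0∞) {m : Rd d → ℝ≥0∞}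
    (hm : Measurable m) : localNorm Q (fun ξ => c * m ξ) = c * localNorm Q m := by
  have h0 : (0 : ℝ) ≤ 1 / ((d : ℝ) + 1) := by positivity
  simp only [localNorm, mul_pow]
  rw [lintegral_const_mul _ (hm.pow_const _), ENNReal.mul_rpow_of_nonneg _ _ h0,
    ← ENNReal.rpow_natCast, ← ENNReal.rpow_mul]
  push_cast
  rw [mul_one_div_cancel (by positivity), ENNReal.rpow_one]

/-- The terms of the Calderón sum of a general system form a dominated family. -/
theorem isDominatedFamily_of_mainTermBound_lt_top {C : J → Rd d ≃L[ℝ] Rd d} {g : J → Rd d → ℂ}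
    (hg : ∀ j, IsGenerator (g j)) (hM : mainTermBound A b Q' C g < ⊤) :
    IsDominatedFamily A b Q' (fun j ξ => (absDet (C j))⁻¹ * ‖𝓕 (g j) ξ‖ ^ 2)
      (fun i j ξ => ENNReal.ofReal (absDet (C j))⁻¹ *
        maxDeriv (d + 1) (fun η => ‖𝓕 (natural (A i) (b i) (g j)) η‖ ^ 2) ξ)
      (mainTermBound A b Q' C g).toReal := by
  have hsq : ∀ j, ContDiff ℝ ∞ (fun ξ => ‖𝓕 (g j) ξ‖ ^ 2) := fun j =>
    (hg j).contDiff_fourier.norm_sq ℝ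
  have hnat : ∀ i j, (fun η => ‖𝓕 (natural (A i) (b i) (g j)) η‖ ^ 2) =
      fun η => ‖𝓕 (g j) (affMap (A i) (b i) η)‖ ^ 2 := fun i j => by
    funext η
    rw [fourier_natural]
  have hsq' : ∀ i j, ContDiff ℝ ∞ (fun η => ‖𝓕 (natural (A i) (b i) (g j)) η‖ ^ 2) :=
    fun i j => by
      rw [hnat]
      exact (hsq j).comp (contDiff_affMap (A i) (b i))
  have hc : ∀ j, 0 ≤ (absDet (C j))⁻¹ := fun j => (inv_pos.2 (absDet_pos (C j))).le
  refine ⟨ENNReal.toReal_nonneg, fun j => contDiff_const.mul (hsq j),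
    fun j ξ => mul_nonneg (hc j) (sq_nonneg _),
    fun i j => (measurable_maxDeriv _ (hsq' i j)).const_mul _, fun i j l k hk ξ => ?_, fun i => ?_⟩
  · have h1 := congrFun (dirDeriv_iterate_clm ((absDet (C j))⁻¹ • ContinuousLinearMap.id ℝ ℝ)
      (coordVec l) (hsq' i j) k) ξ
    simp only [_root_.smul_apply, ContinuousLinearMap.id_apply, smul_eq_mul] at h1
    simp only [fourier_natural] at h1
    rw [h1, enorm_mul, Real.enorm_of_nonneg (hc j)]
    gcongr
    rw [hnat i j]
    exact enorm_dirDeriv_iterate_le_maxDeriv l hk _ ξ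
  · rw [ENNReal.ofReal_toReal hM.ne]
    refine le_trans (le_of_eq (tsum_congr fun j => ?_)) (le_iSup (fun i => ∑' j,
      ENNReal.ofReal (absDet (C j))⁻¹ * (∫⁻ ξ in Q' i,
        maxDeriv (d + 1) (fun η => ‖𝓕 (natural (A i) (b i) (g j)) η‖ ^ 2) ξ ^ (d + 1))
          ^ ((1 : ℝ) / (d + 1))) i)
    exact localNorm_const_mul _ _ (measurable_maxDeriv _ (hsq' i j))

/-- The transition map `S_j⁻¹ S_i` has the linear part `A_j⁻¹ A_i`. -/
theorem affMapInv_affMap (A₁ A₂ : Rd d ≃L[ℝ] Rd d) (b₁ b₂ ξ : Rd d) :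
    affMapInv A₂ b₂ (affMap A₁ b₁ ξ) =
      ((A₂.symm : Rd d →L[ℝ] Rd d) ∘L (A₁ : Rd d →L[ℝ] Rd d)) ξ + A₂.symm (b₁ - b₂) := by
  simp only [affMapInv, affMap, ContinuousLinearMap.comp_apply, ContinuousLinearEquiv.coe_coe,
    map_sub, map_add]
  abel

/-- The terms of the Calderón sum of a structured system form a dominated family. -/
theorem isDominatedFamily_of_structuredBound_lt_top (hd : 1 ≤ d) {A : J → Rd d ≃L[ℝ] Rd d}
    {b : J → Rd d} {Q' : J → Set (Rd d)} {g : Rd d → ℂ} (hg : IsGenerator g)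
    (hM : structuredBound A b Q' g < ⊤) {c : ℝ} (hc : 0 ≤ c) :
    IsDominatedFamily A b Q' (fun j ξ => c * ‖𝓕 g (affMapInv (A j) (b j) ξ)‖ ^ 2)
      (fun i j ξ => ENNReal.ofReal (c * (2 * d) ^ (d + 1)) * (ENNReal.ofReal
        (max 1 (‖((A j).symm : Rd d →L[ℝ] Rd d) ∘L (A i : Rd d →L[ℝ] Rd d)‖ ^ (d + 1))) *
          maxDeriv (d + 1) (𝓕 g) (affMapInv (A j) (b j) (affMap (A i) (b i) ξ)) ^ 2))
      (c * (2 * d) ^ (d + 1) * (structuredBound A b Q' g).toReal) := by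
  have hgs := hg.contDiff_fourier
  have hinv : ∀ j, ContDiff ℝ ∞ (affMapInv (A j) (b j)) := fun j =>
    (A j).symm.contDiff.comp (contDiff_id.sub contDiff_const)
  have hmeas : ∀ i j, Measurable fun ξ =>
      maxDeriv (d + 1) (𝓕 g) (affMapInv (A j) (b j) (affMap (A i) (b i) ξ)) := fun i j =>
    (measurable_maxDeriv _ hgs).comp
      ((hinv j).continuous.comp (contDiff_affMap (A i) (b i)).continuous).measurable
  refine ⟨by positivity, fun j => contDiff_const.mul ((hgs.comp (hinv j)).norm_sq ℝ),
    fun j ξ => by positivity,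
    fun i j => (((hmeas i j).pow_const 2).const_mul _).const_mul _, fun i j l k hk ξ => ?_,
    fun i => ?_⟩
  · set B := ((A j).symm : Rd d →L[ℝ] Rd d) ∘L (A i : Rd d →L[ℝ] Rd d) with hB
    set e := (A j).symm (b i - b j) with he
    have hsq : ContDiff ℝ ∞ (fun ξ => ‖𝓕 g (B ξ + e)‖ ^ 2) :=
      (hgs.comp (B.contDiff.add contDiff_const)).norm_sq ℝ
    have h1 := congrFun (dirDeriv_iterate_clm (c • ContinuousLinearMap.id ℝ ℝ)
      (coordVec l) hsq k) ξ
    simp only [_root_.smul_apply, ContinuousLinearMap.id_apply, smul_eq_mul] at h1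
    have h2 := norm_dirDeriv_iterate_norm_sq_comp_le hd B e (coordVec l) ξ
      (by simp [coordVec]) hgs hk
    simp only [affMapInv_affMap]
    rw [h1, enorm_mul, Real.enorm_of_nonneg hc, ENNReal.ofReal_mul hc, mul_assoc]
    gcongr
    by_cases ht : maxDeriv (d + 1) (𝓕 g) (B ξ + e) = ⊤
    · have hp1 : ENNReal.ofReal ((2 * (d : ℝ)) ^ (d + 1)) ≠ 0 :=
        (ENNReal.ofReal_pos.2 (pow_pos (by have : (0 : ℝ) < d := by exact_mod_cast hd
                                           linarith) _)).ne'
      have hp2 : ENNReal.ofReal (max 1 (‖B‖ ^ (d + 1))) ≠ 0 :=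
        (ENNReal.ofReal_pos.2 (zero_lt_one.trans_le (le_max_left _ _))).ne'
      rw [ht, ENNReal.top_pow two_ne_zero, ENNReal.mul_top hp2, ENNReal.mul_top hp1]
      exact le_top
    · rw [← ENNReal.ofReal_toReal ht, ← ENNReal.ofReal_pow ENNReal.toReal_nonneg,
        ← ENNReal.ofReal_mul (by positivity), ← ENNReal.ofReal_mul (by positivity), ← ofReal_norm,
        ← mul_assoc]
      exact ENNReal.ofReal_le_ofReal h2
  · rw [ENNReal.ofReal_mul (q := (structuredBound A b Q' g).toReal) (by positivity),
      ENNReal.ofReal_toReal hM.ne]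
    have h1 : ∀ j, localNorm (Q' i) (fun ξ => ENNReal.ofReal (c * (2 * d) ^ (d + 1)) *
        (ENNReal.ofReal
        (max 1 (‖((A j).symm : Rd d →L[ℝ] Rd d) ∘L (A i : Rd d →L[ℝ] Rd d)‖ ^ (d + 1))) *
          maxDeriv (d + 1) (𝓕 g) (affMapInv (A j) (b j) (affMap (A i) (b i) ξ)) ^ 2)) =
        ENNReal.ofReal (c * (2 * d) ^ (d + 1)) * (ENNReal.ofReal
        (max 1 (‖((A j).symm : Rd d →L[ℝ] Rd d) ∘L (A i : Rd d →L[ℝ] Rd d)‖ ^ (d + 1))) *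
        (∫⁻ ξ in Q' i, maxDeriv (d + 1) (𝓕 g)
          (affMapInv (A j) (b j) (affMap (A i) (b i) ξ)) ^ (2 * (d + 1)))
            ^ ((1 : ℝ) / (d + 1))) := fun j => by
      rw [localNorm_const_mul _ _ (((hmeas i j).pow_const 2).const_mul _),
        localNorm_const_mul _ _ ((hmeas i j).pow_const 2)]
      simp only [localNorm, pow_mul]
    rw [tsum_congr h1, ENNReal.tsum_mul_left]
    gcongr
    exact le_iSup (fun i => ∑' j, ENNReal.ofReal
      (max 1 (‖((A j).symm : Rd d →L[ℝ] Rd d) ∘L (A i : Rd d →L[ℝ] Rd d)‖ ^ (d + 1))) *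
        (∫⁻ ξ in Q' i, maxDeriv (d + 1) (𝓕 g)
          (affMapInv (A j) (b j) (affMap (A i) (b i) ξ)) ^ (2 * (d + 1)))
            ^ ((1 : ℝ) / (d + 1))) i

theorem ofReal_inv_mul_div_pow {a : ℝ} (ha : 0 < a) {M : ℝ≥0∞} (hM : M < ⊤) (n : ℕ) :
    ENNReal.ofReal (a⁻¹ * (M.toReal / a) ^ n) =
      (ENNReal.ofReal a)⁻¹ * (M / ENNReal.ofReal a) ^ n := by
  rw [ENNReal.ofReal_mul (by positivity), ENNReal.ofReal_inv_of_pos ha,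
    ENNReal.ofReal_pow (by positivity), ENNReal.ofReal_div_of_pos ha, ENNReal.ofReal_toReal hM.ne]

theorem IsMultiplierInvertible.mono {Q : I → Set (Rd d)} {h : Rd d → ℂ} {K K' : ℝ≥0∞}
    (hK : IsMultiplierInvertible Q φ h K) (hle : K ≤ K') : IsMultiplierInvertible Q φ h K' :=
  fun p q _ _ w hw => by
    obtain ⟨T, hT, hn⟩ := hK p q w hw
    exact ⟨T, hT, hn.trans hle⟩

/-- The factor `|det A_j|⁻¹` from `|𝓕 g_j|²` cancels against `|det C_j|⁻¹ = δ^{-d} |det A_j|`. -/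
theorem tZero_structuredGenerator {A C : J → Rd d ≃L[ℝ] Rd d} {b : J → Rd d} {δ : ℝ} (hδ : 0 < δ)
    (hC : ∀ j, (C j : Rd d →L[ℝ] Rd d) = δ • transpose (A j).symm) (g : Rd d → ℂ) :
    tZero C (structuredGenerator A b g) =
      familySum (fun j ξ => (δ ^ d)⁻¹ * ‖𝓕 g (affMapInv (A j) (b j) ξ)‖ ^ 2) := by
  funext ξ
  refine tsum_congr fun j => ?_
  have hp := (absDet_pos (A j)).ne'
  rw [norm_fourier_structuredGenerator_sq, absDet_eq_of_eq_smul_transpose hδ (hC j), mul_inv,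
    inv_inv, ← mul_assoc, mul_assoc _ (absDet (A j)), mul_inv_cancel₀ hp, mul_one]

end Systems

end GSI

theorem mainTheorem4 :
    (∀ (d : ℕ) (_ : 1 ≤ d) (I : Type u) (J : Type v) (_ : Countable J)
      (O : Opens (GSI.Rd d)) (_ : volume (O : Set (GSI.Rd d))ᶜ = 0)
      (A : I → GSI.Rd d ≃L[ℝ] GSI.Rd d) (b : I → GSI.Rd d) (Q' : I → Set (GSI.Rd d))
      (_ : GSI.IsAffinelyGeneratedCover O A b Q')
      (φ : I → 𝓓(O, ℂ)) (_ : GSI.IsRegularPartition A b Q' φ)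
      (C : J → GSI.Rd d ≃L[ℝ] GSI.Rd d) (g : J → GSI.Rd d → ℂ) (_ : ∀ j, GSI.IsGenerator (g j))
      (a B : ℝ) (_ : 0 < a) (_ : 0 < B)
      (_ : ∀ᵐ ξ, a ≤ GSI.tZero C g ξ ∧ GSI.tZero C g ξ ≤ B)
      (_ : GSI.mainTermBound A b Q' C g < ⊤),
      ContinuousOn (GSI.tZero C g) O ∧
      GSI.IsTame φ (fun ξ => (GSI.tZero C g ξ : ℂ)) ∧
      (∀ ξ ∈ O, Summable (fun j => (GSI.absDet (C j))⁻¹ * ‖𝓕 (g j) ξ‖ ^ 2) ∧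
        a ≤ GSI.tZero C g ξ ∧ GSI.tZero C g ξ ≤ B) ∧
      GSI.IsMultiplierInvertible (GSI.affCover A b Q') φ (fun ξ => (GSI.tZero C g ξ : ℂ))
        (ENNReal.ofReal (GSI.dimConst d) *
          ((GSI.coverNumber (GSI.affCover A b Q') : ℕ∞) : ℝ≥0∞) ^ 2 * GSI.bapuConst φ *
          GSI.maxRegularityConst (d + 1) A b φ * (ENNReal.ofReal a)⁻¹ *
          (GSI.mainTermBound A b Q' C g / ENNReal.ofReal a) ^ (d + 1))) ∧
    (∀ (d : ℕ) (_ : 1 ≤ d) (J : Type v) (_ : Countable J)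
      (O : Opens (GSI.Rd d)) (_ : volume (O : Set (GSI.Rd d))ᶜ = 0)
      (A : J → GSI.Rd d ≃L[ℝ] GSI.Rd d) (b : J → GSI.Rd d) (Q' : J → Set (GSI.Rd d))
      (_ : GSI.IsAffinelyGeneratedCover O A b Q')
      (φ : J → 𝓓(O, ℂ)) (_ : GSI.IsRegularPartition A b Q' φ)
      (δ : ℝ) (_ : 0 < δ) (C : J → GSI.Rd d ≃L[ℝ] GSI.Rd d)
      (_ : ∀ j, (C j : GSI.Rd d →L[ℝ] GSI.Rd d) = δ • GSI.transpose (A j).symm)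
      (g : GSI.Rd d → ℂ) (_ : GSI.IsGenerator g)
      (a : ℝ) (_ : 0 < a)
      (_ : ∀ᵐ ξ, ξ ∈ O → a ≤ ∑' j, ‖𝓕 g (GSI.affMapInv (A j) (b j) ξ)‖ ^ 2)
      (_ : GSI.structuredBound A b Q' g < ⊤),
      ContinuousOn (GSI.tZero C (GSI.structuredGenerator A b g)) O ∧
      GSI.IsTame φ (fun ξ => (GSI.tZero C (GSI.structuredGenerator A b g) ξ : ℂ)) ∧
      (∀ ξ ∈ O, Summable (fun j => ‖𝓕 g (GSI.affMapInv (A j) (b j) ξ)‖ ^ 2) ∧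
        a ≤ ∑' j, ‖𝓕 g (GSI.affMapInv (A j) (b j) ξ)‖ ^ 2) ∧
      GSI.IsMultiplierInvertible (GSI.affCover A b Q') φ
        (fun ξ => (GSI.tZero C (GSI.structuredGenerator A b g) ξ : ℂ))
        (ENNReal.ofReal (GSI.dimConst d * (2 * (d : ℝ)) ^ ((d + 1) ^ 2)) *
          ((GSI.coverNumber (GSI.affCover A b Q') : ℕ∞) : ℝ≥0∞) ^ 2 * GSI.bapuConst φ *
          GSI.maxRegularityConst (d + 1) A b φ * (ENNReal.ofReal a)⁻¹ *
          (GSI.structuredBound A b Q' g / ENNReal.ofReal a) ^ (d + 1) *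
          ENNReal.ofReal (δ ^ d))) := by
  refine ⟨?_, ?_⟩
  · intro d hd I J _ O _ A b Q' hQ φ hφ C g hg a B ha _ hab hM
    have hh := GSI.isDominatedFamily_of_mainTermBound_lt_top (A := A) (b := b) (Q' := Q') hg hM
    have hc : ContinuousOn (GSI.tZero C g) O := hh.continuousOn hd hQ hφ
    have hlow : ∀ ξ ∈ O, a ≤ GSI.tZero C g ξ := fun ξ hξ =>
      GSI.le_of_ae_of_continuousOn hc (hab.mono fun _ h _ => h.1) hξ
    have hup : ∀ ξ ∈ O, GSI.tZero C g ξ ≤ B := fun ξ hξ => neg_le_neg_iff.1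
      (GSI.le_of_ae_of_continuousOn hc.neg (hab.mono fun _ h _ => neg_le_neg h.2) hξ)
    refine ⟨hc, hh.isTame hd hQ hφ, fun ξ hξ =>
      ⟨(hh.summable_and_continuousAt hd hQ hφ hξ).1, hlow ξ hξ, hup ξ hξ⟩, ?_⟩
    refine (hh.isMultiplierInvertible hd hQ hφ ha hlow).mono (le_of_eq ?_)
    rw [GSI.ofReal_inv_mul_div_pow ha hM]
    ring
  · intro d hd J _ O _ A b Q' hQ φ hφ δ hδ C hC g hg a ha hae hM
    have hδd : 0 < δ ^ d := pow_pos hδ d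
    have hh := GSI.isDominatedFamily_of_structuredBound_lt_top (A := A) (b := b) (Q' := Q') hd hg hM
      (c := (δ ^ d)⁻¹) (inv_pos.2 hδd).le
    rw [GSI.tZero_structuredGenerator hδ hC]
    have hc := hh.continuousOn hd hQ hφ
    have hval : ∀ ξ, GSI.familySum
        (fun j ξ => (δ ^ d)⁻¹ * ‖𝓕 g (GSI.affMapInv (A j) (b j) ξ)‖ ^ 2) ξ =
        (δ ^ d)⁻¹ * ∑' j, ‖𝓕 g (GSI.affMapInv (A j) (b j) ξ)‖ ^ 2 := fun ξ => tsum_mul_left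
    have hlow : ∀ ξ ∈ O, (δ ^ d)⁻¹ * a ≤ GSI.familySum
        (fun j ξ => (δ ^ d)⁻¹ * ‖𝓕 g (GSI.affMapInv (A j) (b j) ξ)‖ ^ 2) ξ := fun ξ hξ =>
      GSI.le_of_ae_of_continuousOn hc (hae.mono fun η h hη => by
        rw [hval]
        exact mul_le_mul_of_nonneg_left (h hη) (inv_pos.2 hδd).le) hξ
    refine ⟨hc, hh.isTame hd hQ hφ, fun ξ hξ => ⟨?_, ?_⟩, ?_⟩
    · exact (summable_mul_left_iff (inv_pos.2 hδd).ne').1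
        (hh.summable_and_continuousAt hd hQ hφ hξ).1
    · have := hlow ξ hξ
      rw [hval] at this
      exact le_of_mul_le_mul_left this (inv_pos.2 hδd)
    · refine (hh.isMultiplierInvertible hd hQ hφ (mul_pos (inv_pos.2 hδd) ha) hlow).mono
        (le_of_eq ?_)
      have hdim : 0 ≤ GSI.dimConst d := le_trans (by positivity) (GSI.mul_factorial_le_dimConst hd)
      set m := (GSI.structuredBound A b Q' g).toReal with hm
      have h1 : ((δ ^ d)⁻¹ * a)⁻¹ *
          ((δ ^ d)⁻¹ * (2 * d) ^ (d + 1) * m / ((δ ^ d)⁻¹ * a)) ^ (d + 1) =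
          (2 * (d : ℝ)) ^ ((d + 1) ^ 2) * (a⁻¹ * (m / a) ^ (d + 1)) * δ ^ d := by
        have h2 : (δ ^ d)⁻¹ * (2 * d) ^ (d + 1) * m / ((δ ^ d)⁻¹ * a) =
            (2 * d) ^ (d + 1) * (m / a) := by
          field_simp
        rw [h2, mul_pow, ← pow_mul, ← sq, mul_inv, inv_inv]
        ring
      rw [h1, ENNReal.ofReal_mul (by positivity), ENNReal.ofReal_mul (by positivity), hm,
        GSI.ofReal_inv_mul_div_pow ha hM, ENNReal.ofReal_mul hdim]
      ring
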